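/- \textbf{Definitions.} Let $1\le d<n$ be integers, let $C\ge 1$ and $c_0\in(0,\tfrac12]$, and let $B_r(x)$ denote the open ball in $\mathbb R^n$ (Euclidean distance). A closed set $E\subset\mathbb R^n$ with $\operatorname{diam}(E)>0$ belongs to $\mathrm{Reg}_d(C)$ if $$C^{-1}r^d\le \mathcal H^d(B_r(x)\cap E)\le C r^d\qquad\text{for all }x\in E,\ r\in(0,2\operatorname{diam}(E)),$$ and then $\mu:=\mathcal H^d\lfloor_E$. Put $\mathbb J:=\mathbb Z$ if $E$ is unbounded, and $\mathbb J:=\{j\in\mathbb Z: j\ge m\}$ if $E$ is bounded, where $2^{-m}\le\operatorname{diam}(E)<2^{-m+1}$. A \emph{dyadic system} on $E$ (with constant $c_0$) is a collection $\Delta=\bigcup_{j\in\mathbb J}\Delta_j$, where each $\Delta_j$ is a family of pairwise disjoint Borel subsets $Q\subset E$ (\emph{cubes}) such that: (1) $E=\bigcup_{Q\in\Delta_j}Q$ for each $j\in\mathbb J$; (2) if $i\le j$, $Q\in\Delta_i$ and $Q'\in\Delta_j$, then $Q'\subset Q$ or $Q\cap Q'=\emptyset$; (3) if $i<j$ are in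 $\mathbb J$ and $Q'\in\Delta_j$, there is a unique $Q\in\Delta_i$ with $Q'\subset Q$; (4) $\operatorname{diam}(Q)\le c_0^{-1}2^{-j}$ for $Q\in\Delta_j$; (5) for every $Q\in\Delta_j$ there is $x_Q\in E$ with $B_{c_02^{-j}}(x_Q)\cap E\subset Q$. For a cube $Q$ let $2Q:=\{x\in E:\operatorname{dist}(x,Q)\le\operatorname{diam}(Q)\}$. For a nonnegative function $h$ on the bounded Borel subsets of $E$ of positive $\mu$-measure, $a\in(0,\infty)$ and $M\ge0$, we write $E\in\mathrm{GLem}(h,a,M)$ if for every dyadic system $\Delta$ on $E$ with constant $c_0$ and every $Q_0\in\Delta$ $$\sum_{Q\in\Delta,\ Q\subset Q_0}h(2Q)^a\,\mu(Q)\le M\,\mu(Q_0).$$ Let $\mathcal V_d$ be the family of $d$-dimensional affine planes in $\mathbb R^n$, and let $\pi_V$ be the orthogonal projection of $\mathbb R^n$ onto $V\in\mathcal V_d$. For $p\in[1,\infty)$ and a bounded Borel set $S\subset E$ with $\mu(S)>0$ set $$\beta_{p,\mathcal V_d}(S):=\inf_{V\in\mathcal V_d}\left(\frac1{\mu(S)}\int_S\left[\frac{\operatorname{dist}(x,V)}{\operatorname{diam}(S)}\right]^p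 d\mu(x)\right)^{1/p},$$ $$\iota_{p,\mathcal V_d}(S):=\inf_{V\in\mathcal V_d}\left(\frac1{\mu(S)^2}\int_S\int_S\left[\frac{\bigl||x-y|-|\pi_V(x)-\pi_V(y)|\bigr|}{\operatorname{diam}(S)}\right]^p d\mu(x)\,d\mu(y)\right)^{1/p}.$$ \textbf{Theorem.} Let $d\ge1$ be an integer, $C\ge1$, $1\le p\le q<\infty$ and $c_0\in(0,\tfrac12]$. There is a constant $\hat C$, depending only on $d$, $C$, $p$, $q$ and on the constant $c_0$ fixed in the definition of dyadic systems, such that for every integer $n>d$, every $E\subset\mathbb R^n$ with $E\in\mathrm{Reg}_d(C)$, and every $M\ge0$: $$E\in\mathrm{GLem}(\beta_{2p,\mathcal V_d},2q,M)\ \Longrightarrow\ E\in\mathrm{GLem}(\iota_{p,\mathcal V_d},q,\hat C M).$$ In particular, if $c_0=c_0(d,C)$ is chosen as a function of $d$ and $C$, then $\hat C$ depends only on $d$, $C$, $p$, $q$. -/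

import Mathlib

open scoped NNReal ENNReal MeasureTheory

noncomputable section

namespace GeometricLemma

section Metric

variable {X : Type*} [MetricSpace X] [MeasurableSpace X] [BorelSpace X]

/-- `E ∈ Reg_s(C)`: `E` is a closed set of positive diameter, and
`C⁻¹ r ^ s ≤ ℋ^s (B_r(x) ∩ E) ≤ C r ^ s` for all `x ∈ E` and `0 < r < 2 diam E`
(every `r > 0` if `E` is unbounded). -/
structure IsRegular (s C : ℝ) (E : Set X) : Prop where
  s_pos : 0 < s
  one_le : 1 ≤ C
  isClosed : IsClosed E
  diam_pos : 0 < Metric.ediam E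
  lower : ∀ x ∈ E, ∀ r : ℝ, 0 < r → ENNReal.ofReal r < 2 * Metric.ediam E →
    ENNReal.ofReal (C⁻¹ * r ^ s) ≤ μH[s] (Metric.ball x r ∩ E)
  upper : ∀ x ∈ E, ∀ r : ℝ, 0 < r → ENNReal.ofReal r < 2 * Metric.ediam E →
    μH[s] (Metric.ball x r ∩ E) ≤ ENNReal.ofReal (C * r ^ s)

/-- The measure `μ = ℋ^s ⌊ E`. -/
def surfaceMeasure (s : ℝ) (E : Set X) : MeasureTheory.Measure X :=
  (μH[s] : MeasureTheory.Measure X).restrict E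

/-- The set `𝕁` of admissible generations of cubes of `E`. If `E` is unbounded, it is all of `ℤ`.
If `E` is bounded and `2⁻ⁿ ≤ diam E < 2⁻ⁿ⁺¹`, then `2⁻ʲ ≤ diam E` holds exactly for `j ≥ n`. -/
def generations (E : Set X) : Set ℤ :=
  {j | Bornology.IsBounded E → (2 : ℝ) ^ (-j) ≤ Metric.diam E}

/-- A system of dyadic cubes on `E` with constant `c₀`: the cubes of generation `j ∈ 𝕁`
form the family `gen j` (the values `gen j` for `j ∉ 𝕁` play no role). -/
structure DyadicSystem (c₀ : ℝ) (E : Set X) where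
  gen : ℤ → Set (Set X)
  measurable : ∀ j ∈ generations E, ∀ Q ∈ gen j, MeasurableSet Q
  subset : ∀ j ∈ generations E, ∀ Q ∈ gen j, Q ⊆ E
  pairwise_disjoint : ∀ j ∈ generations E, ∀ Q ∈ gen j, ∀ Q' ∈ gen j, Q ≠ Q' → Disjoint Q Q'
  cover : ∀ j ∈ generations E, E = ⋃ Q ∈ gen j, Q
  nested : ∀ i ∈ generations E, ∀ j ∈ generations E, i ≤ j →
    ∀ Q ∈ gen i, ∀ Q' ∈ gen j, Q' ⊆ Q ∨ Disjoint Q Q'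
  ancestor : ∀ j ∈ generations E, ∀ Q' ∈ gen j, ∀ i ∈ generations E, i < j →
    ∃! Q, Q ∈ gen i ∧ Q' ⊆ Q
  diam_le : ∀ j ∈ generations E, ∀ Q ∈ gen j,
    Metric.ediam Q ≤ ENNReal.ofReal (c₀⁻¹ * (2 : ℝ) ^ (-j))
  center : ∀ j ∈ generations E, ∀ Q ∈ gen j,
    ∃ x ∈ E, Metric.ball x (c₀ * (2 : ℝ) ^ (-j)) ∩ E ⊆ Q

/-- The collection `Δ = ⋃_{j ∈ 𝕁} Δ_j` of all cubes of the system. -/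
def DyadicSystem.cubes {c₀ : ℝ} {E : Set X} (Δ : DyadicSystem c₀ E) : Set (Set X) :=
  {Q | ∃ j ∈ generations E, Q ∈ Δ.gen j}

/-- The enlarged cube `K Q = {x ∈ E : dist (x, Q) ≤ (K - 1) diam Q}`. -/
def dilate (E : Set X) (K : ℝ) (Q : Set X) : Set X :=
  {x ∈ E | Metric.infDist x Q ≤ (K - 1) * Metric.diam Q}

/-- `E ∈ GLem(h, p, M)` for an `s`-regular set `E`: for every dyadic system `Δ` on `E` (with the
fixed constant `c₀`) and every `Q₀ ∈ Δ`,
`∑_{Q ∈ Δ, Q ⊆ Q₀} h(2Q) ^ p μ(Q) ≤ M μ(Q₀)`, where `μ = ℋ^s ⌊ E`.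
Only the values of `h` at bounded Borel subsets of `E` of positive measure matter. -/
def GLem (c₀ s : ℝ) (E : Set X) (h : Set X → ℝ) (p : ℝ) (M : ℝ≥0) : Prop :=
  ∀ Δ : DyadicSystem c₀ E, ∀ Q₀ ∈ Δ.cubes,
    ∑' Q : {Q : Set X // Q ∈ Δ.cubes ∧ Q ⊆ Q₀},
        ENNReal.ofReal (h (dilate E 2 Q.1) ^ p) * surfaceMeasure s E Q.1
      ≤ (M : ℝ≥0∞) * surfaceMeasure s E Q₀

/-- `β_{p,V}(S)` for a single set `V`, with respect to the measure `μ`. -/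
def betaSingle (μ : MeasureTheory.Measure X) (p : ℝ) (V S : Set X) : ℝ :=
  (1 / μ.real S * ∫ x in S, (Metric.infDist x V / Metric.diam S) ^ p ∂μ) ^ (1 / p)

/-- `ι_{p,V}(S)` for a single projection `π = π_V`, with respect to the measure `μ`. -/
def iotaSingle (μ : MeasureTheory.Measure X) (p : ℝ) (π : X → X) (S : Set X) : ℝ :=
  (1 / μ.real S ^ 2 *
    ∫ y in S, ∫ x in S, (|dist x y - dist (π x) (π y)| / Metric.diam S) ^ p ∂μ ∂μ) ^ (1 / p)

end Metric

/-- `𝒱_d(ℝⁿ)`: the `d`-dimensional affine planes in `ℝⁿ`. -/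
abbrev Planes (d n : ℕ) : Type :=
  {V : AffineSubspace ℝ (EuclideanSpace ℝ (Fin n)) //
    Nonempty V ∧ Module.finrank ℝ V.direction = d}

/-- The orthogonal projection `π_V` of `ℝⁿ` onto the plane `V`. -/
def Planes.proj {d n : ℕ} (V : Planes d n) (x : EuclideanSpace ℝ (Fin n)) :
    EuclideanSpace ℝ (Fin n) :=
  haveI : Nonempty V.1 := V.2.1
  (EuclideanGeometry.orthogonalProjection V.1 x : EuclideanSpace ℝ (Fin n))

/-- `β_{p,𝒱_d}(S)` for a subset `S` of the `d`-regular set `E ⊆ ℝⁿ`. -/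
def beta {n : ℕ} (d : ℕ) (E : Set (EuclideanSpace ℝ (Fin n))) (p : ℝ)
    (S : Set (EuclideanSpace ℝ (Fin n))) : ℝ :=
  ⨅ V : Planes d n, betaSingle (surfaceMeasure (d : ℝ) E) p (V.1 : Set _) S

/-- `ι_{p,𝒱_d}(S)` for a subset `S` of the `d`-regular set `E ⊆ ℝⁿ`. -/
def iota {n : ℕ} (d : ℕ) (E : Set (EuclideanSpace ℝ (Fin n))) (p : ℝ)
    (S : Set (EuclideanSpace ℝ (Fin n))) : ℝ :=
  ⨅ V : Planes d n, iotaSingle (surfaceMeasure (d : ℝ) E) p V.proj S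

end GeometricLemma

end

/-! For a d-plane U, Pythagoras gives ||x-y| - |π_U x - π_U y|| · |x-y| ≤ |P(x-y)|², where P
projects onto the orthogonal complement of the direction of U. The square is what turns the
exponents 2p, 2q of β into p, q for ι. The difficulty is the factor |x-y|, which is small for close
pairs.

Fix a cube Q of generation j and let U be a near-optimal plane of one cube T', about k generations
coarser and meeting Q. For x ≠ y in 2Q there is a cube T containing x, of size comparable to |x-y|,
with y in 2T (`DyadicSystem.exists_cube_of_pair`). Replacing U by the plane V_T costs an angle,
bounded by the sum of the β's along the chain of cubes from T' down to T
(`exists_angleLE_of_chain`). Hence the defect of the pair is at most a constant times (dist(x,V_T)²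
+ dist(y,V_T)²)/|x-y| + (∑ β)² |x-y|. Taking p-th powers and integrating over 2Q × 2Q bounds ι(2Q)^p
by a constant times 2^{jd} ∑_N 2^{-N} ∑_T β(2T)^{2p} μ(T), with T running over the cubes N
generations below T' that meet 2Q. Jensen with exponent q/p gives the same for q. On summing over Q
⊆ Q₀, each T is counted boundedly often per generation of Q, the weights 2^{-N} are summable, and
the packing hypothesis for β on finitely overlapping cubes near Q₀ finishes the proof.

The angle bound rests on `exists_angleLE_of_lintegral_le`: if two d-planes both approximate a
substantial part of E but are far from parallel, that part lies in a thin slab of codimension one in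
a d-plane, which upper regularity forbids (`measure_slab_le`). Only directions inside the d-plane
are discretised, so no constant depends on n.

When E is bounded, Q may have no ancestor k generations up. The system is then replaced by
`DyadicSystem.mergeTop`, whose first generation is E alone. This is legitimate because the
hypothesis on β concerns every dyadic system. -/

noncomputable section
namespace GeometricLemma
open MeasureTheory

/-! ### Measure of thin slabs in a d-plane -/

section Slab

variable {F : Type*} [NormedAddCommGroup F] [InnerProductSpace ℝ F] [FiniteDimensional ℝ F]

/-- The vectors e are an orthonormal basis of the orthogonal complement of w in W; z splits into its
part off W, its part along w, and the remainder in their span. -/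
lemma norm_le_of_coordinates {d : ℕ} (W : Submodule ℝ F) (hW : Module.finrank ℝ W = d)
    (w : F) (hwW : w ∈ W) (hw : ‖w‖ = 1) :
    ∃ e : Fin (d - 1) → F, (∀ i, ‖e i‖ = 1) ∧ ∀ z : F,
      ‖z‖ ≤ ‖z - W.starProjection z‖ + |inner ℝ w z| + ∑ i, |inner ℝ (e i) z| := by
  set U : Submodule ℝ F := (Submodule.span ℝ {w})ᗮ ⊓ W with hU
  have hw0 : w ≠ 0 := by
    intro h; simp [h] at hw
  have hle : Submodule.span ℝ {w} ≤ W := by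
    rw [Submodule.span_singleton_le_iff_mem]; exact hwW
  have hfin : Module.finrank ℝ U = d - 1 := by
    have := Submodule.finrank_add_inf_finrank_orthogonal hle
    rw [finrank_span_singleton hw0, hW] at this
    change 1 + Module.finrank ℝ U = d at this
    omega
  let b := (stdOrthonormalBasis ℝ U).reindex (finCongr hfin)
  refine ⟨fun i => (b i : F), fun i => ?_, fun z => ?_⟩
  · exact b.norm_eq_one i
  · set v := W.starProjection z with hv
    have hvW : v ∈ W := Submodule.starProjection_apply_mem W z
    have hort : ∀ y ∈ W, inner ℝ y z = inner ℝ y v := by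
      intro y hy
      have h1 : inner ℝ (z - v) y = 0 := Submodule.starProjection_inner_eq_zero z y hy
      rw [real_inner_comm, inner_sub_right] at h1
      · linarith
    set u := v - (inner ℝ w z) • w with hu
    have huU : u ∈ U := by
      refine ⟨?_, W.sub_mem hvW (W.smul_mem _ hwW)⟩
      rw [SetLike.mem_coe, Submodule.mem_orthogonal_singleton_iff_inner_right, hu, inner_sub_right,
        inner_smul_right, real_inner_self_eq_norm_sq, hw, hort w hwW]
      simp
    have hsum : u = ∑ i, (inner ℝ (b i : F) z) • (b i : F) := by
      have h1 := b.sum_repr' ⟨u, huU⟩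
      have h2 : u = ((∑ i, inner ℝ (b i) (⟨u, huU⟩ : U) • b i : U) : F) := by rw [h1]
      rw [h2]
      simp only [Submodule.coe_sum, Submodule.coe_smul, Submodule.coe_inner]
      refine Finset.sum_congr rfl fun i _ => ?_
      congr 1
      have hbU := (b i).2
      have hb1 : inner ℝ (b i : F) w = 0 := by
        rw [real_inner_comm]
        exact (Submodule.mem_orthogonal_singleton_iff_inner_right).1 hbU.1
      rw [hu, inner_sub_right, inner_smul_right, hb1, hort _ hbU.2]
      simp
    have hnu : ‖u‖ ≤ ∑ i, |inner ℝ (b i : F) z| := by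
      rw [hsum]
      refine (norm_sum_le _ _).trans (Finset.sum_le_sum fun i _ => ?_)
      have : ‖(b i : F)‖ = 1 := b.norm_eq_one i
      rw [norm_smul, this, mul_one, Real.norm_eq_abs]
    have hz : z = (z - v) + (inner ℝ w z) • w + u := by rw [hu]; abel
    calc ‖z‖ = ‖(z - v) + (inner ℝ w z) • w + u‖ := by rw [← hz]
      _ ≤ ‖z - v‖ + ‖(inner ℝ w z) • w‖ + ‖u‖ := norm_add₃_le
      _ ≤ _ := by
        rw [norm_smul, hw, mul_one, Real.norm_eq_abs]
        gcongr

variable [MeasurableSpace F]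

/-- The part of a slab of codimension one in a `d`-plane has small measure with respect to an
upper `d`-regular measure. -/
lemma measure_slab_le {d : ℕ} (hd : 1 ≤ d) {C : ℝ} (hC : 0 ≤ C) {E : Set F} {μ : Measure F}
    (hup : ∀ x ∈ E, ∀ r : ℝ, 0 < r → μ (Metric.ball x r) ≤ ENNReal.ofReal (C * r ^ d))
    (W : Submodule ℝ F) (hW : Module.finrank ℝ W = d) (w : F) (hwW : w ∈ W) (hw : ‖w‖ = 1)
    {η r : ℝ} (hη : 0 < η) (hη1 : η ≤ 1) (hr : 0 < r) {A : Set F} (hAE : A ⊆ E)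
    (hdiam : ∀ x ∈ A, ∀ y ∈ A, ‖x - y‖ ≤ 2 * r)
    (hperp : ∀ x ∈ A, ∀ y ∈ A, ‖(x - y) - W.starProjection (x - y)‖ ≤ 2 * η * r)
    (hin : ∀ x ∈ A, ∀ y ∈ A, |inner ℝ w (x - y)| ≤ 2 * η * r) :
    μ A ≤ ENNReal.ofReal (C * (d + 4) ^ d * 7 ^ (d - 1) * η * r ^ d) := by
  obtain ⟨e, he1, he⟩ := norm_le_of_coordinates W hW w hwW hw
  rcases A.eq_empty_or_nonempty with rfl | ⟨x1, hx1⟩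
  · simp
  set s := η * r with hs
  have hs0 : 0 < s := mul_pos hη hr
  -- Cells of side ηr in the d - 1 directions of W orthogonal to w: at most (7/η)^(d-1) of them are
  -- occupied, and each fibre lies in a ball of radius (d+4)ηr. The product leaves one spare factor
  -- η.
  let φ : F → Fin (d - 1) → ℤ := fun x i => ⌊inner ℝ (e i) (x - x1) / s⌋
  set N : ℤ := ⌈2 / η⌉ with hN
  have hN0 : 0 ≤ N := Int.ceil_nonneg (by positivity)
  let I : Finset (Fin (d - 1) → ℤ) := Fintype.piFinset fun _ => Finset.Icc (-N) N
  have hcover : A ⊆ ⋃ v ∈ I, {x ∈ A | φ x = v} := by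
    intro x hx
    simp only [Set.mem_iUnion]
    refine ⟨φ x, ?_, hx, rfl⟩
    simp only [I, Fintype.mem_piFinset, Finset.mem_Icc]
    intro i
    have h1 : |inner ℝ (e i) (x - x1)| ≤ 2 * r := by
      refine (abs_real_inner_le_norm _ _).trans ?_
      rw [he1, one_mul]
      exact hdiam x hx x1 hx1
    have h2 : |inner ℝ (e i) (x - x1) / s| ≤ 2 / η := by
      rw [abs_div, abs_of_pos hs0, div_le_div_iff₀ hs0 hη, hs]
      nlinarith
    have h3 := abs_le.1 h2
    have h4 : 2 / η ≤ (N : ℝ) := Int.le_ceil _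
    constructor
    · apply Int.le_floor.2
      push_cast
      linarith
    · have : ((φ x i : ℤ) : ℝ) ≤ N := (Int.floor_le _).trans (h3.2.trans h4)
      exact_mod_cast this
  have hfib : ∀ v ∈ I, μ {x ∈ A | φ x = v} ≤ ENNReal.ofReal (C * ((d + 4) * s) ^ d) := by
    intro v _
    rcases Set.eq_empty_or_nonempty {x ∈ A | φ x = v} with h | ⟨y, hy⟩
    · rw [h]; simp
    · refine (measure_mono ?_).trans (hup y (hAE hy.1) ((d + 4) * s) (by positivity))
      intro x hx
      rw [mem_ball_iff_norm]
      refine (he (x - y)).trans_lt ?_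
      have h1 : ∀ i, |inner ℝ (e i) (x - y)| ≤ s := by
        intro i
        have h2 : φ x i = φ y i := by rw [hx.2, hy.2]
        have h3 := Int.abs_sub_lt_one_of_floor_eq_floor h2
        rw [← sub_div, ← inner_sub_right, sub_sub_sub_cancel_right, abs_div, abs_of_pos hs0,
          div_lt_one hs0] at h3
        exact h3.le
      have h4 : ∑ i, |inner ℝ (e i) (x - y)| ≤ (d - 1) * s := by
        refine (Finset.sum_le_sum fun i _ => h1 i).trans ?_
        rw [Finset.sum_const, Finset.card_univ, Fintype.card_fin, nsmul_eq_mul, Nat.cast_sub hd]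
        simp
      have h5 := hperp x hx.1 y hy.1
      have h6 := hin x hx.1 y hy.1
      rw [mul_assoc, ← hs] at h5 h6
      linarith
  have hcard : (I.card : ℝ) ≤ (7 / η) ^ (d - 1) := by
    simp only [I, Fintype.card_piFinset, Finset.prod_const, Finset.card_univ, Fintype.card_fin]
    push_cast
    refine pow_le_pow_left₀ (by positivity) ?_ _
    rw [Int.card_Icc]
    have h1 : (((N + 1 - -N).toNat : ℤ) : ℝ) = 2 * N + 1 := by
      rw [Int.toNat_of_nonneg (by omega)]; push_cast; ring
    have h2 : (((N + 1 - -N).toNat : ℕ) : ℝ) = 2 * N + 1 := by exact_mod_cast h1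
    rw [h2]
    have h3 : (N : ℝ) < 2 / η + 1 := Int.ceil_lt_add_one _
    have h4 : 1 ≤ 1 / η := by rw [le_div_iff₀ hη]; linarith
    have h5 : 2 / η = 2 * (1 / η) := by ring
    have h6 : 7 / η = 7 * (1 / η) := by ring
    rw [h6]; rw [h5] at h3
    linarith
  calc μ A ≤ μ (⋃ v ∈ I, {x ∈ A | φ x = v}) := measure_mono hcover
    _ ≤ ∑ v ∈ I, μ {x ∈ A | φ x = v} := measure_biUnion_finset_le _ _
    _ ≤ ∑ v ∈ I, ENNReal.ofReal (C * ((d + 4) * s) ^ d) := Finset.sum_le_sum hfib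
    _ = ENNReal.ofReal (I.card * (C * ((d + 4) * s) ^ d)) := by
      rw [Finset.sum_const, nsmul_eq_mul, ENNReal.ofReal_mul (Nat.cast_nonneg _),
        ENNReal.ofReal_natCast]
    _ ≤ _ := by
      apply ENNReal.ofReal_le_ofReal
      calc I.card * (C * ((d + 4) * s) ^ d) ≤ (7 / η) ^ (d - 1) * (C * ((d + 4) * s) ^ d) := by
            gcongr
        _ = _ := by
            obtain ⟨m, rfl⟩ : ∃ m, d = m + 1 := ⟨d - 1, by omega⟩
            simp only [Nat.add_sub_cancel, hs]
            push_cast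
            rw [div_pow, mul_pow, mul_pow, pow_succ η]
            field_simp

end Slab

/-! ### Orthogonal projections and angles between planes -/

section Planes

variable {n d : ℕ}

/-- The component of the vector `u` orthogonal to the plane `V`. -/
def Planes.perp (V : Planes d n) (u : EuclideanSpace ℝ (Fin n)) : EuclideanSpace ℝ (Fin n) :=
  u - V.1.direction.starProjection u

lemma Planes.proj_sub (V : Planes d n) (x y : EuclideanSpace ℝ (Fin n)) :
    V.proj x - V.proj y = V.1.direction.starProjection (x - y) := by
  have : Nonempty V.1 := V.2.1
  have h := (EuclideanGeometry.orthogonalProjection V.1).linearMap_vsub x y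
  rw [EuclideanGeometry.orthogonalProjection_linear] at h
  have h2 := congrArg (Subtype.val) h
  rw [map_sub]
  simp only [Planes.proj]
  simpa using h2.symm

lemma Planes.norm_sub_proj (V : Planes d n) (x : EuclideanSpace ℝ (Fin n)) :
    ‖x - V.proj x‖ = Metric.infDist x (V.1 : Set (EuclideanSpace ℝ (Fin n))) := by
  have : Nonempty V.1 := V.2.1
  rw [← EuclideanGeometry.dist_orthogonalProjection_eq_infDist, dist_eq_norm]
  rfl

lemma Planes.norm_perp_sub_le (V : Planes d n) (x y : EuclideanSpace ℝ (Fin n)) :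
    ‖V.perp (x - y)‖ ≤ Metric.infDist x (V.1 : Set (EuclideanSpace ℝ (Fin n))) +
      Metric.infDist y (V.1 : Set (EuclideanSpace ℝ (Fin n))) := by
  rw [← V.norm_sub_proj, ← V.norm_sub_proj, Planes.perp, ← V.proj_sub]
  refine le_trans (le_of_eq ?_) (norm_sub_le _ _)
  congr 1; abel

lemma Planes.norm_sq_eq (V : Planes d n) (u : EuclideanSpace ℝ (Fin n)) :
    ‖u‖ ^ 2 = ‖V.1.direction.starProjection u‖ ^ 2 + ‖V.perp u‖ ^ 2 := by
  have h : inner ℝ (V.perp u) (V.1.direction.starProjection u) = 0 :=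
    Submodule.starProjection_inner_eq_zero u _ (Submodule.starProjection_apply_mem _ _)
  have h2 : u = V.1.direction.starProjection u + V.perp u := by rw [Planes.perp]; abel
  conv_lhs => rw [h2]
  rw [norm_add_sq_real, real_inner_comm, h]; ring

/-- With a, b, c the norms of x - y, its projection and its orthogonal part, a² - b² = c² and (a -
b)a ≤ (a - b)(a + b). This is the source of the square in the theorem. -/
lemma Planes.abs_dist_sub_mul_le (V : Planes d n) (x y : EuclideanSpace ℝ (Fin n)) :
    |dist x y - dist (V.proj x) (V.proj y)| * ‖x - y‖ ≤ ‖V.perp (x - y)‖ ^ 2 := by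
  rw [dist_eq_norm, dist_eq_norm, V.proj_sub]
  have h := V.norm_sq_eq (x - y)
  set a := ‖x - y‖
  set b := ‖V.1.direction.starProjection (x - y)‖
  set c := ‖V.perp (x - y)‖
  have ha : 0 ≤ a := norm_nonneg _
  have hb : 0 ≤ b := norm_nonneg _
  have hba : b ≤ a := abs_le_of_sq_le_sq' (by nlinarith [sq_nonneg c]) ha |>.2
  rw [abs_of_nonneg (by linarith)]
  nlinarith

/-- `V` is within angle `A` of `W`. -/
def Planes.AngleLE (V W : Planes d n) (A : ℝ) : Prop :=
  ∀ u, ‖V.perp u‖ ≤ ‖W.perp u‖ + A * ‖u‖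

lemma Planes.AngleLE.trans {U V W : Planes d n} {A B : ℝ} (h : U.AngleLE V A) (h' : V.AngleLE W B) :
    U.AngleLE W (A + B) := by
  intro u
  have h1 := h u
  have h2 := h' u
  rw [add_mul]; linarith

lemma Planes.AngleLE.mono {V W : Planes d n} {A B : ℝ} (h : V.AngleLE W A) (hAB : A ≤ B) :
    V.AngleLE W B := fun u => (h u).trans (by gcongr)

lemma Planes.norm_perp_le (V : Planes d n) (u : EuclideanSpace ℝ (Fin n)) : ‖V.perp u‖ ≤ ‖u‖ := by
  refine abs_le_of_sq_le_sq' ?_ (norm_nonneg _) |>.2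
  rw [V.norm_sq_eq u]; nlinarith [sq_nonneg ‖V.1.direction.starProjection u‖]

lemma Planes.perp_add (V : Planes d n) (u v : EuclideanSpace ℝ (Fin n)) :
    V.perp (u + v) = V.perp u + V.perp v := by
  simp only [Planes.perp, map_add]; abel

lemma Planes.angleLE_of_direction {V W : Planes d n} {A : ℝ} (hA : 0 ≤ A)
    (h : ∀ w ∈ W.1.direction, ‖V.perp w‖ ≤ A * ‖w‖) : V.AngleLE W A := by
  intro u
  have h2 : u = W.1.direction.starProjection u + W.perp u := by rw [Planes.perp]; abel
  have h3 : ‖W.1.direction.starProjection u‖ ≤ ‖u‖ := by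
    refine abs_le_of_sq_le_sq' ?_ (norm_nonneg _) |>.2
    rw [W.norm_sq_eq u]; nlinarith [sq_nonneg ‖W.perp u‖]
  have h4 := h _ (Submodule.starProjection_apply_mem W.1.direction u)
  have h5 := V.norm_perp_le (W.perp u)
  calc ‖V.perp u‖ = ‖V.perp (W.1.direction.starProjection u) + V.perp (W.perp u)‖ := by
        rw [← V.perp_add, ← h2]
    _ ≤ _ := norm_add_le _ _
    _ ≤ A * ‖u‖ + ‖W.perp u‖ := by
        have : A * ‖W.1.direction.starProjection u‖ ≤ A * ‖u‖ := by gcongr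
        linarith
    _ = _ := add_comm _ _

end Planes

/-! ### Planes approximating the same large set are nearly parallel -/

section Angle

variable {n d : ℕ}

/-- Chebyshev, followed by K ≤ K^s. The weaker bound m/K lets one K serve for all s ≥ 1. -/
lemma meas_le_of_lintegral_rpow_le {X : Type*} [MeasurableSpace X] {μ : Measure X} {f : X → ℝ}
    (hf : Measurable f) {S : Set X} {s m a K : ℝ} (hs : 1 ≤ s) (ha : 0 < a)
    (hK : 1 ≤ K)
    (hint : ∫⁻ x in S, ENNReal.ofReal (f x ^ s) ∂μ ≤ ENNReal.ofReal (m * a ^ s)) :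
    μ {x ∈ S | K * a ≤ f x} ≤ ENNReal.ofReal (m / K) := by
  have hKa : 0 < K * a := by positivity
  have hm := mul_meas_ge_le_lintegral (μ := μ.restrict S)
    (f := fun x => ENNReal.ofReal (f x ^ s)) (by fun_prop) (ENNReal.ofReal ((K * a) ^ s))
  have hsub : {x ∈ S | K * a ≤ f x} ⊆
      {x | ENNReal.ofReal ((K * a) ^ s) ≤ ENNReal.ofReal (f x ^ s)} ∩ S := by
    intro x hx
    refine ⟨ENNReal.ofReal_le_ofReal (Real.rpow_le_rpow hKa.le hx.2 (by linarith)), hx.1⟩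
  have hmeas : MeasurableSet {x | ENNReal.ofReal ((K * a) ^ s) ≤ ENNReal.ofReal (f x ^ s)} :=
    measurableSet_le measurable_const (by fun_prop)
  rw [Measure.restrict_apply hmeas] at hm
  have hpos : 0 < (K * a) ^ s := Real.rpow_pos_of_pos hKa s
  have h1 : ENNReal.ofReal ((K * a) ^ s) * μ {x ∈ S | K * a ≤ f x} ≤
      ENNReal.ofReal (m * a ^ s) := by
    refine (mul_le_mul_right (measure_mono hsub) _).trans (hm.trans hint)
  rw [mul_comm, ← ENNReal.le_div_iff_mul_le (Or.inl (by simpa using hpos))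
    (Or.inl ENNReal.ofReal_ne_top), ← ENNReal.ofReal_div_of_pos hpos] at h1
  rcases le_or_gt m 0 with hm0 | hm0
  · refine h1.trans ?_
    rw [ENNReal.ofReal_of_nonpos]
    · exact zero_le
    · exact div_nonpos_of_nonpos_of_nonneg
        (mul_nonpos_of_nonpos_of_nonneg hm0 (Real.rpow_nonneg ha.le _)) hpos.le
  refine h1.trans (ENNReal.ofReal_le_ofReal ?_)
  rw [Real.mul_rpow (by linarith) ha.le, mul_div_mul_right _ _ (Real.rpow_pos_of_pos ha s).ne']
  gcongr
  exact Real.self_le_rpow_of_one_le hK hs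

/-- For w in the direction of W let e be its part orthogonal to V, and w' the projection of e to W.
On points close to both planes the functional ⟨w', ·⟩ hardly varies, so such points lie in a slab of
W with normal w'. They carry too much mass for the slab to be thin, which bounds |w'| by |e|; then
|e|² = ⟨w', w⟩ bounds |e| by |w|. -/
lemma exists_angleLE_of_lintegral_le (d : ℕ) (hd : 1 ≤ d) (C : ℝ) (hC : 1 ≤ C) :
    ∃ K : ℝ, 0 < K ∧ ∀ (n : ℕ) (E : Set (EuclideanSpace ℝ (Fin n)))
      (μ : Measure (EuclideanSpace ℝ (Fin n))),
      (∀ x ∈ E, ∀ r : ℝ, 0 < r → μ (Metric.ball x r) ≤ ENNReal.ofReal (C * r ^ d)) →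
      ∀ (s : ℝ), 1 ≤ s → ∀ (V W : Planes d n) (x0 : EuclideanSpace ℝ (Fin n)) (r a : ℝ)
        (S : Set (EuclideanSpace ℝ (Fin n))), 0 < r → 0 < a →
        S ⊆ E → S ⊆ Metric.ball x0 r → ENNReal.ofReal (C⁻¹ * r ^ d) ≤ μ S →
        ∫⁻ x in S, ENNReal.ofReal (Metric.infDist x V.1 ^ s) ∂μ ≤
          ENNReal.ofReal (r ^ d * (a * r) ^ s) →
        ∫⁻ x in S, ENNReal.ofReal (Metric.infDist x W.1 ^ s) ∂μ ≤
          ENNReal.ofReal (r ^ d * (a * r) ^ s) →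
        V.AngleLE W (K * a) := by
  set D : ℝ := C * (d + 4) ^ d * 7 ^ (d - 1) with hD
  have hC0 : 0 < C := by linarith
  have hD1 : 1 ≤ D := by
    have h1 : (1 : ℝ) ≤ (d + 4) ^ d := one_le_pow₀ (by linarith [(Nat.cast_nonneg d : (0 : ℝ) ≤ d)])
    have h2 : (1 : ℝ) ≤ 7 ^ (d - 1) := one_le_pow₀ (by norm_num)
    rw [hD]
    exact one_le_mul_of_one_le_of_one_le (one_le_mul_of_one_le_of_one_le hC h1) h2
  -- Chosen so that the slab bound D η r^d equals r^d/(4C), the mass that G exceeds.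
  set η : ℝ := 1 / (4 * C * D) with hη
  have hη0 : 0 < η := by positivity
  have hη1 : η ≤ 1 := by
    rw [hη, div_le_one (by positivity)]
    nlinarith
  refine ⟨16 * C / η, by positivity, ?_⟩
  intro n E μ hup s hs V W x0 r a S hr ha hSE hSr hmS hV hW
  set t := 4 * C * (a * r) with ht
  have ht0 : 0 < t := by positivity
  have hb1 := meas_le_of_lintegral_rpow_le (Metric.continuous_infDist_pt _).measurable hs
    (mul_pos ha hr) (by linarith : (1 : ℝ) ≤ 4 * C) hV
  have hb2 := meas_le_of_lintegral_rpow_le (Metric.continuous_infDist_pt _).measurable hs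
    (mul_pos ha hr) (by linarith : (1 : ℝ) ≤ 4 * C) hW
  rw [← ht] at hb1 hb2
  set G : Set (EuclideanSpace ℝ (Fin n)) :=
    {x ∈ S | Metric.infDist x (V.1 : Set (EuclideanSpace ℝ (Fin n))) < t ∧
      Metric.infDist x (W.1 : Set (EuclideanSpace ℝ (Fin n))) < t} with hG
  -- S has mass at least four times r^d/(4C), and each of the two bad sets takes at most one such
  -- share.
  have hGm : ¬ μ G ≤ ENNReal.ofReal (r ^ d / (4 * C)) := by
    intro hcon
    have hsub : S ⊆ G ∪ ({x ∈ S | t ≤ Metric.infDist x (V.1 : Set (EuclideanSpace ℝ (Fin n)))} ∪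
        {x ∈ S | t ≤ Metric.infDist x (W.1 : Set (EuclideanSpace ℝ (Fin n)))}) := by
      intro x hx
      by_cases h1 : Metric.infDist x (V.1 : Set (EuclideanSpace ℝ (Fin n))) < t
      · by_cases h2 : Metric.infDist x (W.1 : Set (EuclideanSpace ℝ (Fin n))) < t
        · exact Or.inl ⟨hx, h1, h2⟩
        · exact Or.inr (Or.inr ⟨hx, not_lt.1 h2⟩)
      · exact Or.inr (Or.inl ⟨hx, not_lt.1 h1⟩)
    have h3 := hmS.trans ((measure_mono hsub).trans ((measure_union_le _ _).trans
      (add_le_add hcon ((measure_union_le _ _).trans (add_le_add hb1 hb2)))))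
    have hp : 0 < r ^ d / (4 * C) := by positivity
    rw [← ENNReal.ofReal_add hp.le hp.le, ← ENNReal.ofReal_add hp.le (by positivity),
      ENNReal.ofReal_le_ofReal_iff (by positivity)] at h3
    have h4 : C⁻¹ * r ^ d = 4 * (r ^ d / (4 * C)) := by field_simp
    linarith
  apply Planes.angleLE_of_direction (by positivity)
  intro w hw
  set e := V.perp w with he
  set w' := W.1.direction.starProjection e with hw'
  have hee : ∀ u, inner ℝ e u = inner ℝ e (V.perp u) := by
    intro u
    have : inner ℝ e (V.1.direction.starProjection u) = 0 :=
      Submodule.starProjection_inner_eq_zero w _ (Submodule.starProjection_apply_mem _ _)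
    rw [Planes.perp, inner_sub_right, this, sub_zero]
  have hww : ∀ u, inner ℝ w' u = inner ℝ e (W.1.direction.starProjection u) := by
    intro u
    rw [hw', Submodule.inner_starProjection_left_eq_right]
  have hsq : inner ℝ w' w = ‖e‖ ^ 2 := by
    rw [hww, Submodule.starProjection_eq_self_iff.2 hw, hee, ← he, real_inner_self_eq_norm_sq]
  -- If t > ηr the estimate is trivial from |w'| ≤ |e|. Otherwise t ≤ ηr makes G thin orthogonally
  -- to W, and failure of the estimate would make it thin along w' too, contradicting `hGm`.
  have hkey : ‖w'‖ * (η * r) ≤ 4 * t * ‖e‖ := by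
    rcases lt_or_ge (η * r) t with htr | htr
    · have h1 : ‖w'‖ ≤ ‖e‖ := by
        have := W.norm_sq_eq e
        refine abs_le_of_sq_le_sq' ?_ (norm_nonneg _) |>.2
        rw [this]; nlinarith [sq_nonneg ‖W.perp e‖]
      have : ‖w'‖ * (η * r) ≤ ‖e‖ * t := by gcongr
      nlinarith [norm_nonneg e]
    · rcases eq_or_ne w' 0 with h0 | h0
      · rw [h0, norm_zero, zero_mul]; positivity
      have hn0 : 0 < ‖w'‖ := norm_pos_iff.2 h0
      have hP : ∀ x ∈ G, ∀ y ∈ G, ‖W.perp (x - y)‖ ≤ 2 * t ∧ ‖V.perp (x - y)‖ ≤ 2 * t := by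
        intro x hx y hy
        have h1 := W.norm_perp_sub_le x y
        have h2 := V.norm_perp_sub_le x y
        have := hx.2; have := hy.2
        constructor <;> linarith
      by_contra hcon
      push Not at hcon
      apply hGm
      refine (measure_slab_le hd hC0.le hup W.1.direction W.2.2 (‖w'‖⁻¹ • w')
        (Submodule.smul_mem _ _ (Submodule.starProjection_apply_mem _ _))
        (norm_smul_inv_norm h0) hη0 hη1 hr (fun x hx => hSE hx.1) ?_ ?_ ?_).trans ?_
      · intro x hx y hy
        have h1 := mem_ball_iff_norm.1 (hSr hx.1)
        have h2 := mem_ball_iff_norm'.1 (hSr hy.1)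
        have h3 := norm_add_le (x - x0) (x0 - y)
        rw [sub_add_sub_cancel] at h3
        linarith
      · intro x hx y hy
        refine (hP x hx y hy).1.trans ?_
        linarith
      · intro x hx y hy
        rw [inner_smul_left, hww]
        simp only [conj_trivial]
        have h1 : W.1.direction.starProjection (x - y) = (x - y) - W.perp (x - y) := by
          rw [Planes.perp]; abel
        rw [h1, inner_sub_right, hee (x - y), abs_mul, abs_of_pos (inv_pos.2 hn0),
          inv_mul_le_iff₀ hn0]
        have h2 := abs_real_inner_le_norm e (V.perp (x - y))
        have h3 := abs_real_inner_le_norm e (W.perp (x - y))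
        have h4 := hP x hx y hy
        have h5 := abs_sub (inner ℝ e (V.perp (x - y))) (inner ℝ e (W.perp (x - y)))
        have h6 : ‖e‖ * ‖V.perp (x - y)‖ ≤ ‖e‖ * (2 * t) := by gcongr; exact h4.2
        have h7 : ‖e‖ * ‖W.perp (x - y)‖ ≤ ‖e‖ * (2 * t) := by gcongr; exact h4.1
        nlinarith
      · apply ENNReal.ofReal_le_ofReal
        rw [← hD, hη]
        apply le_of_eq
        field_simp
  have hle : ‖e‖ ^ 2 ≤ ‖w'‖ * ‖w‖ := by
    rw [← hsq]; exact real_inner_le_norm _ _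
  rcases eq_or_ne ‖e‖ 0 with h0 | h0
  · rw [h0]; positivity
  have he0 : 0 < ‖e‖ := lt_of_le_of_ne (norm_nonneg _) h0.symm
  have h1 : ‖e‖ * (‖e‖ * (η * r)) ≤ ‖e‖ * (4 * t * ‖w‖) := by
    calc ‖e‖ * (‖e‖ * (η * r)) = ‖e‖ ^ 2 * (η * r) := by ring
      _ ≤ ‖w'‖ * ‖w‖ * (η * r) := by gcongr
      _ = ‖w'‖ * (η * r) * ‖w‖ := by ring
      _ ≤ 4 * t * ‖e‖ * ‖w‖ := by gcongr
      _ = _ := by ring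
  have h2 := le_of_mul_le_mul_left h1 he0
  have h3 : ‖e‖ * η * r ≤ 16 * C * a * ‖w‖ * r := by rw [ht] at h2; linarith
  have h4 := le_of_mul_le_mul_right h3 hr
  rw [show 16 * C / η * a * ‖w‖ = 16 * C * a * ‖w‖ / η by ring, le_div_iff₀ hη0]
  exact h4

end Angle

/-! ### Regular sets, doubled cubes and dyadic systems -/

section Regular

set_option linter.unusedSectionVars false

variable {X : Type*} [MetricSpace X] [MeasurableSpace X] [BorelSpace X] {d : ℕ} {C c₀ : ℝ}
  {E : Set X}

lemma surfaceMeasure_apply {s : ℝ} {A : Set X} (hA : MeasurableSet A) :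
    surfaceMeasure s E A = μH[s] (A ∩ E) := Measure.restrict_apply hA

lemma IsRegular.nonempty {s : ℝ} (hE : IsRegular s C E) : E.Nonempty := by
  by_contra h
  rw [Set.not_nonempty_iff_eq_empty] at h
  have := hE.diam_pos
  simp [h] at this

lemma IsRegular.measure_ball_le (hE : IsRegular (d : ℝ) C E) {x : X} (hx : x ∈ E) {r : ℝ}
    (hr : 0 < r) : surfaceMeasure d E (Metric.ball x r) ≤ ENNReal.ofReal (C * r ^ d) := by
  rw [surfaceMeasure_apply measurableSet_ball]
  by_cases h : ENNReal.ofReal r < 2 * Metric.ediam E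
  · simpa using hE.upper x hx r hr h
  · push Not at h
    have hb : Bornology.IsBounded E := by
      rw [Metric.isBounded_iff_ediam_ne_top]
      intro htop
      rw [htop, ENNReal.mul_top two_ne_zero] at h
      exact ENNReal.ofReal_ne_top (top_le_iff.1 h)
    set D := Metric.diam E with hD
    have hDe : Metric.ediam E = ENNReal.ofReal D := by
      rw [hD, Metric.diam, ENNReal.ofReal_toReal hb.ediam_ne_top]
    have hD0 : 0 < D := by
      have := hE.diam_pos
      rwa [hDe, ENNReal.ofReal_pos] at this
    have h2 : 2 * D ≤ r := by
      rw [hDe, show (2 : ℝ≥0∞) = ENNReal.ofReal 2 by simp,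
        ← ENNReal.ofReal_mul zero_le_two, ENNReal.ofReal_le_ofReal_iff hr.le] at h
      exact h
    -- A radius strictly between D and 2D is admissible in the definition and its ball already
    -- contains E.
    have h3 := hE.upper x hx (3 / 2 * D) (by positivity) (by
      rw [hDe, show (2 : ℝ≥0∞) = ENNReal.ofReal 2 by simp, ← ENNReal.ofReal_mul zero_le_two,
        ENNReal.ofReal_lt_ofReal_iff (by positivity)]
      linarith)
    calc μH[(d : ℝ)] (Metric.ball x r ∩ E) ≤ μH[(d : ℝ)] (Metric.ball x (3 / 2 * D) ∩ E) := by
          refine measure_mono fun y hy => ⟨?_, hy.2⟩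
          rw [Metric.mem_ball]
          have := Metric.dist_le_diam_of_mem hb hy.2 hx
          linarith
      _ ≤ _ := h3
      _ ≤ _ := by
          apply ENNReal.ofReal_le_ofReal
          rw [Real.rpow_natCast]
          have := hE.one_le
          gcongr
          linarith

lemma ofReal_zpow_le_ediam {j : ℤ} (hj : j ∈ generations E) :
    ENNReal.ofReal ((2 : ℝ) ^ (-j)) ≤ Metric.ediam E := by
  by_cases hb : Bornology.IsBounded E
  · have := hj hb
    rw [Metric.diam] at this
    exact ENNReal.ofReal_le_of_le_toReal this
  · rw [Metric.ediam_of_unbounded hb]; exact le_top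

lemma generations_mono {i j : ℤ} (hi : i ∈ generations E) (hij : i ≤ j) : j ∈ generations E := by
  intro hb
  exact (zpow_le_zpow_right₀ one_le_two (by omega)).trans (hi hb)

lemma IsRegular.le_measure_ball (hE : IsRegular (d : ℝ) C E) {x : X} (hx : x ∈ E) {j : ℤ}
    (hj : j ∈ generations E) {r : ℝ} (hr : 0 < r) (hrj : r ≤ (2 : ℝ) ^ (-j)) :
    ENNReal.ofReal (C⁻¹ * r ^ d) ≤ surfaceMeasure d E (Metric.ball x r) := by
  rw [surfaceMeasure_apply measurableSet_ball]
  have h := hE.lower x hx r hr (by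
    refine (ENNReal.ofReal_le_ofReal hrj).trans_lt ?_
    have h1 := ofReal_zpow_le_ediam hj
    rcases eq_or_ne (Metric.ediam E) ⊤ with h | h
    · rw [h, ENNReal.mul_top two_ne_zero]; exact ENNReal.ofReal_lt_top
    refine h1.trans_lt ?_
    rw [two_mul]
    exact ENNReal.lt_add_right h hE.diam_pos.ne')
  simpa using h

/-- The properties of a single dyadic cube of generation `j`. -/
structure IsCube (c₀ : ℝ) (E : Set X) (j : ℤ) (Q : Set X) : Prop where
  measurable : MeasurableSet Q
  subset : Q ⊆ E
  ediam_le : Metric.ediam Q ≤ ENNReal.ofReal (c₀⁻¹ * (2 : ℝ) ^ (-j))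
  center : ∃ x ∈ E, Metric.ball x (c₀ * (2 : ℝ) ^ (-j)) ∩ E ⊆ Q

namespace IsCube

variable {j : ℤ} {Q : Set X}

lemma exists_center (hQ : IsCube c₀ E j Q) (hc : 0 < c₀) :
    ∃ x ∈ Q, Metric.ball x (c₀ * (2 : ℝ) ^ (-j)) ∩ E ⊆ Q := by
  obtain ⟨x, hx, h⟩ := hQ.center
  exact ⟨x, h ⟨Metric.mem_ball_self (by positivity), hx⟩, h⟩

lemma nonempty (hQ : IsCube c₀ E j Q) (hc : 0 < c₀) : Q.Nonempty :=
  let ⟨x, hx, _⟩ := hQ.exists_center hc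
  ⟨x, hx⟩

lemma isBounded (hQ : IsCube c₀ E j Q) : Bornology.IsBounded Q := by
  rw [Metric.isBounded_iff_ediam_ne_top]
  exact ne_top_of_le_ne_top ENNReal.ofReal_ne_top hQ.ediam_le

lemma diam_le (hQ : IsCube c₀ E j Q) (hc : 0 < c₀) : Metric.diam Q ≤ c₀⁻¹ * (2 : ℝ) ^ (-j) :=
  ENNReal.toReal_le_of_le_ofReal (by positivity) hQ.ediam_le

lemma le_measure (hE : IsRegular (d : ℝ) C E) (hj : j ∈ generations E) (hQ : IsCube c₀ E j Q)
    (hc : 0 < c₀) (hc1 : c₀ ≤ 1) :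
    ENNReal.ofReal (C⁻¹ * (c₀ * (2 : ℝ) ^ (-j)) ^ d) ≤ surfaceMeasure d E Q := by
  obtain ⟨x, hx, h⟩ := hQ.exists_center hc
  have h2 : (0 : ℝ) < 2 ^ (-j) := by positivity
  refine (hE.le_measure_ball (hQ.subset hx) hj (by positivity) (by nlinarith)).trans ?_
  rw [surfaceMeasure_apply measurableSet_ball, surfaceMeasure_apply hQ.measurable]
  exact measure_mono fun y hy => ⟨h hy, hy.2⟩

/-- Q carries the mass of a ball of radius c₀2^{-j}, so upper regularity prevents it from fitting
into a much smaller ball. -/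
lemma le_diam (hE : IsRegular (d : ℝ) C E) (hd : 1 ≤ d) (hj : j ∈ generations E)
    (hQ : IsCube c₀ E j Q) (hc : 0 < c₀) (hc1 : c₀ ≤ 1) :
    C⁻¹ ^ 2 * c₀ * (2 : ℝ) ^ (-j) ≤ Metric.diam Q := by
  by_contra hcon
  push Not at hcon
  have hC1 := hE.one_le
  set r := C⁻¹ ^ 2 * c₀ * (2 : ℝ) ^ (-j) with hr
  have hr0 : 0 < r := by positivity
  obtain ⟨x, hx⟩ := hQ.nonempty hc
  -- The midpoint of diam Q and r is strictly above diam Q, as an open ball requires, and strictly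
  -- below r, which gives the contradiction.
  have h1 : surfaceMeasure (d : ℝ) E Q ≤ ENNReal.ofReal (C * ((Metric.diam Q + r) / 2) ^ d) := by
    have hpos : 0 < (Metric.diam Q + r) / 2 := by
      have : 0 ≤ Metric.diam Q := Metric.diam_nonneg
      linarith
    refine (measure_mono ?_).trans (hE.measure_ball_le (hQ.subset hx) hpos)
    intro y hy
    have := Metric.dist_le_diam_of_mem hQ.isBounded hy hx
    rw [Metric.mem_ball]; linarith
  have h2 := (hQ.le_measure hE hj hc hc1).trans h1
  have h3 : 0 ≤ Metric.diam Q := Metric.diam_nonneg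
  rw [ENNReal.ofReal_le_ofReal_iff (by positivity)] at h2
  have h4 : ((Metric.diam Q + r) / 2) ^ d < r ^ d :=
    pow_lt_pow_left₀ (by linarith) (by linarith) (by omega)
  have h5 : C * r ^ d ≤ C⁻¹ * (c₀ * (2 : ℝ) ^ (-j)) ^ d := by
    rw [hr, mul_assoc, mul_pow (C⁻¹ ^ 2)]
    have h6 : (C⁻¹ ^ 2) ^ d ≤ C⁻¹ ^ 2 :=
      pow_le_of_le_one (by positivity) (pow_le_one₀ (by positivity) (inv_le_one_of_one_le₀ hC1))
        (by omega)
    have h7 : C * C⁻¹ ^ 2 = C⁻¹ := by field_simp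
    calc C * ((C⁻¹ ^ 2) ^ d * (c₀ * (2 : ℝ) ^ (-j)) ^ d)
        ≤ C * (C⁻¹ ^ 2 * (c₀ * (2 : ℝ) ^ (-j)) ^ d) := by gcongr
      _ = _ := by rw [← mul_assoc, h7]
  have h8 : C * ((Metric.diam Q + r) / 2) ^ d < C * r ^ d := by gcongr
  linarith

end IsCube

lemma subset_dilate {Q : Set X} (hQ : Q ⊆ E) : Q ⊆ dilate E 2 Q := by
  intro x hx
  refine ⟨hQ hx, ?_⟩
  rw [Metric.infDist_zero_of_mem hx]
  have : 0 ≤ Metric.diam Q := Metric.diam_nonneg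
  linarith

lemma measurableSet_dilate (hE : IsClosed E) {K : ℝ} {Q : Set X} :
    MeasurableSet (dilate E K Q) :=
  hE.measurableSet.inter
    ((isClosed_le (Metric.continuous_infDist_pt Q) continuous_const).measurableSet)

lemma mem_dilate_of_dist_le {Q : Set X} {x y : X} (hx : x ∈ E) (hy : y ∈ Q)
    (h : dist x y ≤ Metric.diam Q) : x ∈ dilate E 2 Q :=
  ⟨hx, by
    have := Metric.infDist_le_dist_of_mem (x := x) hy
    linarith⟩

lemma lt_dist_of_notMem_dilate {Q : Set X} {x y : X} (hx : x ∈ E) (hy : y ∈ Q)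
    (h : x ∉ dilate E 2 Q) : Metric.diam Q < dist x y := by
  by_contra hcon
  exact h (mem_dilate_of_dist_le hx hy (not_lt.1 hcon))

lemma dist_le_of_mem_dilate_of_mem {Q : Set X} (hb : Bornology.IsBounded Q) {x y : X}
    (hx : x ∈ dilate E 2 Q) (hy : y ∈ Q) : dist x y ≤ 2 * Metric.diam Q := by
  apply le_of_forall_pos_lt_add
  intro ε hε
  obtain ⟨z, hz, hxz⟩ := (Metric.infDist_lt_iff ⟨y, hy⟩).1
    (lt_of_le_of_lt hx.2 (lt_add_of_pos_right _ hε))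
  have h1 := Metric.dist_le_diam_of_mem hb hz hy
  have h2 := dist_triangle x z y
  linarith

lemma dist_le_of_mem_dilate {Q : Set X} (hb : Bornology.IsBounded Q) (hne : Q.Nonempty) {x y : X}
    (hx : x ∈ dilate E 2 Q) (hy : y ∈ dilate E 2 Q) : dist x y ≤ 3 * Metric.diam Q := by
  apply le_of_forall_pos_lt_add
  intro ε hε
  obtain ⟨z, hz, hxz⟩ := (Metric.infDist_lt_iff hne).1
    (lt_of_le_of_lt hx.2 (lt_add_of_pos_right _ hε))
  have h1 := dist_le_of_mem_dilate_of_mem hb hy hz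
  have h2 := dist_triangle x z y
  rw [dist_comm] at h1
  linarith

lemma isBounded_dilate {Q : Set X} (hb : Bornology.IsBounded Q) (hne : Q.Nonempty) :
    Bornology.IsBounded (dilate E 2 Q) :=
  Metric.isBounded_iff.2 ⟨_, fun _ hx _ hy => dist_le_of_mem_dilate hb hne hx hy⟩

lemma diam_dilate_le {Q : Set X} (hb : Bornology.IsBounded Q) (hne : Q.Nonempty) :
    Metric.diam (dilate E 2 Q) ≤ 3 * Metric.diam Q :=
  Metric.diam_le_of_forall_dist_le (by have : 0 ≤ Metric.diam Q := Metric.diam_nonneg; linarith)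
    fun _ hx _ hy => dist_le_of_mem_dilate hb hne hx hy

lemma dilate_mono {Q Q' : Set X} (hne : Q.Nonempty) (h : Q ⊆ Q') (hb : Bornology.IsBounded Q') :
    dilate E 2 Q ⊆ dilate E 2 Q' := by
  intro x hx
  refine ⟨hx.1, (Metric.infDist_le_infDist_of_subset h hne).trans (hx.2.trans ?_)⟩
  have := Metric.diam_mono h hb
  linarith

namespace IsCube

variable {j : ℤ} {Q : Set X}

lemma diam_dilate_le (hQ : IsCube c₀ E j Q) (hc : 0 < c₀) :
    Metric.diam (dilate E 2 Q) ≤ 3 * c₀⁻¹ * (2 : ℝ) ^ (-j) := by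
  have h1 := GeometricLemma.diam_dilate_le (E := E) hQ.isBounded (hQ.nonempty hc)
  have h2 := hQ.diam_le hc
  linarith

lemma le_diam_dilate (hE : IsRegular (d : ℝ) C E) (hd : 1 ≤ d) (hj : j ∈ generations E)
    (hQ : IsCube c₀ E j Q) (hc : 0 < c₀) (hc1 : c₀ ≤ 1) :
    C⁻¹ ^ 2 * c₀ * (2 : ℝ) ^ (-j) ≤ Metric.diam (dilate E 2 Q) :=
  (hQ.le_diam hE hd hj hc hc1).trans
    (Metric.diam_mono (subset_dilate hQ.subset) (isBounded_dilate hQ.isBounded (hQ.nonempty hc)))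

lemma dilate_subset_ball (hQ : IsCube c₀ E j Q) (hc : 0 < c₀) {x : X} (hx : x ∈ dilate E 2 Q) :
    dilate E 2 Q ⊆ Metric.ball x (4 * c₀⁻¹ * (2 : ℝ) ^ (-j)) := by
  intro y hy
  have h1 := dist_le_of_mem_dilate hQ.isBounded (hQ.nonempty hc) hy hx
  have h2 := hQ.diam_le hc
  have h3 : 0 < c₀⁻¹ * (2 : ℝ) ^ (-j) := by positivity
  rw [Metric.mem_ball]
  linarith

lemma measure_dilate_le (hE : IsRegular (d : ℝ) C E) (hQ : IsCube c₀ E j Q) (hc : 0 < c₀) :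
    surfaceMeasure d E (dilate E 2 Q) ≤ ENNReal.ofReal (C * (4 * c₀⁻¹ * (2 : ℝ) ^ (-j)) ^ d) := by
  obtain ⟨x, hx⟩ := hQ.nonempty hc
  have hx' := subset_dilate hQ.subset hx
  exact (measure_mono (hQ.dilate_subset_ball hc hx')).trans
    (hE.measure_ball_le hx'.1 (by positivity))

lemma measure_dilate_ne_top (hE : IsRegular (d : ℝ) C E) (hQ : IsCube c₀ E j Q) (hc : 0 < c₀) :
    surfaceMeasure d E (dilate E 2 Q) ≠ ⊤ :=
  ne_top_of_le_ne_top ENNReal.ofReal_ne_top (hQ.measure_dilate_le hE hc)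

lemma measure_dilate_pos (hE : IsRegular (d : ℝ) C E) (hj : j ∈ generations E)
    (hQ : IsCube c₀ E j Q) (hc : 0 < c₀) (hc1 : c₀ ≤ 1) :
    0 < surfaceMeasure d E (dilate E 2 Q) := by
  refine lt_of_lt_of_le ?_ ((hQ.le_measure hE hj hc hc1).trans
    (measure_mono (subset_dilate hQ.subset)))
  have := hE.one_le
  rw [ENNReal.ofReal_pos]; positivity

lemma measure_le (hE : IsRegular (d : ℝ) C E) (hQ : IsCube c₀ E j Q) (hc : 0 < c₀) :
    surfaceMeasure d E Q ≤ ENNReal.ofReal (C * (4 * c₀⁻¹ * (2 : ℝ) ^ (-j)) ^ d) :=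
  (measure_mono (subset_dilate hQ.subset)).trans (hQ.measure_dilate_le hE hc)

end IsCube

namespace DyadicSystem

/-- The cubes of generation `j`, where there are none for inadmissible `j`. -/
def level (Δ : DyadicSystem c₀ E) (j : ℤ) : Set (Set X) := {Q | j ∈ generations E ∧ Q ∈ Δ.gen j}

variable (Δ : DyadicSystem c₀ E)

lemma isCube {j : ℤ} {Q : Set X} (hQ : Q ∈ Δ.level j) : IsCube c₀ E j Q :=
  ⟨Δ.measurable j hQ.1 Q hQ.2, Δ.subset j hQ.1 Q hQ.2, Δ.diam_le j hQ.1 Q hQ.2,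
    Δ.center j hQ.1 Q hQ.2⟩

lemma exists_mem_level {j : ℤ} (hj : j ∈ generations E) {x : X} (hx : x ∈ E) :
    ∃ Q ∈ Δ.level j, x ∈ Q := by
  rw [Δ.cover j hj] at hx
  simp only [Set.mem_iUnion] at hx
  obtain ⟨Q, hQ, hxQ⟩ := hx
  exact ⟨Q, ⟨hj, hQ⟩, hxQ⟩

lemma level_eq_of_mem {j : ℤ} {Q Q' : Set X} (hQ : Q ∈ Δ.level j) (hQ' : Q' ∈ Δ.level j) {x : X}
    (hx : x ∈ Q) (hx' : x ∈ Q') : Q = Q' := by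
  by_contra h
  exact Set.disjoint_left.1 (Δ.pairwise_disjoint j hQ.1 Q hQ.2 Q' hQ'.2 h) hx hx'

lemma subset_of_mem {i j : ℤ} (hij : i ≤ j) {Q Q' : Set X} (hQ : Q ∈ Δ.level i)
    (hQ' : Q' ∈ Δ.level j) {x : X} (hx : x ∈ Q) (hx' : x ∈ Q') : Q' ⊆ Q :=
  (Δ.nested i hQ.1 j hQ'.1 hij Q hQ.2 Q' hQ'.2).resolve_right
    fun h => Set.disjoint_left.1 h hx hx'

lemma pairwiseDisjoint_level (j : ℤ) : (Δ.level j).PairwiseDisjoint id :=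
  fun Q hQ Q' hQ' h => Δ.pairwise_disjoint j hQ.1 Q hQ.2 Q' hQ'.2 h

/-- Disjoint cubes each contain a relative ball of E, hence distinct points of a countable dense
subset. -/
lemma countable_level [SecondCountableTopology X] (hc : 0 < c₀) (j : ℤ) :
    (Δ.level j).Countable := by
  classical
  obtain ⟨D, hD, hdense⟩ := TopologicalSpace.exists_countable_dense E
  have hex : ∀ Q : Δ.level j, ∃ y : D, ((y : E) : X) ∈ (Q : Set X) := by
    intro Q
    obtain ⟨x, hx, hb⟩ := (Δ.isCube Q.2).exists_center hc
    obtain ⟨y, hyD, hy⟩ := hdense.exists_dist_lt (⟨x, (Δ.isCube Q.2).subset hx⟩ : E)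
      (ε := c₀ * (2 : ℝ) ^ (-j)) (by positivity)
    refine ⟨⟨y, hyD⟩, hb ⟨?_, y.2⟩⟩
    rw [Metric.mem_ball, dist_comm]; exact hy
  choose f hf using hex
  have hinj : Function.Injective f := by
    intro Q Q' h
    apply Subtype.ext
    exact Δ.level_eq_of_mem Q.2 Q'.2 (hf Q) (h ▸ hf Q')
  have : Countable D := hD.to_subtype
  exact Set.countable_coe_iff.1 hinj.countable

/-- For bounded `E`, all the cubes of the first generation may be replaced by `E` itself. -/
def mergeTop (Δ : DyadicSystem c₀ E) (hc : 0 < c₀) (hc2 : c₀ ≤ 1 / 2) (hE : IsClosed E)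
    (hne : E.Nonempty) : DyadicSystem c₀ E where
  gen j := {Q | (j - 1 ∈ generations E ∧ Q ∈ Δ.gen j) ∨ (j - 1 ∉ generations E ∧ Q = E)}
  measurable j hj Q hQ := by
    rcases hQ with hQ | hQ
    · exact Δ.measurable j hj Q hQ.2
    · rw [hQ.2]; exact hE.measurableSet
  subset j hj Q hQ := by
    rcases hQ with hQ | hQ
    · exact Δ.subset j hj Q hQ.2
    · rw [hQ.2]
  pairwise_disjoint j hj Q hQ Q' hQ' h := by
    rcases hQ with hQ | hQ <;> rcases hQ' with hQ' | hQ'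
    · exact Δ.pairwise_disjoint j hj Q hQ.2 Q' hQ'.2 h
    · exact absurd hQ.1 hQ'.1
    · exact absurd hQ'.1 hQ.1
    · exact absurd (hQ.2.trans hQ'.2.symm) h
  cover j hj := by
    by_cases h : j - 1 ∈ generations E
    · simpa [h] using Δ.cover j hj
    · simp [h]
  nested i hi j hj hij Q hQ Q' hQ' := by
    have key : Q' ⊆ E := by
      rcases hQ' with h | h
      · exact Δ.subset j hj Q' h.2
      · rw [h.2]
    rcases hQ with hQ | hQ
    · rcases hQ' with hQ' | hQ'
      · exact Δ.nested i hi j hj hij Q hQ.2 Q' hQ'.2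
      · exact absurd (generations_mono hQ.1 (by omega)) hQ'.1
    · left; rw [hQ.2]; exact key
  ancestor j hj Q' hQ' i hi hij := by
    have hj1 : j - 1 ∈ generations E := generations_mono hi (by omega)
    have hQ'' : Q' ∈ Δ.gen j := by
      rcases hQ' with h | h
      · exact h.2
      · exact absurd hj1 h.1
    by_cases h : i - 1 ∈ generations E
    · simpa [h] using Δ.ancestor j hj Q' hQ'' i hi hij
    · refine ⟨E, ⟨Or.inr ⟨h, rfl⟩, Δ.subset j hj Q' hQ''⟩, ?_⟩
      rintro Q ⟨hQ, -⟩
      rcases hQ with hQ | hQ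
      · exact absurd hQ.1 h
      · exact hQ.2
  diam_le j hj Q hQ := by
    rcases hQ with hQ | hQ
    · exact Δ.diam_le j hj Q hQ.2
    · rw [hQ.2]
      have h1 := hQ.1
      simp only [generations, Set.mem_ofPred_eq, Classical.not_imp, not_le] at h1
      rw [← ENNReal.ofReal_toReal h1.1.ediam_ne_top]
      apply ENNReal.ofReal_le_ofReal
      refine h1.2.le.trans ?_
      rw [show -(j - 1) = 1 + -j by ring, zpow_add₀ two_ne_zero, zpow_one]
      -- Here c₀ ≤ 1/2 is needed: in the first generation only diam E < 2 · 2^{-j} is known, and E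
      -- must satisfy the diameter bound for cubes.
      have : 2 ≤ c₀⁻¹ := by
        rw [le_inv_comm₀ two_pos hc]; linarith
      gcongr
  center j hj Q hQ := by
    rcases hQ with hQ | hQ
    · exact Δ.center j hj Q hQ.2
    · obtain ⟨x, hx⟩ := hne
      exact ⟨x, hx, by rw [hQ.2]; exact Set.inter_subset_right⟩

/-- The first generation of a bounded set consists of the set alone. -/
def HasTop (Δ : DyadicSystem c₀ E) : Prop :=
  ∀ j ∈ generations E, j - 1 ∉ generations E → Δ.gen j = {E}

lemma hasTop_mergeTop (hc : 0 < c₀) (hc2 : c₀ ≤ 1 / 2) (hE : IsClosed E) (hne : E.Nonempty) :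
    (Δ.mergeTop hc hc2 hE hne).HasTop := by
  intro j _ hj
  ext Q
  simp [mergeTop, hj]

end DyadicSystem

/-- Among the generations at most `k` steps before `j` there is a first one, and it is either
exactly `k` steps before `j` or the first one of all. -/
lemma exists_first_generation {j : ℤ} (hj : j ∈ generations E) (k : ℕ) :
    ∃ s : ℕ, s ≤ k ∧ j - k + s ∈ generations E ∧
      (∀ i ∈ generations E, j - k ≤ i → j - k + s ≤ i) ∧
      (s = 0 ∨ j - k + s - 1 ∉ generations E) := by
  classical
  have hex : ∃ s : ℕ, j - k + s ∈ generations E := ⟨k, by simpa using hj⟩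
  refine ⟨Nat.find hex, Nat.find_min' hex (by simpa using hj), Nat.find_spec hex, ?_, ?_⟩
  · intro i hi hij
    have := Nat.find_min' hex (m := (i - (j - k)).toNat) (by
      rw [Int.toNat_of_nonneg (by omega)]; simpa using hi)
    omega
  · rcases Nat.eq_zero_or_pos (Nat.find hex) with h | h
    · exact Or.inl h
    · right
      have := Nat.find_min hex (m := Nat.find hex - 1) (by omega)
      rw [Nat.cast_sub h] at this
      simpa [add_sub_assoc] using this

end Regular

/-! ### Near-optimal planes of cubes and their angles -/

section Beta

lemma lintegral_infDist_rpow_le {X : Type*} [MetricSpace X] [MeasurableSpace X] [BorelSpace X]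
    {μ : Measure X} {s b : ℝ} (hs : 1 ≤ s) {V S : Set X} (hS : MeasurableSet S)
    (hb : Bornology.IsBounded S) (hfin : μ S ≠ ⊤) (hpos : 0 < μ S) (hdiam : 0 < Metric.diam S)
    (hV : betaSingle μ s V S ≤ b) :
    ∫⁻ x in S, ENNReal.ofReal (Metric.infDist x V ^ s) ∂μ ≤
      ENNReal.ofReal (μ.real S * (b * Metric.diam S) ^ s) := by
  have hs0 : 0 < s := by linarith
  set D := Metric.diam S with hD
  have hm : 0 < μ.real S := ENNReal.toReal_pos hpos.ne' hfin
  set I := ∫ x in S, (Metric.infDist x V / D) ^ s ∂μ with hI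
  have hI0 : 0 ≤ I := integral_nonneg fun x =>
    Real.rpow_nonneg (div_nonneg Metric.infDist_nonneg hdiam.le) _
  have hb0 : 0 ≤ b := le_trans (Real.rpow_nonneg (by positivity) _) hV
  have hIle : I ≤ μ.real S * b ^ s := by
    have h1 := Real.rpow_le_rpow (Real.rpow_nonneg (by positivity) _) hV hs0.le
    rw [← hI, ← Real.rpow_mul (by positivity), one_div_mul_cancel hs0.ne', Real.rpow_one,
      one_div, inv_mul_le_iff₀ hm] at h1
    exact h1
  obtain ⟨x0, hx0⟩ : S.Nonempty := by
    by_contra h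
    rw [Set.not_nonempty_iff_eq_empty] at h
    simp [h] at hpos
  have hmeas : Measurable fun x => (Metric.infDist x V / D) ^ s := by
    have : Measurable fun x => Metric.infDist x V := (Metric.continuous_infDist_pt V).measurable
    fun_prop
  have hint : IntegrableOn (fun x => (Metric.infDist x V / D) ^ s) S μ := by
    refine Measure.integrableOn_of_bounded (M := ((Metric.infDist x0 V + D) / D) ^ s) hfin
      hmeas.aestronglyMeasurable ?_
    filter_upwards [ae_restrict_mem hS] with x hx
    have h0 : 0 ≤ Metric.infDist x V := Metric.infDist_nonneg
    rw [Real.norm_of_nonneg (by positivity)]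
    have h2 := Metric.dist_le_diam_of_mem hb hx hx0
    have h3 : Metric.infDist x V ≤ Metric.infDist x0 V + dist x x0 :=
      Metric.infDist_le_infDist_add_dist
    gcongr
    linarith
  have h4 : ∀ x, ENNReal.ofReal (Metric.infDist x V ^ s) =
      ENNReal.ofReal (D ^ s) * ENNReal.ofReal ((Metric.infDist x V / D) ^ s) := by
    intro x
    rw [← ENNReal.ofReal_mul (by positivity), ← Real.mul_rpow hdiam.le
      (div_nonneg Metric.infDist_nonneg hdiam.le), mul_div_cancel₀ _ hdiam.ne']
  simp_rw [h4]
  rw [lintegral_const_mul _ (by fun_prop), ← ofReal_integral_eq_lintegral_ofReal hint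
    (Filter.Eventually.of_forall fun x =>
      Real.rpow_nonneg (div_nonneg Metric.infDist_nonneg hdiam.le) _),
    ← ENNReal.ofReal_mul (by positivity)]
  apply ENNReal.ofReal_le_ofReal
  rw [Real.mul_rpow hb0 hdiam.le]
  calc D ^ s * I ≤ D ^ s * (μ.real S * b ^ s) := by gcongr
    _ = _ := by ring

variable {n d : ℕ} {C c₀ : ℝ} {E : Set (EuclideanSpace ℝ (Fin n))}

lemma betaSingle_nonneg {X : Type*} [MetricSpace X] [MeasurableSpace X] {μ : Measure X} {s : ℝ}
    {V S : Set X} : 0 ≤ betaSingle μ s V S := by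
  apply Real.rpow_nonneg
  refine mul_nonneg (one_div_nonneg.2 measureReal_nonneg) (integral_nonneg fun x =>
    Real.rpow_nonneg (div_nonneg Metric.infDist_nonneg Metric.diam_nonneg) _)

lemma beta_nonneg {s : ℝ} {S : Set (EuclideanSpace ℝ (Fin n))} : 0 ≤ beta d E s S :=
  Real.iInf_nonneg fun _ => betaSingle_nonneg

/-- The infimum need not be attained. The slack δ also keeps the bounds b(T) strictly positive, and
is sent to 0 later. -/
lemma exists_betaSingle_le [Nonempty (Planes d n)] (E : Set (EuclideanSpace ℝ (Fin n))) (s : ℝ)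
    {δ : ℝ} (hδ : 0 < δ) (S : Set (EuclideanSpace ℝ (Fin n))) :
    ∃ V : Planes d n, betaSingle (surfaceMeasure (d : ℝ) E) s V.1 S ≤ beta d E s S + δ := by
  obtain ⟨V, hV⟩ := exists_lt_of_ciInf_lt
    (show (⨅ V : Planes d n, betaSingle (surfaceMeasure (d : ℝ) E) s (V.1 : Set _) S) <
      beta d E s S + δ by exact lt_add_of_pos_right _ hδ)
  exact ⟨V, hV.le⟩

/-- The constant in the moment bound for near-optimal planes of a cube. -/
def momentConst (d : ℕ) (C c₀ s : ℝ) : ℝ := C * (4 * c₀⁻¹) ^ d * (3 * c₀⁻¹) ^ s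

lemma momentConst_pos (hC : 1 ≤ C) (hc : 0 < c₀) (s : ℝ) : 0 < momentConst d C c₀ s := by
  unfold momentConst; positivity

lemma IsCube.lintegral_infDist_le (hE : IsRegular (d : ℝ) C E) (hd : 1 ≤ d) {j : ℤ}
    (hj : j ∈ generations E) {Q : Set (EuclideanSpace ℝ (Fin n))} (hQ : IsCube c₀ E j Q)
    (hc : 0 < c₀) (hc1 : c₀ ≤ 1) {s b : ℝ} (hs : 1 ≤ s) {V : Set (EuclideanSpace ℝ (Fin n))}
    (hV : betaSingle (surfaceMeasure (d : ℝ) E) s V (dilate E 2 Q) ≤ b) :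
    ∫⁻ x in dilate E 2 Q, ENNReal.ofReal (Metric.infDist x V ^ s) ∂(surfaceMeasure (d : ℝ) E) ≤
      ENNReal.ofReal (momentConst d C c₀ s * ((2 : ℝ) ^ (-j)) ^ d * (b * (2 : ℝ) ^ (-j)) ^ s) := by
  have hC := hE.one_le
  have hb0 : 0 ≤ b := betaSingle_nonneg.trans hV
  have hdp : 0 < Metric.diam (dilate E 2 Q) := lt_of_lt_of_le (by positivity)
    (hQ.le_diam_dilate hE hd hj hc hc1)
  refine (lintegral_infDist_rpow_le hs (measurableSet_dilate hE.isClosed)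
    (isBounded_dilate hQ.isBounded (hQ.nonempty hc)) (hQ.measure_dilate_ne_top hE hc)
    (hQ.measure_dilate_pos hE hj hc hc1) hdp hV).trans (ENNReal.ofReal_le_ofReal ?_)
  have h1 : (surfaceMeasure (d : ℝ) E).real (dilate E 2 Q) ≤
      C * (4 * c₀⁻¹ * (2 : ℝ) ^ (-j)) ^ d :=
    ENNReal.toReal_le_of_le_ofReal (by positivity) (hQ.measure_dilate_le hE hc)
  have h2 := hQ.diam_dilate_le hc
  have hL : (0 : ℝ) < 2 ^ (-j) := by positivity
  calc _ ≤ C * (4 * c₀⁻¹ * (2 : ℝ) ^ (-j)) ^ d * (b * (3 * c₀⁻¹ * (2 : ℝ) ^ (-j))) ^ s := by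
        gcongr
    _ = _ := by
        rw [momentConst, mul_left_comm b, Real.mul_rpow (by positivity) (by positivity), mul_pow]
        ring

/-- Both planes are compared on one ball of E inside Q. Its mass is bounded below, and the L^s
moments over the larger doubles control those over the ball because the scales differ by at most
2^k. -/
lemma exists_angleLE_of_cubes (d : ℕ) (hd : 1 ≤ d) (C c₀ s : ℝ) (hC : 1 ≤ C) (hc : 0 < c₀)
    (hc1 : c₀ ≤ 1) (hs : 1 ≤ s) (k : ℕ) :
    ∃ K : ℝ, 0 < K ∧ ∀ (n : ℕ) (E : Set (EuclideanSpace ℝ (Fin n))), IsRegular (d : ℝ) C E →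
      ∀ (j i₁ i₂ : ℤ) (Q T₁ T₂ : Set (EuclideanSpace ℝ (Fin n))),
      j ∈ generations E → i₁ ∈ generations E → i₂ ∈ generations E →
      IsCube c₀ E j Q → IsCube c₀ E i₁ T₁ → IsCube c₀ E i₂ T₂ →
      j - k ≤ i₁ → j - k ≤ i₂ →
      dilate E 2 Q ⊆ dilate E 2 T₁ → dilate E 2 Q ⊆ dilate E 2 T₂ →
      ∀ (V₁ V₂ : Planes d n) (b₁ b₂ : ℝ), 0 < b₁ → 0 < b₂ →
      betaSingle (surfaceMeasure (d : ℝ) E) s V₁.1 (dilate E 2 T₁) ≤ b₁ →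
      betaSingle (surfaceMeasure (d : ℝ) E) s V₂.1 (dilate E 2 T₂) ≤ b₂ →
      V₁.AngleLE V₂ (K * (b₁ + b₂)) := by
  obtain ⟨K, hK, h⟩ := exists_angleLE_of_lintegral_le d hd C hC
  set Λ : ℝ := 2 ^ k * c₀⁻¹ with hΛ
  have hΛ0 : 0 < Λ := by positivity
  -- As K' ≥ 1 and s ≥ 1, K' ≤ K'^s, so the moment constant can be absorbed into the base of the
  -- s-th power.
  set K' : ℝ := 1 + momentConst d C c₀ s * Λ ^ d * Λ ^ s with hK'
  have hmc := momentConst_pos (d := d) hC hc s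
  have hK'1 : 1 ≤ K' := by
    rw [hK']
    have : 0 < momentConst d C c₀ s * Λ ^ d * Λ ^ s := by positivity
    linarith
  refine ⟨K * K', by positivity, ?_⟩
  intro n E hE j i₁ i₂ Q T₁ T₂ hj hi₁ hi₂ hQ hT₁ hT₂ hji₁ hji₂ hs₁ hs₂ V₁ V₂ b₁ b₂ hb₁ hb₂ hV₁ hV₂
  obtain ⟨x, hxQ, hx⟩ := hQ.exists_center hc
  set r : ℝ := c₀ * (2 : ℝ) ^ (-j) with hr
  have hr0 : 0 < r := by positivity
  set S := Metric.ball x r ∩ E with hS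
  have hSQ : S ⊆ dilate E 2 Q := hx.trans (subset_dilate hQ.subset)
  have hmS : ENNReal.ofReal (C⁻¹ * r ^ d) ≤ surfaceMeasure (d : ℝ) E S := by
    have := hE.le_measure_ball (hQ.subset hxQ) hj hr0
      (by rw [hr]; have : (0 : ℝ) < 2 ^ (-j) := by positivity
          nlinarith)
    rwa [surfaceMeasure_apply measurableSet_ball, ← Set.inter_self E, ← Set.inter_assoc,
      ← surfaceMeasure_apply (measurableSet_ball.inter hE.isClosed.measurableSet)] at this
  have key : ∀ (i : ℤ) (T : Set (EuclideanSpace ℝ (Fin n))), i ∈ generations E →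
      IsCube c₀ E i T → j - k ≤ i → dilate E 2 Q ⊆ dilate E 2 T → ∀ (V : Planes d n) (b : ℝ),
      0 < b → b ≤ b₁ + b₂ → betaSingle (surfaceMeasure (d : ℝ) E) s V.1 (dilate E 2 T) ≤ b →
      ∫⁻ x in S, ENNReal.ofReal (Metric.infDist x V.1 ^ s) ∂(surfaceMeasure (d : ℝ) E) ≤
          ENNReal.ofReal (r ^ d * (K' * (b₁ + b₂) * r) ^ s) := by
    intro i T hi hT hji hQT V b hb hbb hV
    refine (lintegral_mono_set (hSQ.trans hQT)).trans
      ((hT.lintegral_infDist_le hE hd hi hc hc1 hs hV).trans (ENNReal.ofReal_le_ofReal ?_))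
    have hL : (2 : ℝ) ^ (-i) ≤ Λ * r := by
      rw [hΛ, hr]
      have : (2 : ℝ) ^ (-i) ≤ 2 ^ ((k : ℤ) + -j) := zpow_le_zpow_right₀ one_le_two (by omega)
      rw [zpow_add₀ two_ne_zero, zpow_natCast] at this
      calc _ ≤ _ := this
        _ = _ := by field_simp
    have hL0 : (0 : ℝ) < 2 ^ (-i) := by positivity
    calc momentConst d C c₀ s * ((2 : ℝ) ^ (-i)) ^ d * (b * (2 : ℝ) ^ (-i)) ^ s
        ≤ momentConst d C c₀ s * (Λ * r) ^ d * ((b₁ + b₂) * (Λ * r)) ^ s := by gcongr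
      _ = r ^ d * ((momentConst d C c₀ s * Λ ^ d * Λ ^ s) * ((b₁ + b₂) * r) ^ s) := by
        rw [mul_left_comm (b₁ + b₂), Real.mul_rpow hΛ0.le (by positivity), mul_pow]; ring
      _ ≤ r ^ d * (K' ^ s * ((b₁ + b₂) * r) ^ s) := by
        gcongr
        refine le_trans ?_ (Real.self_le_rpow_of_one_le hK'1 hs)
        rw [hK']; linarith
      _ = _ := by
        rw [← Real.mul_rpow (by positivity) (by positivity)]; ring_nf
  have := h n E _ (fun x hx r hr => hE.measure_ball_le hx hr) s hs V₁ V₂ x r (K' * (b₁ + b₂)) S hr0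
    (by positivity) Set.inter_subset_right Set.inter_subset_left hmS
    (key i₁ T₁ hi₁ hT₁ hji₁ hs₁ V₁ b₁ hb₁ (by linarith) hV₁)
    (key i₂ T₂ hi₂ hT₂ hji₂ hs₂ V₂ b₂ hb₂ (by linarith) hV₂)
  exact this.mono (by rw [mul_assoc])

end Beta

/-! ### Locating a pair of points at its own scale -/

section Pairs

variable {X : Type*} [MetricSpace X] [MeasurableSpace X] [BorelSpace X] {d : ℕ} {C c₀ : ℝ}
  {E : Set X}

/-- Going up k generations makes diam T exceed the diameter of 2Q. If fewer than k generations are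
available, the top cube is E itself by `HasTop`. -/
lemma DyadicSystem.dilate_subset_dilate_of_first (Δ : DyadicSystem c₀ E) (hΔ : Δ.HasTop)
    (hE : IsRegular (d : ℝ) C E) (hd : 1 ≤ d) (hc : 0 < c₀) (hc1 : c₀ ≤ 1) {k s : ℕ} {j : ℤ}
    (hk : 3 * c₀⁻¹ ≤ C⁻¹ ^ 2 * c₀ * 2 ^ k)
    (hs : s = 0 ∨ j - k + s - 1 ∉ generations E) {Q T : Set X} (hQ : IsCube c₀ E j Q)
    (hT : T ∈ Δ.level (j - k + s)) (hne : (T ∩ dilate E 2 Q).Nonempty) :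
    dilate E 2 Q ⊆ dilate E 2 T := by
  rcases hs with rfl | hs
  · intro y hy
    obtain ⟨z, hzT, hzQ⟩ := hne
    refine mem_dilate_of_dist_le hy.1 hzT ?_
    have h1 := dist_le_of_mem_dilate hQ.isBounded (hQ.nonempty hc) hy hzQ
    have h2 := hQ.diam_le hc
    have h3 := (Δ.isCube hT).le_diam hE hd hT.1 hc hc1
    have h4 : (2 : ℝ) ^ (-(j - k + (0 : ℕ))) = 2 ^ k * 2 ^ (-j) := by
      rw [show -(j - k + (0 : ℕ)) = (k : ℤ) + -j by push_cast; ring, zpow_add₀ two_ne_zero,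
        zpow_natCast]
    rw [h4] at h3
    have h5 : (0 : ℝ) < 2 ^ (-j) := by positivity
    nlinarith
  · have h1 : T = E := by
      have := hT.2
      rwa [hΔ _ hT.1 hs] at this
    rw [h1]
    exact fun y hy => subset_dilate subset_rfl hy.1

/-- T is the last cube around x before y first drops out of the double. Failure one generation later
forces |x-y| to exceed the diameter of that smaller cube, hence the factor 1/2. -/
lemma DyadicSystem.exists_cube_of_pair (Δ : DyadicSystem c₀ E)
    (hE : IsRegular (d : ℝ) C E) (hd : 1 ≤ d) (hc : 0 < c₀) (hc1 : c₀ ≤ 1) {j : ℤ}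
    (hj : j ∈ generations E) {x y : X} (hx : x ∈ E) (hy : y ∈ E) (hxy : x ≠ y)
    (htop : ∀ T ∈ Δ.level j, x ∈ T → y ∈ dilate E 2 T) :
    ∃ N : ℕ, ∃ T ∈ Δ.level (j + N), x ∈ T ∧ y ∈ dilate E 2 T ∧
      C⁻¹ ^ 2 * c₀ / 2 * (2 : ℝ) ^ (-(j + N)) < dist x y := by
  classical
  have hC := hE.one_le
  have hlev : ∀ N : ℕ, j + N ∈ generations E := fun N => generations_mono hj (by omega)
  have hex : ∃ N : ℕ, ∃ T ∈ Δ.level (j + N), x ∈ T ∧ y ∉ dilate E 2 T := by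
    have hpos : 0 < dist x y := dist_pos.2 hxy
    obtain ⟨N, hN⟩ := exists_pow_lt_of_lt_one
      (show 0 < dist x y / (3 * c₀⁻¹ * (2 : ℝ) ^ (-j)) by positivity)
      (show (2 : ℝ)⁻¹ < 1 by norm_num)
    obtain ⟨T, hT, hxT⟩ := Δ.exists_mem_level (hlev N) hx
    refine ⟨N, T, hT, hxT, fun hyT => ?_⟩
    have hcube := Δ.isCube hT
    have h1 := dist_le_of_mem_dilate hcube.isBounded (hcube.nonempty hc)
      (subset_dilate hcube.subset hxT) hyT
    have h2 := hcube.diam_le hc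
    rw [lt_div_iff₀ (by positivity)] at hN
    have h3 : (2 : ℝ) ^ (-(j + N)) = 2⁻¹ ^ N * 2 ^ (-j) := by
      rw [show -(j + (N : ℤ)) = -(N : ℤ) + -j by ring, zpow_add₀ two_ne_zero, zpow_neg,
        zpow_natCast, inv_pow]
    rw [h3] at h2
    linarith
  obtain ⟨T', hT', hxT', hyT'⟩ := Nat.find_spec hex
  have hN0 : Nat.find hex ≠ 0 := by
    intro h0
    rw [h0] at hT'
    exact hyT' (htop T' (by simpa using hT') hxT')
  obtain ⟨N, hN⟩ := Nat.exists_eq_succ_of_ne_zero hN0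
  have hmin := Nat.find_min hex (m := N) (by omega)
  push Not at hmin
  obtain ⟨T, hT, hxT⟩ := Δ.exists_mem_level (hlev N) hx
  refine ⟨N, T, hT, hxT, hmin T hT hxT, ?_⟩
  have h1 := lt_dist_of_notMem_dilate hy hxT' hyT'
  have h2 := (Δ.isCube hT').le_diam hE hd hT'.1 hc hc1
  rw [hN] at h2
  rw [dist_comm]
  refine lt_of_le_of_lt (le_trans (le_of_eq ?_) h2) h1
  rw [show -(j + ((N.succ : ℕ) : ℤ)) = -(j + N) - 1 by push_cast; ring, zpow_sub_one₀ two_ne_zero]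
  ring

end Pairs

/-! ### Power inequalities and the pointwise estimate -/

lemma exists_add_two_pow_le (m : ℕ) : ∃ K : ℝ, 0 < K ∧ ∀ N : ℕ, ((N : ℝ) + 2) ^ m ≤ K * 2 ^ N := by
  obtain ⟨K, hK⟩ := (tendsto_pow_const_div_const_pow_of_one_lt m
    (one_lt_two : (1 : ℝ) < 2)).bddAbove_range
  refine ⟨4 * (|K| + 1), by positivity, fun N => ?_⟩
  have h1 := hK ⟨N + 2, rfl⟩
  simp only [Nat.cast_add, Nat.cast_ofNat] at h1
  rw [div_le_iff₀ (by positivity)] at h1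
  refine h1.trans ?_
  rw [pow_add]
  have h2 := le_abs_self K
  have h3 : (0 : ℝ) < 2 ^ N := by positivity
  nlinarith

/-- Hölder for N + 2 terms loses only a power of N + 2. Bounding it by 2^N is wasteful but
affordable against the decay in `scale_le`. -/
lemma exists_add_sum_rpow_le (s : ℝ) (hs : 1 ≤ s) : ∃ K : ℝ, 0 < K ∧ ∀ (N : ℕ) (a : ℝ) (b : ℕ → ℝ),
    0 ≤ a → (∀ i, 0 ≤ b i) → (a + ∑ i ∈ Finset.range (N + 1), b i) ^ s ≤
      K * 2 ^ N * (a ^ s + ∑ i ∈ Finset.range (N + 1), b i ^ s) := by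
  obtain ⟨K, hK, h⟩ := exists_add_two_pow_le ⌈s⌉₊
  refine ⟨K, hK, fun N a b ha hb => ?_⟩
  let c : ℕ → ℝ := fun i => if i = N + 1 then a else b i
  have hc0 : ∀ i, 0 ≤ c i := fun i => by
    simp only [c]; split_ifs
    · exact ha
    · exact hb i
  have hsum : ∀ g : ℝ → ℝ, ∑ i ∈ Finset.range (N + 2), g (c i) =
      g a + ∑ i ∈ Finset.range (N + 1), g (b i) := by
    intro g
    rw [Finset.sum_range_succ, add_comm]
    congr 1
    · simp [c]
    · refine Finset.sum_congr rfl fun i hi => ?_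
      have : i ≠ N + 1 := by have := Finset.mem_range.1 hi; omega
      simp [c, this]
  have h1 := Real.rpow_sum_le_const_mul_sum_rpow_of_nonneg (Finset.range (N + 2)) hs
    (fun i _ => hc0 i)
  rw [hsum fun x => x, hsum fun x => x ^ s, Finset.card_range] at h1
  refine h1.trans ?_
  have h2 : (((N + 2 : ℕ) : ℝ)) ^ (s - 1) ≤ K * 2 ^ N := by
    refine le_trans ?_ (h N)
    rw [← Real.rpow_natCast]
    push_cast
    apply Real.rpow_le_rpow_of_exponent_le
    · linarith [(Nat.cast_nonneg N : (0 : ℝ) ≤ N)]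
    · linarith [Nat.le_ceil s]
  have h3 : 0 ≤ a ^ s + ∑ i ∈ Finset.range (N + 1), b i ^ s :=
    add_nonneg (Real.rpow_nonneg ha _) (Finset.sum_nonneg fun i _ => Real.rpow_nonneg (hb i) _)
  gcongr

lemma add_three_rpow_le {a b c p : ℝ} (ha : 0 ≤ a) (hb : 0 ≤ b) (hc : 0 ≤ c) (hp : 0 ≤ p) :
    (a + b + c) ^ p ≤ 3 ^ p * (a ^ p + b ^ p + c ^ p) := by
  have ha' := Real.rpow_nonneg ha p
  have hb' := Real.rpow_nonneg hb p
  have hc' := Real.rpow_nonneg hc p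
  have key : ∀ m : ℝ, 0 ≤ m → a ≤ m → b ≤ m → c ≤ m → m ^ p ≤ a ^ p + b ^ p + c ^ p →
      (a + b + c) ^ p ≤ 3 ^ p * (a ^ p + b ^ p + c ^ p) := by
    intro m hm h1 h2 h3 h4
    calc (a + b + c) ^ p ≤ (3 * m) ^ p := by
          apply Real.rpow_le_rpow (by positivity) (by linarith) hp
      _ = 3 ^ p * m ^ p := Real.mul_rpow (by norm_num) hm
      _ ≤ _ := by gcongr
  rcases le_total a b with h | h <;> rcases le_total b c with h' | h'
  · exact key c hc (h.trans h') h' le_rfl (by linarith)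
  · exact key b hb h le_rfl h' (by linarith)
  · rcases le_total a c with h'' | h''
    · exact key c hc h'' h' le_rfl (by linarith)
    · exact key a ha le_rfl h h'' (by linarith)
  · exact key a ha le_rfl h (h'.trans h) (by linarith)

/-- Pythagoras for U, with the orthogonal part of x - y controlled by the distances to V plus the
angle A times |x-y|. At |x-y| ≈ L the first contribution is divided by L and the second multiplied
by it. -/
lemma Planes.abs_dist_sub_rpow_le {n d : ℕ} {p κ₁ κ₂ : ℝ} (hp : 0 ≤ p) (hκ₁ : 0 < κ₁)
    (hκ₂ : 0 < κ₂) {U V : Planes d n} {A L : ℝ} (hUV : U.AngleLE V A) (hA : 0 ≤ A) (hL : 0 < L)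
    {x y : EuclideanSpace ℝ (Fin n)} (h₁ : κ₁ * L ≤ dist x y) (h₂ : dist x y ≤ κ₂ * L) :
    |dist x y - dist (U.proj x) (U.proj y)| ^ p ≤
      (9 * (κ₁⁻¹ + κ₂)) ^ p * ((L ^ p)⁻¹ * (Metric.infDist x V.1 ^ (2 * p) +
        Metric.infDist y V.1 ^ (2 * p)) + L ^ p * A ^ (2 * p)) := by
  set f := |dist x y - dist (U.proj x) (U.proj y)| with hf
  set a := Metric.infDist x (V.1 : Set (EuclideanSpace ℝ (Fin n)))
  set b := Metric.infDist y (V.1 : Set (EuclideanSpace ℝ (Fin n)))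
  have ha : 0 ≤ a := Metric.infDist_nonneg
  have hb : 0 ≤ b := Metric.infDist_nonneg
  have h3 := U.abs_dist_sub_mul_le x y
  have h4 := hUV (x - y)
  have h5 := V.norm_perp_sub_le x y
  rw [← dist_eq_norm, ← hf] at h3
  rw [← dist_eq_norm] at h4
  set D := dist x y
  have hD : 0 < D := lt_of_lt_of_le (by positivity) h₁
  have hfM : f ≤ 3 * (κ₁⁻¹ + κ₂) * (a ^ 2 / L + b ^ 2 / L + A ^ 2 * L) := by
    have h6 : ‖U.perp (x - y)‖ ≤ a + b + A * D := by linarith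
    have h7 : ‖U.perp (x - y)‖ ^ 2 ≤ (a + b + A * D) ^ 2 := by gcongr
    have h8 : f * D ≤ 3 * (a ^ 2 + b ^ 2 + A ^ 2 * D ^ 2) := by
      nlinarith [sq_nonneg (a - b), sq_nonneg (a - A * D), sq_nonneg (b - A * D)]
    have h9 : f ≤ 3 * ((a ^ 2 + b ^ 2) / D + A ^ 2 * D) := by
      rw [← le_div_iff₀ hD] at h8
      refine h8.trans (le_of_eq ?_)
      field_simp
    have h10 : (a ^ 2 + b ^ 2) / D ≤ κ₁⁻¹ * (a ^ 2 / L + b ^ 2 / L) := by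
      calc (a ^ 2 + b ^ 2) / D ≤ (a ^ 2 + b ^ 2) / (κ₁ * L) := by gcongr
        _ = _ := by field_simp
    have h11 : A ^ 2 * D ≤ A ^ 2 * (κ₂ * L) := by gcongr
    have h12 : 0 ≤ κ₂ * (a ^ 2 / L + b ^ 2 / L) := by positivity
    have h13 : 0 ≤ κ₁⁻¹ * (A ^ 2 * L) := by positivity
    nlinarith
  have hconv : ∀ t : ℝ, 0 ≤ t → (t ^ 2) ^ p = t ^ (2 * p) := fun t ht => by
    rw [Real.rpow_mul ht, Real.rpow_two]
  calc f ^ p ≤ (3 * (κ₁⁻¹ + κ₂) * (a ^ 2 / L + b ^ 2 / L + A ^ 2 * L)) ^ p :=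
        Real.rpow_le_rpow (abs_nonneg _) hfM hp
    _ = (3 * (κ₁⁻¹ + κ₂)) ^ p * (a ^ 2 / L + b ^ 2 / L + A ^ 2 * L) ^ p :=
        Real.mul_rpow (by positivity) (by positivity)
    _ ≤ (3 * (κ₁⁻¹ + κ₂)) ^ p * (3 ^ p * ((a ^ 2 / L) ^ p + (b ^ 2 / L) ^ p + (A ^ 2 * L) ^ p)) := by
        gcongr
        exact add_three_rpow_le (by positivity) (by positivity) (by positivity) hp
    _ = _ := by
        rw [show 9 * (κ₁⁻¹ + κ₂) = 3 * (κ₁⁻¹ + κ₂) * 3 by ring,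
          Real.mul_rpow (x := 3 * (κ₁⁻¹ + κ₂)) (y := 3) (by positivity) (by positivity),
          Real.div_rpow (by positivity) hL.le,
          Real.div_rpow (by positivity) hL.le, Real.mul_rpow (by positivity) hL.le,
          hconv a ha, hconv b hb, hconv A hA]
        ring

/-- Angle between a near-optimal plane at the top of a chain of cubes and one at the bottom. -/
lemma exists_angleLE_of_chain (d : ℕ) (hd : 1 ≤ d) (C c₀ s : ℝ) (hC : 1 ≤ C) (hc : 0 < c₀)
    (hc1 : c₀ ≤ 1) (hs : 1 ≤ s) (k : ℕ) (hk : 3 * c₀⁻¹ ≤ C⁻¹ ^ 2 * c₀ * 2 ^ k) :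
    ∃ K : ℝ, 0 < K ∧ ∀ (n : ℕ) (E : Set (EuclideanSpace ℝ (Fin n))), IsRegular (d : ℝ) C E →
      ∀ Δ : DyadicSystem c₀ E, Δ.HasTop →
      ∀ (V : Set (EuclideanSpace ℝ (Fin n)) → Planes d n)
        (b : Set (EuclideanSpace ℝ (Fin n)) → ℝ),
      (∀ T, 0 < b T) →
      (∀ T, betaSingle (surfaceMeasure (d : ℝ) E) s (V T).1 (dilate E 2 T) ≤ b T) →
      ∀ (j : ℤ) (t : ℕ) (Q T' : Set (EuclideanSpace ℝ (Fin n))), j ∈ generations E →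
      IsCube c₀ E j Q → (t = 0 ∨ j - k + t - 1 ∉ generations E) →
      T' ∈ Δ.level (j - k + t) → (T' ∩ dilate E 2 Q).Nonempty →
      ∀ (x : EuclideanSpace ℝ (Fin n)) (c : ℕ → Set (EuclideanSpace ℝ (Fin n))),
      x ∈ dilate E 2 Q → (∀ i : ℕ, c i ∈ Δ.level (j - k + t + i)) → (∀ i, x ∈ c i) →
      ∀ N, (V T').AngleLE (V (c N)) (K * (b T' + ∑ i ∈ Finset.range (N + 1), b (c i))) := by
  -- The gap k + 1 covers both uses: at most k generations from Q up to the top of the chain, and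
  -- one generation between consecutive links.
  obtain ⟨K, hK, h⟩ := exists_angleLE_of_cubes d hd C c₀ s hC hc hc1 hs (k + 1)
  refine ⟨2 * K, by positivity, ?_⟩
  intro n E hE Δ hΔ V b hb hV j t Q T' hj hQ ht hT' hT'Q x c hxQ hc' hxc
  have hind : ∀ N, (V T').AngleLE (V (c N))
      (K * (b T' + ∑ i ∈ Finset.range (N + 1), b (c i) + ∑ i ∈ Finset.range N, b (c i))) := by
    intro N
    induction N with
    | zero =>
      have h0 : c 0 ∈ Δ.level (j - k + t) := by simpa using hc' 0
      have := h n E hE j _ _ Q T' (c 0) hj hT'.1 h0.1 hQ (Δ.isCube hT') (Δ.isCube h0)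
        (by push_cast; omega) (by push_cast; omega)
        (Δ.dilate_subset_dilate_of_first hΔ hE hd hc hc1 hk ht hQ hT' hT'Q)
        (Δ.dilate_subset_dilate_of_first hΔ hE hd hc hc1 hk ht hQ h0 ⟨x, hxc 0, hxQ⟩)
        (V T') (V (c 0)) _ _ (hb _) (hb _) (hV _) (hV _)
      simpa using this
    | succ N ih =>
      -- For consecutive links the smaller cube itself serves as the common cube Q of the
      -- comparison.
      have hsub : c (N + 1) ⊆ c N :=
        Δ.subset_of_mem (by push_cast; omega) (hc' N) (hc' (N + 1)) (hxc N) (hxc (N + 1))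
      have hcube := Δ.isCube (hc' (N + 1))
      have := h n E hE _ _ _ _ _ _ (hc' (N + 1)).1 (hc' N).1 (hc' (N + 1)).1
        hcube (Δ.isCube (hc' N)) hcube
        (by push_cast; omega) (by push_cast; omega)
        (dilate_mono (hcube.nonempty hc) hsub (Δ.isCube (hc' N)).isBounded) subset_rfl
        (V (c N)) (V (c (N + 1))) _ _ (hb _) (hb _) (hV _) (hV _)
      refine (ih.trans this).mono (le_of_eq ?_)
      rw [Finset.sum_range_succ _ (N + 1), Finset.sum_range_succ _ N]
      ring
  intro N
  refine (hind N).mono ?_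
  rw [Finset.sum_range_succ]
  have h1 := hb T'
  have h2 := hb (c N)
  nlinarith

/-! ### Summation tools -/

section Sums

lemma tsum_ite_le_geometric (i : ℕ) :
    ∑' N : ℕ, (if i ≤ N then (2⁻¹ : ℝ≥0∞) ^ N else 0) = 2 * 2⁻¹ ^ i := by
  have hsplit := Summable.sum_add_tsum_nat_add' (f := fun N : ℕ =>
    if i ≤ N then (2⁻¹ : ℝ≥0∞) ^ N else 0) (k := i) ENNReal.summable
  rw [← hsplit, Finset.sum_eq_zero, zero_add]
  · simp only [Nat.le_add_left, if_true, pow_add]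
    rw [ENNReal.tsum_mul_right, ENNReal.tsum_geometric, ENNReal.one_sub_inv_two, inv_inv]
  · intro N hN
    have := Finset.mem_range.1 hN
    rw [if_neg (by omega)]

lemma tsum_geometric_mul_sum_range_le (X : ℕ → ℝ≥0∞) :
    ∑' N : ℕ, (2⁻¹ : ℝ≥0∞) ^ N * ∑ i ∈ Finset.range (N + 1), X i = 2 * ∑' i : ℕ, 2⁻¹ ^ i * X i := by
  have h1 : ∀ N : ℕ, (2⁻¹ : ℝ≥0∞) ^ N * ∑ i ∈ Finset.range (N + 1), X i =
      ∑' i : ℕ, (if i ≤ N then (2⁻¹ : ℝ≥0∞) ^ N else 0) * X i := by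
    intro N
    rw [tsum_eq_sum (s := Finset.range (N + 1)), Finset.mul_sum]
    · refine Finset.sum_congr rfl fun i hi => ?_
      rw [if_pos (by have := Finset.mem_range.1 hi; omega)]
    · intro i hi
      rw [if_neg (by rw [Finset.mem_range] at hi; omega), zero_mul]
  simp_rw [h1]
  rw [ENNReal.tsum_comm, ← ENNReal.tsum_mul_left]
  refine tsum_congr fun i => ?_
  rw [ENNReal.tsum_mul_right, tsum_ite_le_geometric, mul_assoc]

/-- Tonelli: the majorant of the distance defect is a sum of product kernels, so its double integral
decouples. -/
lemma lintegral_lintegral_tsum_product {X ι : Type*} [MeasurableSpace X] [Countable ι]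
    (μ : Measure X) {D φ ψ : ι → X → ℝ≥0∞} (hD : ∀ i, Measurable (D i))
    (hφ : ∀ i, Measurable (φ i)) (hψ : ∀ i, Measurable (ψ i)) (a c : ι → ℝ≥0∞) :
    ∫⁻ y, ∫⁻ x, ∑' i, (a i * (D i x * ψ i y + φ i x * D i y) + c i * (φ i x * ψ i y)) ∂μ ∂μ =
      ∑' i, (a i * ((∫⁻ x, D i x ∂μ) * ∫⁻ x, ψ i x ∂μ) +
        a i * ((∫⁻ x, φ i x ∂μ) * ∫⁻ x, D i x ∂μ) +
        c i * ((∫⁻ x, φ i x ∂μ) * ∫⁻ x, ψ i x ∂μ)) := by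
  have h1 : ∀ y, ∫⁻ x, ∑' i, (a i * (D i x * ψ i y + φ i x * D i y) + c i * (φ i x * ψ i y)) ∂μ =
      ∑' i, (a i * ((∫⁻ x, D i x ∂μ) * ψ i y) + a i * ((∫⁻ x, φ i x ∂μ) * D i y) +
        c i * ((∫⁻ x, φ i x ∂μ) * ψ i y)) := by
    intro y
    rw [lintegral_tsum (fun i => by fun_prop)]
    refine tsum_congr fun i => ?_
    rw [lintegral_add_left (by fun_prop), lintegral_const_mul _ (by fun_prop),
      lintegral_add_left (by fun_prop), lintegral_mul_const _ (hD i), lintegral_mul_const _ (hφ i),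
      lintegral_const_mul _ (by fun_prop), lintegral_mul_const _ (hφ i), mul_add]
  simp_rw [h1]
  rw [lintegral_tsum (fun i => by fun_prop)]
  refine tsum_congr fun i => ?_
  rw [lintegral_add_left (by fun_prop), lintegral_add_left (by fun_prop),
    lintegral_const_mul _ (by fun_prop), lintegral_const_mul _ (by fun_prop),
    lintegral_const_mul _ (by fun_prop), lintegral_const_mul _ (by fun_prop),
    lintegral_const_mul _ (by fun_prop), lintegral_const_mul _ (by fun_prop)]

end Sums

/-! ### Sums over cubes meeting a doubled cube -/

section Touching

variable {X : Type*} [MetricSpace X] [MeasurableSpace X] [BorelSpace X] {d : ℕ} {C c₀ : ℝ}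
  {E : Set X}

/-- The cubes of generation `i` meeting the double of `Q`. -/
def DyadicSystem.touching (Δ : DyadicSystem c₀ E) (Q : Set X) (i : ℤ) : Set (Set X) :=
  {T | T ∈ Δ.level i ∧ (T ∩ dilate E 2 Q).Nonempty}

lemma DyadicSystem.tsum_measure_le [SecondCountableTopology X] (Δ : DyadicSystem c₀ E)
    (hc : 0 < c₀) {i : ℤ} {𝒯 : Set (Set X)} (h𝒯 : 𝒯 ⊆ Δ.level i) {F : Set X}
    (hF : ∀ T ∈ 𝒯, T ⊆ F) (μ : Measure X) : ∑' T : 𝒯, μ T ≤ μ F := by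
  have h := measure_biUnion (μ := μ) (f := id) ((Δ.countable_level hc i).mono h𝒯)
    ((Δ.pairwiseDisjoint_level i).subset h𝒯) (fun T hT => (Δ.isCube (h𝒯 hT)).measurable)
  simp only [id] at h
  rw [← h]
  exact measure_mono (Set.iUnion₂_subset hF)

lemma DyadicSystem.subset_ball_of_touching (Δ : DyadicSystem c₀ E) (hc : 0 < c₀) {Q T : Set X}
    {i j : ℤ} {L : ℝ} (hQ : IsCube c₀ E j Q) (hj : (2 : ℝ) ^ (-j) ≤ L) (hi : (2 : ℝ) ^ (-i) ≤ L)
    (hT : T ∈ Δ.touching Q i) {x : X} (hx : x ∈ dilate E 2 Q) :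
    T ⊆ Metric.ball x (6 * c₀⁻¹ * L) := by
  intro y hy
  obtain ⟨hT, z, hzT, hzQ⟩ := hT
  have hcube := Δ.isCube hT
  have h1 := Metric.dist_le_diam_of_mem hcube.isBounded hy hzT
  have h2 := hcube.diam_le hc
  have h3 := hQ.dilate_subset_ball hc hx hzQ
  rw [Metric.mem_ball] at h3 ⊢
  have h4 := dist_triangle y z x
  have h5 : (0 : ℝ) < 2 ^ (-j) := by positivity
  have h6 : 0 < c₀⁻¹ := inv_pos.2 hc
  have h7 : c₀⁻¹ * (2 : ℝ) ^ (-i) ≤ c₀⁻¹ * L := by gcongr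
  have h8 : 4 * c₀⁻¹ * (2 : ℝ) ^ (-j) ≤ 4 * c₀⁻¹ * L := by gcongr
  have h9 : 0 < c₀⁻¹ * L := by
    have : 0 < L := h5.trans_le hj
    positivity
  linarith

/-- Comparison of a `d`-th power of the side length with the measure of a cube. -/
lemma IsCube.ofReal_pow_le (hE : IsRegular (d : ℝ) C E) {j : ℤ} (hj : j ∈ generations E)
    {Q : Set X} (hQ : IsCube c₀ E j Q) (hc : 0 < c₀) (hc1 : c₀ ≤ 1) :
    ENNReal.ofReal (((2 : ℝ) ^ (-j)) ^ d) ≤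
      ENNReal.ofReal (C * c₀⁻¹ ^ d) * surfaceMeasure d E Q := by
  have hC := hE.one_le
  calc ENNReal.ofReal (((2 : ℝ) ^ (-j)) ^ d)
      = ENNReal.ofReal (C * c₀⁻¹ ^ d) * ENNReal.ofReal (C⁻¹ * (c₀ * (2 : ℝ) ^ (-j)) ^ d) := by
        rw [← ENNReal.ofReal_mul (by positivity)]
        congr 1
        rw [mul_pow, inv_pow]
        field_simp
    _ ≤ _ := by gcongr; exact hQ.le_measure hE hj hc hc1

/-- The sum over scales of the weights of the cubes meeting the double of `Q`. -/
def DyadicSystem.weightedSum (Δ : DyadicSystem c₀ E) (μ : Measure X) (B : Set X → ℝ≥0∞)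
    (Q : Set X) (i : ℤ) : ℝ≥0∞ :=
  ∑' N : ℕ, (2⁻¹ : ℝ≥0∞) ^ N * ∑' T : Δ.touching Q (i + N), B T * μ T

open Classical in
-- Exchanging sums, the cubes T inside a fixed T'' are disjoint and have total mass at most μ(T'').
-- So each generation l of the chain contributes its own sum Y_l, and the weights 2^{-N} with N ≥ l
-- add up to 2 · 2^{-l}. For the B(T') term, all touching cubes of one generation have mass at most
-- κ μ(T').
lemma DyadicSystem.tsum_chain_le [SecondCountableTopology X] (hE : IsRegular (d : ℝ) C E)
    (Δ : DyadicSystem c₀ E) (hc : 0 < c₀) (hc1 : c₀ ≤ 1) (B : Set X → ℝ≥0∞) {Q T' : Set X}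
    {i j : ℤ} (hQ : IsCube c₀ E j Q) (hij : i ≤ j) (hT' : T' ∈ Δ.touching Q i) :
    ∑' N : ℕ, (2⁻¹ : ℝ≥0∞) ^ N * ∑' T : Δ.touching Q (i + N), surfaceMeasure d E T *
      (B T' + ∑ l ∈ Finset.range (N + 1), ∑' T'' : Δ.touching Q (i + l),
        if (T : Set X) ⊆ T'' then B T'' else 0) ≤
      ENNReal.ofReal (2 * (C * (6 * c₀⁻¹) ^ d * (C * c₀⁻¹ ^ d)) + 2) *
        Δ.weightedSum (surfaceMeasure d E) B Q i := by
  set μ := surfaceMeasure (d : ℝ) E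
  have hC := hE.one_le
  set κ : ℝ := C * (6 * c₀⁻¹) ^ d * (C * c₀⁻¹ ^ d) with hκ
  have hκ0 : 0 ≤ κ := by positivity
  let Y : ℕ → ℝ≥0∞ := fun l => ∑' T : Δ.touching Q (i + l), B T * μ T
  have hY : Δ.weightedSum μ B Q i = ∑' l : ℕ, 2⁻¹ ^ l * Y l := rfl
  obtain ⟨x, hx⟩ := hQ.nonempty hc
  have hx2 := subset_dilate hQ.subset hx
  have hmass : ∀ N : ℕ, ∑' T : Δ.touching Q (i + N), μ T ≤ ENNReal.ofReal κ * μ T' := by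
    intro N
    have h1 := Δ.tsum_measure_le hc (𝒯 := Δ.touching Q (i + N)) (fun T hT => hT.1)
      (fun T hT => Δ.subset_ball_of_touching hc (L := 2 ^ (-i)) hQ
        (zpow_le_zpow_right₀ one_le_two (by omega)) (zpow_le_zpow_right₀ one_le_two (by omega))
        hT hx2) μ
    refine h1.trans ((hE.measure_ball_le hx2.1 (by positivity)).trans ?_)
    have h2 := (Δ.isCube hT'.1).ofReal_pow_le hE hT'.1.1 hc hc1
    rw [mul_pow, ← mul_assoc, ENNReal.ofReal_mul (by positivity), hκ,
      ENNReal.ofReal_mul (p := C * (6 * c₀⁻¹) ^ d) (by positivity), mul_assoc]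
    gcongr
  have hswap : ∀ N l : ℕ, ∑' T : Δ.touching Q (i + N), μ T *
      (∑' T'' : Δ.touching Q (i + l), if (T : Set X) ⊆ T'' then B T'' else 0) ≤ Y l := by
    intro N l
    simp_rw [← ENNReal.tsum_mul_left]
    rw [ENNReal.tsum_comm]
    refine ENNReal.tsum_le_tsum fun T'' => ?_
    calc ∑' T : Δ.touching Q (i + N), μ T * (if (T : Set X) ⊆ T'' then B T'' else 0)
        = B T'' * ∑' T : Δ.touching Q (i + N), (if (T : Set X) ⊆ T'' then μ T else 0) := by
          rw [← ENNReal.tsum_mul_left]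
          refine tsum_congr fun T => ?_
          split_ifs
          · rw [mul_comm]
          · simp
      _ ≤ B T'' * ∑' T : Δ.touching Q (i + N), μ.restrict T'' T := by
          gcongr with T
          split_ifs with h
          · rw [Measure.restrict_apply (Δ.isCube T.2.1).measurable,
              Set.inter_eq_self_of_subset_left h]
          · exact zero_le
      _ ≤ B T'' * μ.restrict T'' Set.univ := by
          gcongr
          exact Δ.tsum_measure_le hc (𝒯 := Δ.touching Q (i + N)) (fun T hT => hT.1)
            (fun T _ => Set.subset_univ T) _
      _ = _ := by rw [Measure.restrict_apply_univ]
  have hstep : ∀ N : ℕ, ∑' T : Δ.touching Q (i + N), μ T *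
      (B T' + ∑ l ∈ Finset.range (N + 1), ∑' T'' : Δ.touching Q (i + l),
        if (T : Set X) ⊆ T'' then B T'' else 0) ≤
      ENNReal.ofReal κ * Y 0 + ∑ l ∈ Finset.range (N + 1), Y l := by
    intro N
    simp_rw [mul_add, Finset.mul_sum]
    rw [ENNReal.tsum_add, Summable.tsum_finsetSum (fun _ _ => ENNReal.summable)]
    refine add_le_add ?_ (Finset.sum_le_sum fun l _ => hswap N l)
    rw [ENNReal.tsum_mul_right]
    calc (∑' T : Δ.touching Q (i + N), μ T) * B T' ≤ ENNReal.ofReal κ * μ T' * B T' := by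
          gcongr; exact hmass N
      _ = ENNReal.ofReal κ * (B T' * μ T') := by ring
      _ ≤ _ := by
          gcongr
          have hT0 : T' ∈ Δ.touching Q (i + (0 : ℕ)) := by simpa using hT'
          exact ENNReal.le_tsum (f := fun T : Δ.touching Q (i + (0 : ℕ)) => B T * μ T) ⟨T', hT0⟩
  calc _ ≤ ∑' N : ℕ, (2⁻¹ : ℝ≥0∞) ^ N *
        (ENNReal.ofReal κ * Y 0 + ∑ l ∈ Finset.range (N + 1), Y l) := by
        gcongr with N
        exact hstep N
    _ = 2 * (ENNReal.ofReal κ * Y 0) + 2 * ∑' l : ℕ, 2⁻¹ ^ l * Y l := by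
        simp_rw [mul_add]
        rw [ENNReal.tsum_add, tsum_geometric_mul_sum_range_le, ENNReal.tsum_mul_right,
          ENNReal.tsum_geometric, ENNReal.one_sub_inv_two, inv_inv]
    _ ≤ 2 * (ENNReal.ofReal κ * ∑' l : ℕ, 2⁻¹ ^ l * Y l) + 2 * ∑' l : ℕ, 2⁻¹ ^ l * Y l := by
        gcongr
        have := ENNReal.le_tsum (f := fun l : ℕ => (2⁻¹ : ℝ≥0∞) ^ l * Y l) 0
        simpa using this
    _ = _ := by
        rw [hY, ENNReal.ofReal_add (by positivity) zero_le_two, ENNReal.ofReal_mul zero_le_two]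
        simp only [ENNReal.ofReal_ofNat]
        ring

end Touching

/-! ### The distance defect on a doubled cube -/

lemma zpow_neg_add_natCast (i : ℤ) (N : ℕ) :
    (2 : ℝ) ^ (-(i + (N : ℤ))) = 2 ^ (-i) * 2⁻¹ ^ N := by
  rw [neg_add, zpow_add₀ two_ne_zero, zpow_neg 2 (N : ℤ), zpow_natCast, inv_pow]

/-- The powers p ≥ 1 and d ≥ 1 each yield a factor 2^{-N}: one cancels the Hölder loss 2^N, the
other becomes the weight in `weightedSum`. -/
lemma scale_le {d : ℕ} (hd : 1 ≤ d) {p L : ℝ} (hp : 1 ≤ p) (hL : 0 < L) (N : ℕ) :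
    (2 : ℝ) ^ N * ((L * 2⁻¹ ^ N) ^ p * (L * 2⁻¹ ^ N) ^ d) ≤ L ^ p * L ^ d * 2⁻¹ ^ N := by
  have h0 : (0 : ℝ) < 2⁻¹ ^ N := by positivity
  have h1 : (2⁻¹ : ℝ) ^ N ≤ 1 := pow_le_one₀ (by norm_num) (by norm_num)
  have h2 : ((2⁻¹ : ℝ) ^ N) ^ p ≤ 2⁻¹ ^ N := by
    have := Real.rpow_le_rpow_of_exponent_ge h0 h1 hp
    rwa [Real.rpow_one] at this
  have h3 : ((2⁻¹ : ℝ) ^ N) ^ d ≤ 2⁻¹ ^ N := pow_le_of_le_one h0.le h1 (by omega)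
  rw [Real.mul_rpow hL.le h0.le, mul_pow]
  calc (2 : ℝ) ^ N * (L ^ p * ((2⁻¹ : ℝ) ^ N) ^ p * (L ^ d * ((2⁻¹ : ℝ) ^ N) ^ d))
      ≤ (2 : ℝ) ^ N * (L ^ p * 2⁻¹ ^ N * (L ^ d * 2⁻¹ ^ N)) := by gcongr
    _ = L ^ p * L ^ d * 2⁻¹ ^ N * (2 ^ N * 2⁻¹ ^ N) := by ring
    _ = _ := by rw [← mul_pow]; norm_num

open Classical in
/-- The mean oscillation of distances under a suitable projection is controlled by the flatness of
all smaller cubes. -/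
lemma exists_lintegral_abs_dist_sub_le (d : ℕ) (hd : 1 ≤ d) (C c₀ p : ℝ) (hC : 1 ≤ C)
    (hc : 0 < c₀) (hc1 : c₀ ≤ 1) (hp : 1 ≤ p) (k : ℕ) (hk : 3 * c₀⁻¹ ≤ C⁻¹ ^ 2 * c₀ * 2 ^ k) :
    ∃ K : ℝ, 0 < K ∧ ∀ (n : ℕ) (E : Set (EuclideanSpace ℝ (Fin n))), IsRegular (d : ℝ) C E →
      ∀ Δ : DyadicSystem c₀ E, Δ.HasTop →
      ∀ (V : Set (EuclideanSpace ℝ (Fin n)) → Planes d n)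
        (b : Set (EuclideanSpace ℝ (Fin n)) → ℝ),
      (∀ T, 0 < b T) →
      (∀ T, betaSingle (surfaceMeasure (d : ℝ) E) (2 * p) (V T).1 (dilate E 2 T) ≤ b T) →
      ∀ (j i : ℤ) (t : ℕ) (Q : Set (EuclideanSpace ℝ (Fin n))), j ∈ generations E →
      IsCube c₀ E j Q → t ≤ k → i = j - k + t → i ∈ generations E →
      (t = 0 ∨ j - k + t - 1 ∉ generations E) →
      ∃ U : Planes d n,
        ∫⁻ y in dilate E 2 Q, ∫⁻ x in dilate E 2 Q,
          ENNReal.ofReal (|dist x y - dist (U.proj x) (U.proj y)| ^ p)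
            ∂(surfaceMeasure (d : ℝ) E) ∂(surfaceMeasure (d : ℝ) E) ≤
        ENNReal.ofReal (K * (((2 : ℝ) ^ (-i)) ^ p * ((2 : ℝ) ^ (-i)) ^ d)) *
          Δ.weightedSum (surfaceMeasure (d : ℝ) E) (fun T => ENNReal.ofReal (b T ^ (2 * p))) Q i := by
  have hs : 1 ≤ 2 * p := by linarith
  obtain ⟨Kc, hKc, hchain⟩ := exists_angleLE_of_chain d hd C c₀ (2 * p) hC hc hc1 hs k hk
  obtain ⟨Kp, hKp, hpow⟩ := exists_add_sum_rpow_le (2 * p) hs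
  set κ₁ : ℝ := C⁻¹ ^ 2 * c₀ / 2 with hκ₁
  have hκ₁0 : 0 < κ₁ := by positivity
  set κ₂ : ℝ := 3 * c₀⁻¹ with hκ₂
  have hκ₂0 : 0 < κ₂ := by positivity
  set M : ℝ := (9 * (κ₁⁻¹ + κ₂)) ^ p with hM
  have hM0 : 0 < M := by positivity
  set mc := momentConst d C c₀ (2 * p) with hmc
  have hmc0 : 0 < mc := momentConst_pos hC hc _
  set κ : ℝ := C * (4 * c₀⁻¹) ^ d with hκ
  have hκ0 : 0 < κ := by positivity
  set κ' : ℝ := C * c₀⁻¹ ^ d with hκ'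
  have hκ'0 : 0 < κ' := by positivity
  set KA : ℝ := Kc ^ (2 * p) * Kp with hKA
  have hKA0 : 0 < KA := by positivity
  set K₁ : ℝ := 2 * (M * mc * κ * κ') + M * KA * κ with hK₁
  have hK₁0 : 0 < K₁ := by positivity
  set K₂ : ℝ := 2 * (C * (6 * c₀⁻¹) ^ d * (C * c₀⁻¹ ^ d)) + 2 with hK₂
  have hK₂0 : 0 < K₂ := by positivity
  refine ⟨K₁ * K₂, by positivity, ?_⟩
  intro n E hE Δ hΔ V b hb hV j i t Q hj hQ htk hi hiG ht
  have hij : i ≤ j := by omega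
  set μ := surfaceMeasure (d : ℝ) E with hμ
  set L : ℝ := 2 ^ (-i) with hL
  have hL0 : 0 < L := by positivity
  obtain ⟨x₀, hx₀⟩ := hQ.nonempty hc
  -- The plane of this single cube T' is used for all pairs in 2Q.
  obtain ⟨T', hT', hx₀T'⟩ := Δ.exists_mem_level hiG (hQ.subset hx₀)
  have hT'Q : T' ∈ Δ.touching Q i := ⟨hT', x₀, hx₀T', subset_dilate hQ.subset hx₀⟩
  refine ⟨V T', ?_⟩
  set B : Set (EuclideanSpace ℝ (Fin n)) → ℝ≥0∞ := fun T => ENNReal.ofReal (b T ^ (2 * p)) with hB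
  let Wp : ℕ → Set (EuclideanSpace ℝ (Fin n)) → ℝ≥0∞ := fun N T =>
    B T' + ∑ l ∈ Finset.range (N + 1), ∑' T'' : Δ.touching Q (i + l),
        if T ⊆ T'' then B T'' else 0
  have hlevel : ∀ N : ℕ, i + N ∈ generations E := fun N => generations_mono hiG (by omega)
  have hmem_le : ∀ (l : ℕ) (T T'' : Set (EuclideanSpace ℝ (Fin n))), T ⊆ T'' →
      T'' ∈ Δ.touching Q (i + l) →
      B T'' ≤ ∑' T'' : Δ.touching Q (i + l), if T ⊆ T'' then B T'' else 0 := by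
    intro l T T'' hTT hT''
    have := ENNReal.le_tsum (f := fun T'' : Δ.touching Q (i + l) =>
      if T ⊆ (T'' : Set _) then B T'' else 0) ⟨T'', hT''⟩
    simpa [hTT] using this
  -- The majorant sums over all pairs (N, T), although each (x, y) needs only one of them; no
  -- measurable selection of T is then required.
  let ι : Type := Σ N : ℕ, Δ.touching Q (i + N)
  have hcount : ∀ N : ℕ, Countable (Δ.touching Q (i + N)) := fun N =>
    ((Δ.countable_level hc (i + N)).mono fun T hT => hT.1).to_subtype
  have hι : Countable ι := inferInstance
  let D : ι → EuclideanSpace ℝ (Fin n) → ℝ≥0∞ := fun e => (dilate E 2 e.2.1).indicator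
    fun x => ENNReal.ofReal (Metric.infDist x (V e.2.1).1 ^ (2 * p))
  let φ : ι → EuclideanSpace ℝ (Fin n) → ℝ≥0∞ := fun e => (e.2.1 : Set _).indicator fun _ => 1
  let ψ : ι → EuclideanSpace ℝ (Fin n) → ℝ≥0∞ := fun e => (dilate E 2 e.2.1).indicator fun _ => 1
  let a : ι → ℝ≥0∞ := fun e => ENNReal.ofReal (M * ((L * 2⁻¹ ^ e.1) ^ p)⁻¹)
  let c : ι → ℝ≥0∞ := fun e => ENNReal.ofReal (M * (L * 2⁻¹ ^ e.1) ^ p * (KA * 2 ^ e.1)) *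
    Wp e.1 e.2.1
  have hcube : ∀ e : ι, IsCube c₀ E (i + e.1) e.2.1 := fun e => Δ.isCube e.2.2.1
  have hdm : ∀ e : ι, MeasurableSet (dilate E 2 (e.2.1 : Set (EuclideanSpace ℝ (Fin n)))) :=
    fun e => measurableSet_dilate hE.isClosed
  have hDm : ∀ e, Measurable (D e) := fun e => by
    refine Measurable.indicator ?_ (hdm e)
    have : Measurable fun x => Metric.infDist x ((V e.2.1).1 : Set (EuclideanSpace ℝ (Fin n))) :=
      (Metric.continuous_infDist_pt _).measurable
    fun_prop
  have hφm : ∀ e, Measurable (φ e) := fun e => measurable_const.indicator (hcube e).measurable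
  have hψm : ∀ e, Measurable (ψ e) := fun e => measurable_const.indicator (hdm e)
  have hpoint : ∀ y ∈ dilate E 2 Q, ∀ x ∈ dilate E 2 Q,
      ENNReal.ofReal (|dist x y - dist ((V T').proj x) ((V T').proj y)| ^ p) ≤
      ∑' e, (a e * (D e x * ψ e y + φ e x * D e y) + c e * (φ e x * ψ e y)) := by
    intro y hy x hx
    rcases eq_or_ne x y with rfl | hxy
    · simp only [dist_self, sub_zero, abs_zero]
      rw [Real.zero_rpow (by linarith), ENNReal.ofReal_zero]
      exact zero_le
    obtain ⟨N, T, hT, hxT, hyT, hlow⟩ := Δ.exists_cube_of_pair hE hd hc hc1 hiG hx.1 hy.1 hxy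
      (fun T hT hxT => Δ.dilate_subset_dilate_of_first hΔ hE hd hc hc1 hk ht hQ (hi ▸ hT)
        ⟨x, hxT, hx⟩ hy)
    choose ch hch hxch using fun l : ℕ => Δ.exists_mem_level (hlevel l) hx.1
    have hchN : ch N = T := Δ.level_eq_of_mem (hch N) hT (hxch N) hxT
    have hang := hchain n E hE Δ hΔ V b hb hV j t Q T' hj hQ ht (hi ▸ hT') hT'Q.2 x ch hx
      (fun l => hi ▸ hch l) hxch N
    rw [hchN] at hang
    have hTc := Δ.isCube hT
    have hup : dist x y ≤ κ₂ * (L * 2⁻¹ ^ N) := by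
      have h1 := dist_le_of_mem_dilate hTc.isBounded (hTc.nonempty hc)
        (subset_dilate hTc.subset hxT) hyT
      have h2 := hTc.diam_le hc
      rw [zpow_neg_add_natCast, ← hL] at h2
      rw [hκ₂]; linarith
    rw [zpow_neg_add_natCast, ← hL] at hlow
    have hbsum : 0 ≤ b T' + ∑ l ∈ Finset.range (N + 1), b (ch l) :=
      add_nonneg (hb _).le (Finset.sum_nonneg fun l _ => (hb _).le)
    have hmain := Planes.abs_dist_sub_rpow_le (by linarith : 0 ≤ p) hκ₁0 hκ₂0 hang
      (by positivity) (show 0 < L * 2⁻¹ ^ N by positivity) hlow.le hup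
    rw [← hM] at hmain
    have hA : ENNReal.ofReal ((Kc * (b T' + ∑ l ∈ Finset.range (N + 1), b (ch l))) ^ (2 * p)) ≤
        ENNReal.ofReal (KA * 2 ^ N) * Wp N T := by
      have h1 := hpow N (b T') (fun l => b (ch l)) (hb _).le (fun l => (hb _).le)
      have h2 : (Kc * (b T' + ∑ l ∈ Finset.range (N + 1), b (ch l))) ^ (2 * p) ≤
          KA * 2 ^ N * (b T' ^ (2 * p) + ∑ l ∈ Finset.range (N + 1), b (ch l) ^ (2 * p)) := by
        rw [Real.mul_rpow hKc.le hbsum, hKA]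
        exact (mul_le_mul_of_nonneg_left h1 (by positivity)).trans (le_of_eq (by ring))
      refine (ENNReal.ofReal_le_ofReal h2).trans ?_
      have hn : ∀ T, 0 ≤ b T ^ (2 * p) := fun T => Real.rpow_nonneg (hb T).le _
      rw [ENNReal.ofReal_mul (by positivity), ENNReal.ofReal_add (hn _)
        (Finset.sum_nonneg fun l _ => hn _), ENNReal.ofReal_sum_of_nonneg fun l _ => hn _]
      refine mul_le_mul' le_rfl (add_le_add le_rfl (Finset.sum_le_sum fun l hl => ?_))
      refine hmem_le l T (ch l) ?_ ⟨hch l, x, hxch l, hx⟩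
      have := Finset.mem_range.1 hl
      exact Δ.subset_of_mem (by omega) (hch l) hT (hxch l) hxT
    let e₀ : ι := ⟨N, ⟨T, hT, x, hxT, hx⟩⟩
    refine le_trans ?_ (ENNReal.le_tsum e₀)
    have hDx : D e₀ x = ENNReal.ofReal (Metric.infDist x (V T).1 ^ (2 * p)) :=
      Set.indicator_of_mem (subset_dilate hTc.subset hxT) _
    have hDy : D e₀ y = ENNReal.ofReal (Metric.infDist y (V T).1 ^ (2 * p)) :=
      Set.indicator_of_mem hyT _
    have hφx : φ e₀ x = 1 := Set.indicator_of_mem hxT _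
    have hψy : ψ e₀ y = 1 := Set.indicator_of_mem hyT _
    rw [hDx, hDy, hφx, hψy]
    simp only [mul_one, one_mul]
    refine (ENNReal.ofReal_le_ofReal hmain).trans ?_
    have hi0 : ∀ z : EuclideanSpace ℝ (Fin n),
        0 ≤ Metric.infDist z ((V T).1 : Set (EuclideanSpace ℝ (Fin n))) ^ (2 * p) :=
      fun z => Real.rpow_nonneg Metric.infDist_nonneg _
    have hLp : 0 ≤ (L * 2⁻¹ ^ N) ^ p := by positivity
    rw [mul_add, ENNReal.ofReal_add
      (mul_nonneg hM0.le (mul_nonneg (inv_nonneg.2 hLp) (add_nonneg (hi0 _) (hi0 _))))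
      (mul_nonneg hM0.le (mul_nonneg hLp (Real.rpow_nonneg (by positivity) _)))]
    refine add_le_add ?_ ?_
    · rw [← mul_assoc, ENNReal.ofReal_mul (by positivity), ENNReal.ofReal_add (hi0 _) (hi0 _)]
    · rw [← mul_assoc, ENNReal.ofReal_mul (by positivity)]
      change _ ≤ ENNReal.ofReal (M * (L * 2⁻¹ ^ N) ^ p * (KA * 2 ^ N)) * Wp N T
      rw [ENNReal.ofReal_mul (p := M * (L * 2⁻¹ ^ N) ^ p) (by positivity), mul_assoc]
      gcongr
  have hterm : ∀ e : ι, a e * ((∫⁻ x, D e x ∂μ) * ∫⁻ x, ψ e x ∂μ) +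
        a e * ((∫⁻ x, φ e x ∂μ) * ∫⁻ x, D e x ∂μ) +
        c e * ((∫⁻ x, φ e x ∂μ) * ∫⁻ x, ψ e x ∂μ) ≤
      ENNReal.ofReal (K₁ * (L ^ p * L ^ d)) * (2⁻¹ ^ e.1 * (μ e.2.1 * Wp e.1 e.2.1)) := by
    rintro ⟨N, T, hTt⟩
    have hT := hTt.1
    have hTc := Δ.isCube hT
    simp only [a, c, D, φ, ψ]
    rw [lintegral_indicator (measurableSet_dilate hE.isClosed),
      lintegral_indicator_const (measurableSet_dilate hE.isClosed),
      lintegral_indicator_const hTc.measurable, one_mul, one_mul]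
    set LN : ℝ := L * 2⁻¹ ^ N with hLN
    have hLN0 : 0 < LN := by positivity
    have hLN' : (2 : ℝ) ^ (-(i + (N : ℤ))) = LN := by rw [zpow_neg_add_natCast]
    set I := ∫⁻ x in dilate E 2 T, ENNReal.ofReal (Metric.infDist x (V T).1 ^ (2 * p)) ∂μ with hI
    have hb0 : 0 ≤ b T ^ (2 * p) := Real.rpow_nonneg (hb T).le _
    have hI1 : I ≤ ENNReal.ofReal (mc * LN ^ d * LN ^ (2 * p)) * B T := by
      refine (hTc.lintegral_infDist_le hE hd hT.1 hc hc1 hs (hV T)).trans (le_of_eq ?_)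
      rw [hLN', hB, ← ENNReal.ofReal_mul (by positivity), Real.mul_rpow (hb T).le hLN0.le]
      congr 1; ring
    have hm2 : μ (dilate E 2 T) ≤ ENNReal.ofReal (κ * LN ^ d) := by
      refine (hTc.measure_dilate_le hE hc).trans (le_of_eq ?_)
      rw [hLN', hκ, mul_pow]; congr 1; ring
    have hmT : μ T ≤ ENNReal.ofReal (κ * LN ^ d) :=
      (measure_mono (subset_dilate hTc.subset)).trans hm2
    have hLd : ENNReal.ofReal (LN ^ d) ≤ ENNReal.ofReal κ' * μ T := by
      have := hTc.ofReal_pow_le hE hT.1 hc hc1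
      rwa [hLN'] at this
    -- T is one of its own ancestors, so the flatness term for T can be absorbed into the chain sum.
    have hBW : B T ≤ Wp N T := by
      refine (hmem_le N T T subset_rfl hTt).trans ?_
      refine le_trans ?_ le_add_self
      exact Finset.single_le_sum (f := fun l : ℕ => ∑' T'' : Δ.touching Q (i + l),
        if T ⊆ (T'' : Set _) then B T'' else 0) (fun _ _ => zero_le)
        (Finset.mem_range.2 (Nat.lt_succ_self N))
    have h2p : LN ^ (2 * p) = LN ^ p * LN ^ p := by
      rw [two_mul, Real.rpow_add hLN0]
    -- The moment over 2T and the mass of 2T supply two factors LN^d; one is traded for μ(T).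
    have hfirst : ENNReal.ofReal (M * (LN ^ p)⁻¹) * (ENNReal.ofReal (κ * LN ^ d) * I) ≤
        ENNReal.ofReal (M * mc * κ * κ' * (LN ^ p * LN ^ d)) * (μ T * Wp N T) := by
      calc _ ≤ ENNReal.ofReal (M * (LN ^ p)⁻¹) * (ENNReal.ofReal (κ * LN ^ d) *
            (ENNReal.ofReal (mc * LN ^ d * LN ^ (2 * p)) * B T)) := by gcongr
        _ = ENNReal.ofReal (M * mc * κ * (LN ^ p * LN ^ d)) * ENNReal.ofReal (LN ^ d) * B T := by
            generalize B T = z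
            rw [← mul_assoc, ← mul_assoc, ← mul_assoc, ← ENNReal.ofReal_mul (by positivity),
              ← ENNReal.ofReal_mul (by positivity), ← ENNReal.ofReal_mul (by positivity), h2p]
            congr 2
            have : LN ^ p ≠ 0 := (Real.rpow_pos_of_pos hLN0 p).ne'
            field_simp
        _ ≤ ENNReal.ofReal (M * mc * κ * (LN ^ p * LN ^ d)) * (ENNReal.ofReal κ' * μ T) *
            Wp N T := by gcongr
        _ = _ := by
            rw [← mul_assoc, ← ENNReal.ofReal_mul (by positivity), mul_assoc _ (μ T)]
            congr 2; ring
    have hthird : ENNReal.ofReal (M * LN ^ p * (KA * 2 ^ N)) * Wp N T *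
        (μ T * ENNReal.ofReal (κ * LN ^ d)) =
        ENNReal.ofReal (M * KA * κ * (2 ^ N * (LN ^ p * LN ^ d))) * (μ T * Wp N T) := by
      rw [show ∀ u v w z : ℝ≥0∞, u * v * (w * z) = u * z * (w * v) by intros; ring,
        ← ENNReal.ofReal_mul (by positivity)]
      congr 2; ring
    have hpow2 : (1 : ℝ) ≤ 2 ^ N := one_le_pow₀ one_le_two
    have hX : 0 ≤ LN ^ p * LN ^ d := by positivity
    calc _ ≤ ENNReal.ofReal (M * (LN ^ p)⁻¹) * (ENNReal.ofReal (κ * LN ^ d) * I) +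
          ENNReal.ofReal (M * (LN ^ p)⁻¹) * (ENNReal.ofReal (κ * LN ^ d) * I) +
          ENNReal.ofReal (M * LN ^ p * (KA * 2 ^ N)) * Wp N T *
            (μ T * ENNReal.ofReal (κ * LN ^ d)) := by
          rw [mul_comm I]
          gcongr
      _ ≤ ENNReal.ofReal (M * mc * κ * κ' * (LN ^ p * LN ^ d)) * (μ T * Wp N T) +
          ENNReal.ofReal (M * mc * κ * κ' * (LN ^ p * LN ^ d)) * (μ T * Wp N T) +
          ENNReal.ofReal (M * KA * κ * (2 ^ N * (LN ^ p * LN ^ d))) * (μ T * Wp N T) := by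
          rw [hthird]
          gcongr
      _ = ENNReal.ofReal (M * mc * κ * κ' * (LN ^ p * LN ^ d) +
            M * mc * κ * κ' * (LN ^ p * LN ^ d) +
            M * KA * κ * (2 ^ N * (LN ^ p * LN ^ d))) * (μ T * Wp N T) := by
          rw [ENNReal.ofReal_add (by positivity) (by positivity),
            ENNReal.ofReal_add (by positivity) (by positivity)]
          ring
      _ ≤ ENNReal.ofReal (K₁ * (L ^ p * L ^ d) * 2⁻¹ ^ N) * (μ T * Wp N T) := by
          gcongr
          have h1 := scale_le hd hp hL0 N
          rw [← hLN] at h1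
          calc _ ≤ M * mc * κ * κ' * (2 ^ N * (LN ^ p * LN ^ d)) +
                M * mc * κ * κ' * (2 ^ N * (LN ^ p * LN ^ d)) +
                M * KA * κ * (2 ^ N * (LN ^ p * LN ^ d)) := by
                have : LN ^ p * LN ^ d ≤ 2 ^ N * (LN ^ p * LN ^ d) :=
                  le_mul_of_one_le_left hX hpow2
                gcongr
            _ = K₁ * (2 ^ N * (LN ^ p * LN ^ d)) := by rw [hK₁]; ring
            _ ≤ K₁ * (L ^ p * L ^ d * 2⁻¹ ^ N) := by gcongr
            _ = _ := by ring
      _ = _ := by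
          rw [ENNReal.ofReal_mul (by positivity), mul_assoc, ENNReal.ofReal_pow (by positivity),
            ENNReal.ofReal_inv_of_pos two_pos, ENNReal.ofReal_ofNat]
  calc _ ≤ ∫⁻ y in dilate E 2 Q, ∫⁻ x in dilate E 2 Q,
          ∑' e, (a e * (D e x * ψ e y + φ e x * D e y) + c e * (φ e x * ψ e y)) ∂μ ∂μ := by
        refine setLIntegral_mono' (measurableSet_dilate hE.isClosed) fun y hy => ?_
        exact setLIntegral_mono' (measurableSet_dilate hE.isClosed) fun x hx => hpoint y hy x hx
    _ ≤ ∫⁻ y, ∫⁻ x,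
          ∑' e, (a e * (D e x * ψ e y + φ e x * D e y) + c e * (φ e x * ψ e y)) ∂μ ∂μ := by
        refine (setLIntegral_le_lintegral _ _).trans (lintegral_mono fun y => ?_)
        exact setLIntegral_le_lintegral _ _
    _ ≤ ∑' e : ι, ENNReal.ofReal (K₁ * (L ^ p * L ^ d)) *
          (2⁻¹ ^ e.1 * (μ e.2.1 * Wp e.1 e.2.1)) := by
        rw [lintegral_lintegral_tsum_product μ hDm hφm hψm]
        exact ENNReal.tsum_le_tsum hterm
    _ = ENNReal.ofReal (K₁ * (L ^ p * L ^ d)) * ∑' N : ℕ, 2⁻¹ ^ N *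
          ∑' T : Δ.touching Q (i + N), μ T * Wp N T := by
        rw [ENNReal.tsum_mul_left]
        congr 1
        refine (ENNReal.tsum_sigma fun (N : ℕ) (T : Δ.touching Q (i + N)) =>
          2⁻¹ ^ N * (μ T * Wp N T)).trans ?_
        simp_rw [ENNReal.tsum_mul_left]
    _ ≤ ENNReal.ofReal (K₁ * (L ^ p * L ^ d)) * (ENNReal.ofReal K₂ * Δ.weightedSum μ B Q i) := by
        gcongr
        exact Δ.tsum_chain_le hE hc hc1 B hQ hij hT'Q
    _ = _ := by
        rw [← mul_assoc, ← ENNReal.ofReal_mul (by positivity)]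
        congr 2; ring

/-- No integrability is needed, since the Bochner integral of a non-integrable function is 0. This
bounds ι without a measurability discussion. -/
lemma ofReal_integral_le_lintegral {X : Type*} [MeasurableSpace X] {μ : Measure X} {f : X → ℝ}
    (hf : ∀ x, 0 ≤ f x) : ENNReal.ofReal (∫ x, f x ∂μ) ≤ ∫⁻ x, ENNReal.ofReal (f x) ∂μ := by
  by_cases h : Integrable f μ
  · rw [ofReal_integral_eq_lintegral_ofReal h (Filter.Eventually.of_forall hf)]
  · rw [integral_undef h, ENNReal.ofReal_zero]; exact zero_le

/-- Jensen for the measure with mass w i at i, on the discrete σ-algebra where every function is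
measurable. -/
lemma tsum_mul_rpow_le {ι : Type*} (w B : ι → ℝ≥0∞) {r : ℝ} (hr : 1 ≤ r) :
    (∑' i, w i * B i) ^ r ≤ (∑' i, w i) ^ (r - 1) * ∑' i, w i * B i ^ r := by
  let _ : MeasurableSpace ι := ⊤
  let ν : Measure ι := Measure.sum fun i => w i • Measure.dirac i
  have hν : ∀ f : ι → ℝ≥0∞, ∫⁻ i, f i ∂ν = ∑' i, w i * f i := by
    intro f
    rw [lintegral_sum_measure]
    refine tsum_congr fun i => ?_
    rw [lintegral_smul_measure, lintegral_dirac, smul_eq_mul]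
  have hr0 : 0 < r := by linarith
  have h := eLpNorm'_le_eLpNorm'_mul_rpow_measure_univ (μ := ν) one_pos hr (f := B)
    (Measurable.aestronglyMeasurable (fun _ _ => trivial))
  simp only [eLpNorm', enorm_eq_self, ENNReal.rpow_one, one_div, inv_one, hν] at h
  have hu : ν Set.univ = ∑' i, w i := by
    rw [← lintegral_one, hν]; simp
  have h2 := ENNReal.rpow_le_rpow h hr0.le
  rw [ENNReal.mul_rpow_of_nonneg _ _ hr0.le, ← ENNReal.rpow_mul, ← ENNReal.rpow_mul,
    inv_mul_cancel₀ hr0.ne', ENNReal.rpow_one, hu, sub_mul, one_mul, inv_mul_cancel₀ hr0.ne',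
    mul_comm] at h2
  exact h2

/-! ### From flatness to the coefficient ι of one cube -/

section Iota

variable {n d : ℕ} {C c₀ : ℝ} {E : Set (EuclideanSpace ℝ (Fin n))}

lemma iotaSingle_nonneg {X : Type*} [MetricSpace X] [MeasurableSpace X] {μ : Measure X} {p : ℝ}
    {π : X → X} {S : Set X} : 0 ≤ iotaSingle μ p π S := by
  apply Real.rpow_nonneg
  refine mul_nonneg (by positivity) (integral_nonneg fun y => integral_nonneg fun x => ?_)
  exact Real.rpow_nonneg (div_nonneg (abs_nonneg _) Metric.diam_nonneg) _

lemma iota_nonneg {p : ℝ} {S : Set (EuclideanSpace ℝ (Fin n))} : 0 ≤ iota d E p S :=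
  Real.iInf_nonneg fun _ => iotaSingle_nonneg

lemma ofReal_iota_rpow_le {p : ℝ} (hp : 0 < p) (S : Set (EuclideanSpace ℝ (Fin n)))
    (U : Planes d n) :
    ENNReal.ofReal (iota d E p S ^ p) ≤
      ENNReal.ofReal (1 / (surfaceMeasure (d : ℝ) E).real S ^ 2 * (Metric.diam S ^ p)⁻¹) *
      ∫⁻ y in S, ∫⁻ x in S,
          ENNReal.ofReal (|dist x y - dist (U.proj x) (U.proj y)| ^ p)
            ∂(surfaceMeasure (d : ℝ) E) ∂(surfaceMeasure (d : ℝ) E) := by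
  set μ := surfaceMeasure (d : ℝ) E with hμ
  set m := μ.real S with hm
  set D := Metric.diam S with hD
  have hD0 : 0 ≤ D := Metric.diam_nonneg
  have hle : iota d E p S ≤ iotaSingle μ p U.proj S :=
    ciInf_le ⟨0, by rintro _ ⟨V, rfl⟩; exact iotaSingle_nonneg⟩ U
  have hg0 : ∀ x y, 0 ≤ (|dist x y - dist (U.proj x) (U.proj y)| / D) ^ p := fun x y =>
    Real.rpow_nonneg (div_nonneg (abs_nonneg _) hD0) _
  have h1 : iota d E p S ^ p ≤ 1 / m ^ 2 *
      ∫ y in S, ∫ x in S, (|dist x y - dist (U.proj x) (U.proj y)| / D) ^ p ∂μ ∂μ := by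
    refine (Real.rpow_le_rpow iota_nonneg hle hp.le).trans (le_of_eq ?_)
    rw [iotaSingle, ← Real.rpow_mul, one_div_mul_cancel hp.ne', Real.rpow_one]
    exact mul_nonneg (by positivity) (integral_nonneg fun y => integral_nonneg fun x => hg0 x y)
  refine (ENNReal.ofReal_le_ofReal h1).trans ?_
  rw [ENNReal.ofReal_mul (by positivity), ENNReal.ofReal_mul (by positivity), mul_assoc]
  gcongr
  refine (ofReal_integral_le_lintegral fun y => integral_nonneg fun x => hg0 x y).trans ?_
  rw [← lintegral_const_mul' _ _ ENNReal.ofReal_ne_top]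
  refine lintegral_mono fun y => ?_
  refine (ofReal_integral_le_lintegral fun x => hg0 x y).trans ?_
  rw [← lintegral_const_mul' _ _ ENNReal.ofReal_ne_top]
  refine lintegral_mono fun x => le_of_eq ?_
  rw [← ENNReal.ofReal_mul (by positivity), Real.div_rpow (abs_nonneg _) hD0, div_eq_inv_mul]

namespace DyadicSystem

lemma weightedSum_mono_left {X : Type*} [MetricSpace X] [MeasurableSpace X] [BorelSpace X]
    {E : Set X} (Δ : DyadicSystem c₀ E) (μ : Measure X) {B B' : Set X → ℝ≥0∞}
    (h : ∀ T, B T ≤ B' T) (Q : Set X) (i : ℤ) :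
    Δ.weightedSum μ B Q i ≤ Δ.weightedSum μ B' Q i := by
  unfold weightedSum
  gcongr
  exact h _

lemma weightedSum_add_mul {X : Type*} [MetricSpace X] [MeasurableSpace X] [BorelSpace X]
    {E : Set X} (Δ : DyadicSystem c₀ E) (μ : Measure X) (B : Set X → ℝ≥0∞) (a b : ℝ≥0∞) (Q : Set X) (i : ℤ) :
    Δ.weightedSum μ (fun T => a * B T + b) Q i =
      a * Δ.weightedSum μ B Q i + b * Δ.weightedSum μ (fun _ => 1) Q i := by
  have h : ∀ N : ℕ, ∑' T : Δ.touching Q (i + N), (a * B T + b) * μ T =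
      a * (∑' T : Δ.touching Q (i + N), B T * μ T) +
        b * ∑' T : Δ.touching Q (i + N), 1 * μ T := by
    intro N
    simp_rw [add_mul, one_mul, mul_assoc]
    rw [ENNReal.tsum_add, ENNReal.tsum_mul_left, ENNReal.tsum_mul_left]
  unfold weightedSum
  simp_rw [h, mul_add]
  rw [ENNReal.tsum_add, ← ENNReal.tsum_mul_left, ← ENNReal.tsum_mul_left]
  congr 1
  · exact tsum_congr fun N => mul_left_comm _ _ _
  · exact tsum_congr fun N => mul_left_comm _ _ _

lemma weightedSum_rpow_le {X : Type*} [MetricSpace X] [MeasurableSpace X] [BorelSpace X]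
    {E : Set X} (Δ : DyadicSystem c₀ E) (μ : Measure X) (B : Set X → ℝ≥0∞) {r : ℝ} (hr : 1 ≤ r) (Q : Set X)
    (i : ℤ) :
    Δ.weightedSum μ B Q i ^ r ≤ Δ.weightedSum μ (fun _ => 1) Q i ^ (r - 1) *
      Δ.weightedSum μ (fun T => B T ^ r) Q i := by
  have key : ∀ B : Set X → ℝ≥0∞, Δ.weightedSum μ B Q i =
      ∑' e : Σ N : ℕ, Δ.touching Q (i + N), 2⁻¹ ^ e.1 * μ e.2 * B e.2 := by
    intro B
    rw [ENNReal.tsum_sigma (fun (N : ℕ) (T : Δ.touching Q (i + N)) => 2⁻¹ ^ N * μ T * B T)]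
    unfold weightedSum
    refine tsum_congr fun N => ?_
    rw [← ENNReal.tsum_mul_left]
    refine tsum_congr fun T => ?_
    ring
  rw [key, key, key]
  simp only [mul_one]
  exact tsum_mul_rpow_le _ _ hr

/-- Cubes of one generation touching 2Q are disjoint and lie in one ball of radius comparable to
2^{-i}. -/
lemma weightedSum_one_le {X : Type*} [MetricSpace X] [MeasurableSpace X] [BorelSpace X]
    [SecondCountableTopology X] {E : Set X} (hE : IsRegular (d : ℝ) C E) (Δ : DyadicSystem c₀ E)
    (hc : 0 < c₀) {Q : Set X} {i j : ℤ} (hQ : IsCube c₀ E j Q) (hij : i ≤ j) :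
    Δ.weightedSum (surfaceMeasure d E) (fun _ => 1) Q i ≤
      ENNReal.ofReal (2 * (C * (6 * c₀⁻¹ * (2 : ℝ) ^ (-i)) ^ d)) := by
  obtain ⟨x, hx⟩ := hQ.nonempty hc
  have hx2 := subset_dilate hQ.subset hx
  have hmass : ∀ N : ℕ, ∑' T : Δ.touching Q (i + N), surfaceMeasure (d : ℝ) E T ≤
      ENNReal.ofReal (C * (6 * c₀⁻¹ * (2 : ℝ) ^ (-i)) ^ d) := by
    intro N
    have h1 := Δ.tsum_measure_le hc (𝒯 := Δ.touching Q (i + N)) (fun T hT => hT.1)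
      (fun T hT => Δ.subset_ball_of_touching hc (L := 2 ^ (-i)) hQ
        (zpow_le_zpow_right₀ one_le_two (by omega)) (zpow_le_zpow_right₀ one_le_two (by omega))
        hT hx2) (surfaceMeasure (d : ℝ) E)
    exact h1.trans (hE.measure_ball_le hx2.1 (by positivity))
  unfold weightedSum
  simp_rw [one_mul]
  calc _ ≤ ∑' N : ℕ, (2⁻¹ : ℝ≥0∞) ^ N * ENNReal.ofReal (C * (6 * c₀⁻¹ * (2 : ℝ) ^ (-i)) ^ d) := by
        gcongr with N
        exact hmass N
    _ = _ := by
        rw [ENNReal.tsum_mul_right, ENNReal.tsum_geometric, ENNReal.one_sub_inv_two, inv_inv,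
          ENNReal.ofReal_mul zero_le_two, ENNReal.ofReal_ofNat]

end DyadicSystem

lemma add_rpow_le_two_rpow_mul {a b s : ℝ} (ha : 0 ≤ a) (hb : 0 ≤ b) (hs : 0 ≤ s) :
    (a + b) ^ s ≤ 3 ^ s * (a ^ s + b ^ s) := by
  rcases eq_or_lt_of_le hs with rfl | hs
  · simp
  · have := add_three_rpow_le ha hb le_rfl hs.le
    rwa [Real.zero_rpow hs.ne', add_zero, add_zero] at this

/-- Normalising the double integral divides by μ(2Q)² diam(2Q)^p, about L^{2d+p}, against the factor
L^{p+d} of the estimate; L^{-d} remains. -/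
lemma exists_ofReal_iota_rpow_le_weightedSum (d : ℕ) (hd : 1 ≤ d) (C c₀ p : ℝ) (hC : 1 ≤ C)
    (hc : 0 < c₀) (hc1 : c₀ ≤ 1) (hp : 1 ≤ p) (k : ℕ) (hk : 3 * c₀⁻¹ ≤ C⁻¹ ^ 2 * c₀ * 2 ^ k) :
    ∃ K : ℝ, 0 < K ∧ ∀ (n : ℕ) (E : Set (EuclideanSpace ℝ (Fin n))), Nonempty (Planes d n) →
      IsRegular (d : ℝ) C E → ∀ Δ : DyadicSystem c₀ E, Δ.HasTop →
      ∀ (j i : ℤ) (t : ℕ) (Q : Set (EuclideanSpace ℝ (Fin n))), j ∈ generations E →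
      IsCube c₀ E j Q → t ≤ k → i = j - k + t → i ∈ generations E →
      (t = 0 ∨ j - k + t - 1 ∉ generations E) →
      ENNReal.ofReal (iota d E p (dilate E 2 Q) ^ p) ≤
        ENNReal.ofReal (K * (((2 : ℝ) ^ (-j)) ^ d)⁻¹) *
          Δ.weightedSum (surfaceMeasure (d : ℝ) E)
            (fun T => ENNReal.ofReal (beta d E (2 * p) (dilate E 2 T) ^ (2 * p))) Q i := by
  have hp0 : 0 < p := by linarith
  obtain ⟨K, hK, hmain⟩ := exists_lintegral_abs_dist_sub_le d hd C c₀ p hC hc hc1 hp k hk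
  set κm : ℝ := C⁻¹ * c₀ ^ d with hκm
  have hκm0 : 0 < κm := by positivity
  set κ₁ : ℝ := C⁻¹ ^ 2 * c₀ with hκ₁
  have hκ₁0 : 0 < κ₁ := by positivity
  set K₁ : ℝ := (κm ^ 2)⁻¹ * (κ₁ ^ p)⁻¹ * K * ((2 ^ k) ^ p * (2 ^ k) ^ d) with hK₁
  have hK₁0 : 0 < K₁ := by positivity
  refine ⟨K₁ * 3 ^ (2 * p), by positivity, ?_⟩
  intro n E hPl hE Δ hΔ j i t Q hj hQ htk hi hiG ht
  have hij : i ≤ j := by omega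
  set μ := surfaceMeasure (d : ℝ) E with hμ
  set S := dilate E 2 Q with hS
  set L : ℝ := 2 ^ (-j) with hL
  have hL0 : 0 < L := by positivity
  have hLi : (2 : ℝ) ^ (-i) ≤ 2 ^ k * L := by
    rw [hL, ← zpow_natCast, ← zpow_add₀ two_ne_zero]
    exact zpow_le_zpow_right₀ one_le_two (by omega)
  have hLi0 : (0 : ℝ) < 2 ^ (-i) := by positivity
  set Bt : Set (EuclideanSpace ℝ (Fin n)) → ℝ := fun T => beta d E (2 * p) (dilate E 2 T) with hBt
  have hBt0 : ∀ T, 0 ≤ Bt T := fun T => beta_nonneg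
  have hm : κm * L ^ d ≤ μ.real S := by
    have h1 := (hQ.le_measure hE hj hc hc1).trans (measure_mono (subset_dilate hQ.subset))
    have h2 := ENNReal.toReal_mono (hQ.measure_dilate_ne_top hE hc) h1
    rw [ENNReal.toReal_ofReal (by positivity)] at h2
    refine le_trans (le_of_eq ?_) h2
    rw [hκm, mul_pow]; ring
  have hdiam : κ₁ * L ≤ Metric.diam S := hQ.le_diam_dilate hE hd hj hc hc1
  -- The plane U depends on δ, but the constant does not, so δ → 0 is permitted.
  have hfixed : ∀ δ : ℝ, 0 < δ → ENNReal.ofReal (iota d E p S ^ p) ≤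
      ENNReal.ofReal (K₁ * (L ^ d)⁻¹) *
        Δ.weightedSum μ (fun T => ENNReal.ofReal ((Bt T + δ) ^ (2 * p))) Q i := by
    intro δ hδ
    choose V hV using fun T => exists_betaSingle_le (d := d) E (2 * p) hδ (dilate E 2 T)
    obtain ⟨U, hU⟩ := hmain n E hE Δ hΔ V (fun T => Bt T + δ)
      (fun T => add_pos_of_nonneg_of_pos (hBt0 T) hδ) hV j i t Q hj hQ htk hi hiG ht
    refine (ofReal_iota_rpow_le hp0 S U).trans ((mul_le_mul_right hU _).trans ?_)
    rw [← mul_assoc, ← ENNReal.ofReal_mul (by positivity)]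
    refine mul_le_mul' (ENNReal.ofReal_le_ofReal ?_) le_rfl
    calc 1 / μ.real S ^ 2 * (Metric.diam S ^ p)⁻¹ *
          (K * (((2 : ℝ) ^ (-i)) ^ p * ((2 : ℝ) ^ (-i)) ^ d))
        ≤ 1 / (κm * L ^ d) ^ 2 * ((κ₁ * L) ^ p)⁻¹ *
          (K * ((2 ^ k * L) ^ p * (2 ^ k * L) ^ d)) := by gcongr
      _ = _ := by
          have hLp : L ^ p ≠ 0 := (Real.rpow_pos_of_pos hL0 p).ne'
          have hkp : κ₁ ^ p ≠ 0 := (Real.rpow_pos_of_pos hκ₁0 p).ne'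
          rw [hK₁, Real.mul_rpow hκ₁0.le hL0.le, Real.mul_rpow (by positivity) hL0.le]
          field_simp
          rw [mul_pow]
          ring
  set Y := Δ.weightedSum μ (fun T => ENNReal.ofReal (Bt T ^ (2 * p))) Q i with hY
  set Z := Δ.weightedSum μ (fun _ => 1) Q i with hZ
  -- Finiteness of the total weight makes the error term δ^{2p} Z vanish in the limit.
  have hZfin : Z ≠ ⊤ :=
    ne_top_of_le_ne_top ENNReal.ofReal_ne_top (Δ.weightedSum_one_le hE hc hQ hij)
  set a : ℝ≥0∞ := ENNReal.ofReal (K₁ * (L ^ d)⁻¹) with ha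
  have hδ : ∀ δ : ℝ, 0 < δ → ENNReal.ofReal (iota d E p S ^ p) ≤
      a * (ENNReal.ofReal (3 ^ (2 * p)) * Y + ENNReal.ofReal (3 ^ (2 * p) * δ ^ (2 * p)) * Z) := by
    intro δ hδ
    refine (hfixed δ hδ).trans ?_
    rw [hY, hZ, ← Δ.weightedSum_add_mul]
    gcongr
    refine Δ.weightedSum_mono_left _ (fun T => ?_) _ _
    rw [← ENNReal.ofReal_mul (by positivity), ← ENNReal.ofReal_add
      (mul_nonneg (by positivity) (Real.rpow_nonneg (hBt0 T) _)) (by positivity), ← mul_add]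
    exact ENNReal.ofReal_le_ofReal (add_rpow_le_two_rpow_mul (hBt0 T) hδ.le (by linarith))
  have hlim : Filter.Tendsto (fun δ : ℝ => a * (ENNReal.ofReal (3 ^ (2 * p)) * Y +
      ENNReal.ofReal (3 ^ (2 * p) * δ ^ (2 * p)) * Z)) (nhdsWithin 0 (Set.Ioi 0))
      (nhds (a * (ENNReal.ofReal (3 ^ (2 * p)) * Y + 0 * Z))) := by
    refine ENNReal.Tendsto.const_mul ?_ (Or.inr ENNReal.ofReal_ne_top)
    refine Filter.Tendsto.const_add _ (ENNReal.Tendsto.mul_const ?_ (Or.inr hZfin))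
    rw [← ENNReal.ofReal_zero]
    refine ENNReal.tendsto_ofReal (Filter.Tendsto.mono_left ?_ nhdsWithin_le_nhds)
    have hcont : Continuous fun δ : ℝ => (3 : ℝ) ^ (2 * p) * δ ^ (2 * p) :=
      continuous_const.mul (Real.continuous_rpow_const (by linarith))
    have := hcont.tendsto 0
    rwa [Real.zero_rpow (by linarith), mul_zero] at this
  have hfin := ge_of_tendsto hlim (eventually_mem_nhdsWithin.mono fun δ hδ' => hδ δ hδ')
  rw [zero_mul, add_zero, ← mul_assoc, ha, ← ENNReal.ofReal_mul (by positivity)] at hfin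
  refine hfin.trans (le_of_eq ?_)
  congr 2; ring

/-- Jensen with r = q/p applied to the preceding bound. -/
lemma exists_ofReal_iota_rpow_mul_measure_le (d : ℕ) (hd : 1 ≤ d) (C c₀ p q : ℝ) (hC : 1 ≤ C)
    (hc : 0 < c₀) (hc1 : c₀ ≤ 1) (hp : 1 ≤ p) (hpq : p ≤ q) (k : ℕ)
    (hk : 3 * c₀⁻¹ ≤ C⁻¹ ^ 2 * c₀ * 2 ^ k) :
    ∃ K : ℝ, 0 < K ∧ ∀ (n : ℕ) (E : Set (EuclideanSpace ℝ (Fin n))), Nonempty (Planes d n) →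
      IsRegular (d : ℝ) C E → ∀ Δ : DyadicSystem c₀ E, Δ.HasTop →
      ∀ (j i : ℤ) (t : ℕ) (Q : Set (EuclideanSpace ℝ (Fin n))), j ∈ generations E →
      IsCube c₀ E j Q → t ≤ k → i = j - k + t → i ∈ generations E →
      (t = 0 ∨ j - k + t - 1 ∉ generations E) →
      ENNReal.ofReal (iota d E p (dilate E 2 Q) ^ q) * surfaceMeasure (d : ℝ) E Q ≤
        ENNReal.ofReal K *
          Δ.weightedSum (surfaceMeasure (d : ℝ) E)
            (fun T => ENNReal.ofReal (beta d E (2 * p) (dilate E 2 T) ^ (2 * q))) Q i := by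
  have hp0 : 0 < p := by linarith
  obtain ⟨K, hK, hmain⟩ := exists_ofReal_iota_rpow_le_weightedSum d hd C c₀ p hC hc hc1 hp k hk
  set r : ℝ := q / p with hr
  have hr1 : 1 ≤ r := by rw [hr, le_div_iff₀ hp0]; linarith
  have hpr : p * r = q := by rw [hr]; field_simp
  set κ₁ : ℝ := 2 * (C * (6 * c₀⁻¹ * 2 ^ k) ^ d) with hκ₁
  have hκ₁0 : 0 < κ₁ := by positivity
  set κ₂ : ℝ := C * (4 * c₀⁻¹) ^ d with hκ₂
  have hκ₂0 : 0 < κ₂ := by positivity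
  refine ⟨K ^ r * κ₁ ^ (r - 1) * κ₂, by positivity, ?_⟩
  intro n E hPl hE Δ hΔ j i t Q hj hQ htk hi hiG ht
  have hij : i ≤ j := by omega
  set μ := surfaceMeasure (d : ℝ) E with hμ
  set L : ℝ := 2 ^ (-j) with hL
  have hL0 : 0 < L := by positivity
  have hLi : (2 : ℝ) ^ (-i) ≤ 2 ^ k * L := by
    rw [hL, ← zpow_natCast, ← zpow_add₀ two_ne_zero]
    exact zpow_le_zpow_right₀ one_le_two (by omega)
  set S := dilate E 2 Q with hS
  have hι0 : 0 ≤ iota d E p S := iota_nonneg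
  have h1 := hmain n E hPl hE Δ hΔ j i t Q hj hQ htk hi hiG ht
  have h2 : ENNReal.ofReal (iota d E p S ^ q) = ENNReal.ofReal (iota d E p S ^ p) ^ r := by
    rw [ENNReal.ofReal_rpow_of_nonneg (Real.rpow_nonneg hι0 _) (by linarith), ← Real.rpow_mul hι0,
      hpr]
  have h3 : (fun T => ENNReal.ofReal (beta d E (2 * p) (dilate E 2 T) ^ (2 * p)) ^ r) =
      fun T => ENNReal.ofReal (beta d E (2 * p) (dilate E 2 T) ^ (2 * q)) := by
    funext T
    rw [ENNReal.ofReal_rpow_of_nonneg (Real.rpow_nonneg beta_nonneg _) (by linarith),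
      ← Real.rpow_mul beta_nonneg, mul_assoc, hpr]
  have h4 := Δ.weightedSum_rpow_le μ
    (fun T => ENNReal.ofReal (beta d E (2 * p) (dilate E 2 T) ^ (2 * p))) hr1 Q i
  rw [h3] at h4
  set W := Δ.weightedSum μ
    (fun T => ENNReal.ofReal (beta d E (2 * p) (dilate E 2 T) ^ (2 * q))) Q i with hW
  have h5 : Δ.weightedSum μ (fun _ => 1) Q i ≤ ENNReal.ofReal (κ₁ * L ^ d) := by
    refine (Δ.weightedSum_one_le hE hc hQ hij).trans (ENNReal.ofReal_le_ofReal ?_)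
    calc 2 * (C * (6 * c₀⁻¹ * (2 : ℝ) ^ (-i)) ^ d) ≤ 2 * (C * (6 * c₀⁻¹ * (2 ^ k * L)) ^ d) := by
          gcongr
      _ = _ := by rw [hκ₁, ← mul_assoc (6 * c₀⁻¹), mul_pow _ L]; ring
  have h6 : μ Q ≤ ENNReal.ofReal (κ₂ * L ^ d) := by
    refine (hQ.measure_le hE hc).trans (le_of_eq ?_)
    rw [hκ₂, mul_pow]; congr 1; rw [mul_assoc]
  rw [h2]
  calc ENNReal.ofReal (iota d E p S ^ p) ^ r * μ Q
      ≤ (ENNReal.ofReal (K * (L ^ d)⁻¹) * _) ^ r * ENNReal.ofReal (κ₂ * L ^ d) := by gcongr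
    _ ≤ ENNReal.ofReal (K * (L ^ d)⁻¹) ^ r * (ENNReal.ofReal (κ₁ * L ^ d) ^ (r - 1) * W) *
          ENNReal.ofReal (κ₂ * L ^ d) := by
        rw [ENNReal.mul_rpow_of_nonneg _ _ (by linarith)]
        gcongr
        refine h4.trans ?_
        gcongr
    _ = ENNReal.ofReal ((K * (L ^ d)⁻¹) ^ r * (κ₁ * L ^ d) ^ (r - 1) * (κ₂ * L ^ d)) * W := by
        rw [ENNReal.ofReal_rpow_of_nonneg (by positivity) (by linarith),
          ENNReal.ofReal_rpow_of_nonneg (by positivity) (by linarith),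
          show ∀ u v w z : ℝ≥0∞, u * (v * w) * z = u * v * z * w by intros; ring,
          ← ENNReal.ofReal_mul (by positivity), ← ENNReal.ofReal_mul (by positivity)]
    _ = _ := by
        congr 2
        -- The powers of L^d are -r, r - 1 and 1, so the constant is independent of scale.
        have hX : 0 < L ^ d := by positivity
        rw [Real.mul_rpow hK.le (by positivity), Real.mul_rpow hκ₁0.le hX.le,
          Real.inv_rpow hX.le, Real.rpow_sub_one hX.ne']
        have : (L ^ d) ^ r ≠ 0 := (Real.rpow_pos_of_pos hX r).ne'
        field_simp

end Iota

/-! ### Summation over cubes and the packing condition -/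

section Packing

set_option linter.unusedSectionVars false

variable {X : Type*} [MetricSpace X] [MeasurableSpace X] [BorelSpace X] {d : ℕ} {C c₀ : ℝ}
  {E : Set X}

namespace DyadicSystem

/-- Lets every cube start its sum formally k generations up, inadmissible generations being empty.
-/
lemma weightedSum_shift_le (Δ : DyadicSystem c₀ E) (μ : Measure X) (B : Set X → ℝ≥0∞) (Q : Set X)
    (i : ℤ) (t : ℕ) :
    Δ.weightedSum μ B Q (i + t) ≤ 2 ^ t * Δ.weightedSum μ B Q i := by
  unfold weightedSum
  rw [← ENNReal.tsum_mul_left]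
  refine le_trans (ENNReal.tsum_le_tsum fun N => le_of_eq ?_)
    (ENNReal.tsum_comp_le_tsum_of_injective (add_left_injective t) _)
  have h1 : (2 : ℝ≥0∞) ^ t * 2⁻¹ ^ t = 1 := by
    rw [← mul_pow, ENNReal.mul_inv_cancel two_ne_zero ENNReal.ofNat_ne_top, one_pow]
  have h2 : i + (t : ℤ) + (N : ℤ) = i + ((N + t : ℕ) : ℤ) := by push_cast; ring
  rw [h2, pow_add, show ∀ u v w z : ℝ≥0∞, u * (v * w * z) = u * w * (v * z) by intros; ring, h1,
    one_mul]

open Classical in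
/-- A set is a cube of boundedly many generations only. -/
lemma tsum_mem_level_le (hE : IsRegular (d : ℝ) C E) (hd : 1 ≤ d) (Δ : DyadicSystem c₀ E)
    (hc : 0 < c₀) (hc1 : c₀ ≤ 1) {m : ℕ} (hm : c₀⁻¹ < C⁻¹ ^ 2 * c₀ * 2 ^ m) (i : ℤ) (T : Set X) :
    ∑' s : ℕ, (if T ∈ Δ.level (i + s) then (1 : ℝ≥0∞) else 0) ≤ m := by
  by_cases hex : ∃ s : ℕ, T ∈ Δ.level (i + s)
  · have hmin := Nat.find_spec hex
    set s₀ := Nat.find hex with hs₀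
    -- Generation i + s₀ bounds diam T from below and generation i + s bounds it from above; by the
    -- choice of m these conflict when s ≥ s₀ + m.
    have hsupp : ∀ s : ℕ, s ∉ Finset.Ico s₀ (s₀ + m) →
        (if T ∈ Δ.level (i + s) then (1 : ℝ≥0∞) else 0) = 0 := by
      intro s hs
      rw [if_neg]
      intro hT
      apply hs
      rw [Finset.mem_Ico]
      refine ⟨Nat.find_min' hex hT, ?_⟩
      by_contra hcon
      push Not at hcon
      have h1 := (Δ.isCube hmin).le_diam hE hd hmin.1 hc hc1
      have h2 := (Δ.isCube hT).diam_le hc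
      have h3 : (2 : ℝ) ^ (-(i + (s : ℤ))) * 2 ^ m ≤ 2 ^ (-(i + (s₀ : ℤ))) := by
        rw [← zpow_natCast, ← zpow_add₀ two_ne_zero]
        exact zpow_le_zpow_right₀ one_le_two (by omega)
      have h4 : (0 : ℝ) < 2 ^ (-(i + (s : ℤ))) := by positivity
      have hC := hE.one_le
      have h5 : C⁻¹ ^ 2 * c₀ * ((2 : ℝ) ^ (-(i + (s : ℤ))) * 2 ^ m) ≤
          c₀⁻¹ * (2 : ℝ) ^ (-(i + (s : ℤ))) := by
        refine le_trans ?_ (h1.trans h2)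
        gcongr
      have h6 : c₀⁻¹ * (2 : ℝ) ^ (-(i + (s : ℤ))) <
          C⁻¹ ^ 2 * c₀ * 2 ^ m * (2 : ℝ) ^ (-(i + (s : ℤ))) := by gcongr
      linarith
    rw [tsum_eq_sum (s := Finset.Ico s₀ (s₀ + m)) fun s hs => hsupp s hs]
    calc _ ≤ ∑ s ∈ Finset.Ico s₀ (s₀ + m), (1 : ℝ≥0∞) :=
          Finset.sum_le_sum fun s _ => by split_ifs <;> simp
      _ = m := by simp
  · push Not at hex
    simp [hex]

open Classical in
-- The packing condition counts each set once, whereas sums over generations may repeat it, at most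
-- m times.
lemma tsum_level_subset_le (hE : IsRegular (d : ℝ) C E) (hd : 1 ≤ d) (Δ : DyadicSystem c₀ E)
    (hc : 0 < c₀) (hc1 : c₀ ≤ 1) {m : ℕ} (hm : c₀⁻¹ < C⁻¹ ^ 2 * c₀ * 2 ^ m) (i : ℤ) (T₀ : Set X)
    (g : Set X → ℝ≥0∞) :
    ∑' s : ℕ, ∑' T : {T | T ∈ Δ.level (i + s) ∧ T ⊆ T₀}, g T ≤
      m * ∑' T : {T | T ∈ Δ.cubes ∧ T ⊆ T₀}, g T := by
  have h1 : ∀ s : ℕ, ∑' T : {T | T ∈ Δ.level (i + s) ∧ T ⊆ T₀}, g T ≤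
      ∑' T : {T | T ∈ Δ.cubes ∧ T ⊆ T₀},
        (if (T : Set X) ∈ Δ.level (i + s) then (1 : ℝ≥0∞) else 0) * g T := by
    intro s
    have hsub : {T | T ∈ Δ.level (i + s) ∧ T ⊆ T₀} ⊆ {T | T ∈ Δ.cubes ∧ T ⊆ T₀} :=
      fun T hT => ⟨⟨i + s, hT.1⟩, hT.2⟩
    refine le_trans (ENNReal.tsum_le_tsum fun T => le_of_eq ?_)
      (ENNReal.tsum_comp_le_tsum_of_injective (Set.inclusion_injective hsub) _)
    have hT : (T : Set X) ∈ Δ.level (i + s) := T.2.1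
    simp [hT]
  refine (ENNReal.tsum_le_tsum h1).trans ?_
  rw [ENNReal.tsum_comm, ← ENNReal.tsum_mul_left]
  refine ENNReal.tsum_le_tsum fun T => ?_
  rw [ENNReal.tsum_mul_right]
  gcongr
  exact Δ.tsum_mem_level_le hE hd hc hc1 hm i T

/-- Volume count: the cubes are disjoint, lie in one ball, and each has mass at least
C⁻¹(c₀2^{-j})^d. -/
lemma tsum_one_le [SecondCountableTopology X] (hE : IsRegular (d : ℝ) C E) (Δ : DyadicSystem c₀ E)
    (hc : 0 < c₀) (hc1 : c₀ ≤ 1) {j : ℤ} {𝒬 : Set (Set X)} (h𝒬 : 𝒬 ⊆ Δ.level j) {z : X} (hz : z ∈ E)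
    {R : ℝ} (hR : 0 < R) (hball : ∀ Q ∈ 𝒬, Q ⊆ Metric.ball z (R * (2 : ℝ) ^ (-j))) :
    ∑' _ : 𝒬, (1 : ℝ≥0∞) ≤ ENNReal.ofReal (C * c₀⁻¹ ^ d * (C * R ^ d)) := by
  have hC := hE.one_le
  set L : ℝ := 2 ^ (-j) with hL
  have hL0 : 0 < L := by positivity
  have h1 : ENNReal.ofReal (L ^ d) * ∑' _ : 𝒬, (1 : ℝ≥0∞) ≤
      ENNReal.ofReal (C * c₀⁻¹ ^ d) * ENNReal.ofReal (C * (R * L) ^ d) := by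
    calc _ = ∑' _ : 𝒬, ENNReal.ofReal (L ^ d) := by rw [← ENNReal.tsum_mul_left]; simp
      _ ≤ ∑' Q : 𝒬, ENNReal.ofReal (C * c₀⁻¹ ^ d) * surfaceMeasure (d : ℝ) E Q :=
          ENNReal.tsum_le_tsum fun Q => (Δ.isCube (h𝒬 Q.2)).ofReal_pow_le hE (h𝒬 Q.2).1 hc hc1
      _ ≤ _ := by
          rw [ENNReal.tsum_mul_left]
          gcongr
          exact (Δ.tsum_measure_le hc h𝒬 hball _).trans (hE.measure_ball_le hz (by positivity))
  have hLd : ENNReal.ofReal (L ^ d) ≠ 0 := by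
    rw [Ne, ENNReal.ofReal_eq_zero, not_le]; positivity
  refine (ENNReal.mul_le_mul_iff_right hLd ENNReal.ofReal_ne_top).1 (h1.trans (le_of_eq ?_))
  rw [← ENNReal.ofReal_mul (by positivity), ← ENNReal.ofReal_mul (by positivity)]
  congr 1
  rw [mul_pow]; ring

/-- The cubes of generation `i` meeting the set `F`. -/
def meeting (Δ : DyadicSystem c₀ E) (F : Set X) (i : ℤ) : Set (Set X) :=
  {T | T ∈ Δ.level i ∧ (T ∩ F).Nonempty}

open Classical in
-- After exchanging sums, a fixed T meets 2Q for boundedly many Q of generation j, all of them in a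
-- ball around T. The cubes Q and T may come from different systems.
lemma tsum_touching_le [SecondCountableTopology X] (hE : IsRegular (d : ℝ) C E)
    (Δ Δ' : DyadicSystem c₀ E) (hc : 0 < c₀) (hc1 : c₀ ≤ 1) {k : ℕ} {i j : ℤ} (hij : j - k ≤ i)
    {𝒬 : Set (Set X)} (h𝒬 : 𝒬 ⊆ Δ.level j) {F : Set X} (hF : ∀ Q ∈ 𝒬, dilate E 2 Q ⊆ F)
    (g : Set X → ℝ≥0∞) :
    ∑' Q : 𝒬, ∑' T : Δ'.touching Q i, g T ≤
      ENNReal.ofReal (C * c₀⁻¹ ^ d * (C * ((4 + 2 ^ k) * c₀⁻¹) ^ d)) *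
        ∑' T : Δ'.meeting F i, g T := by
  have h1 : ∀ Q : 𝒬, ∑' T : Δ'.touching Q i, g T ≤ ∑' T : Δ'.meeting F i,
      (if ((T : Set X) ∩ dilate E 2 Q).Nonempty then (1 : ℝ≥0∞) else 0) * g T := by
    intro Q
    have hsub : Δ'.touching Q i ⊆ Δ'.meeting F i :=
      fun T hT => ⟨hT.1, hT.2.mono (Set.inter_subset_inter_right _ (hF Q Q.2))⟩
    refine le_trans (ENNReal.tsum_le_tsum fun T => le_of_eq ?_)
      (ENNReal.tsum_comp_le_tsum_of_injective (Set.inclusion_injective hsub) _)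
    have hT : ((T : Set X) ∩ dilate E 2 Q).Nonempty := T.2.2
    simp [hT]
  refine (ENNReal.tsum_le_tsum h1).trans ?_
  rw [ENNReal.tsum_comm, ← ENNReal.tsum_mul_left]
  refine ENNReal.tsum_le_tsum fun T => ?_
  rw [ENNReal.tsum_mul_right]
  gcongr
  obtain ⟨T, hT, -⟩ := T
  have hTc := Δ'.isCube hT
  obtain ⟨z, hz⟩ := hTc.nonempty hc
  have hL : (2 : ℝ) ^ (-i) ≤ 2 ^ k * 2 ^ (-j) := by
    rw [← zpow_natCast, ← zpow_add₀ two_ne_zero]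
    exact zpow_le_zpow_right₀ one_le_two (by omega)
  have h2 := Δ.tsum_one_le hE hc hc1 (𝒬 := {Q ∈ 𝒬 | (T ∩ dilate E 2 Q).Nonempty})
    (fun Q hQ => h𝒬 hQ.1) (hTc.subset hz) (R := (4 + 2 ^ k) * c₀⁻¹) (by positivity) (by
      rintro Q ⟨hQ, w, hwT, hwQ⟩ y hy
      have hQc := Δ.isCube (h𝒬 hQ)
      have h3 := hQc.dilate_subset_ball hc hwQ (subset_dilate hQc.subset hy)
      have h4 := Metric.dist_le_diam_of_mem hTc.isBounded hwT hz
      have h5 := hTc.diam_le hc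
      rw [Metric.mem_ball] at h3 ⊢
      have h6 := dist_triangle y w z
      have h7 : c₀⁻¹ * (2 : ℝ) ^ (-i) ≤ c₀⁻¹ * (2 ^ k * 2 ^ (-j)) := by gcongr
      linarith)
  refine le_trans (le_of_eq ?_) h2
  rw [tsum_subtype 𝒬 (fun Q => if (T ∩ dilate E 2 Q).Nonempty then (1 : ℝ≥0∞) else 0),
    tsum_subtype {Q ∈ 𝒬 | (T ∩ dilate E 2 Q).Nonempty} (fun _ => (1 : ℝ≥0∞))]
  refine tsum_congr fun Q => ?_
  by_cases h : Q ∈ 𝒬 <;> by_cases h' : (T ∩ dilate E 2 Q).Nonempty <;>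
    simp [Set.indicator, h, h']

/-- Every cube in the sum sits inside a cube T₀ of the first admissible generation from j - k on
that meets the ball. The packing bound applies to each T₀, and these are disjoint within a larger
ball. -/
lemma tsum_meeting_le [SecondCountableTopology X] (hE : IsRegular (d : ℝ) C E) (hd : 1 ≤ d)
    (Δ : DyadicSystem c₀ E) (hc : 0 < c₀) (hc1 : c₀ ≤ 1) {m k : ℕ}
    (hm : c₀⁻¹ < C⁻¹ ^ 2 * c₀ * 2 ^ m) {j : ℤ} (hj : j ∈ generations E) {x : X} (hx : x ∈ E)
    {R : ℝ} (hR : 0 < R) {M : ℝ≥0∞} {g : Set X → ℝ≥0∞}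
    (hg : ∀ T₀ ∈ Δ.cubes, ∑' T : {T | T ∈ Δ.cubes ∧ T ⊆ T₀}, g T ≤
      M * surfaceMeasure (d : ℝ) E T₀) :
    ∑' s : ℕ, ∑' T : Δ.meeting (Metric.ball x (R * (2 : ℝ) ^ (-j))) (j - k + s), g T ≤
      m * (M * ENNReal.ofReal (C * ((R + 2 ^ k * c₀⁻¹) * (2 : ℝ) ^ (-j)) ^ d)) := by
  obtain ⟨t, htk, htG, hfirst, -⟩ := exists_first_generation hj k
  set F := Metric.ball x (R * (2 : ℝ) ^ (-j)) with hF
  set i₀ : ℤ := j - k + t with hi₀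
  have h1 : ∀ s : ℕ, ∑' T : Δ.meeting F (j - k + s), g T ≤
      ∑' T₀ : Δ.meeting F i₀, ∑' T : {T | T ∈ Δ.level (j - k + s) ∧ T ⊆ T₀}, g T := by
    intro s
    refine le_trans (ENNReal.tsum_mono_subtype g ?_) (ENNReal.tsum_iUnion_le_tsum g
      fun T₀ : Δ.meeting F i₀ => {T | T ∈ Δ.level (j - k + s) ∧ T ⊆ T₀})
    rintro T ⟨hT, w, hwT, hwF⟩
    obtain ⟨T₀, hT₀, hwT₀⟩ := Δ.exists_mem_level htG ((Δ.isCube hT).subset hwT)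
    refine Set.mem_iUnion.2 ⟨⟨T₀, hT₀, w, hwT₀, hwF⟩, hT, ?_⟩
    exact Δ.subset_of_mem (hfirst _ hT.1 (by omega)) hT₀ hT hwT₀ hwT
  have hL : (2 : ℝ) ^ (-i₀) ≤ 2 ^ k * 2 ^ (-j) := by
    rw [← zpow_natCast, ← zpow_add₀ two_ne_zero]
    exact zpow_le_zpow_right₀ one_le_two (by omega)
  refine (ENNReal.tsum_le_tsum h1).trans ?_
  rw [ENNReal.tsum_comm]
  calc _ ≤ ∑' T₀ : Δ.meeting F i₀, m * (M * surfaceMeasure (d : ℝ) E T₀) := by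
        refine ENNReal.tsum_le_tsum fun T₀ => ?_
        refine (Δ.tsum_level_subset_le hE hd hc hc1 hm _ _ _).trans ?_
        gcongr
        exact hg T₀ ⟨i₀, T₀.2.1⟩
    _ ≤ _ := by
        rw [ENNReal.tsum_mul_left, ENNReal.tsum_mul_left]
        gcongr
        refine (Δ.tsum_measure_le hc (𝒯 := Δ.meeting F i₀) (fun T hT => hT.1)
          (F := Metric.ball x ((R + 2 ^ k * c₀⁻¹) * (2 : ℝ) ^ (-j))) ?_ _).trans
          (hE.measure_ball_le hx (by positivity))
        rintro T ⟨hT, w, hwT, hwF⟩ y hy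
        have hTc := Δ.isCube hT
        have h4 := Metric.dist_le_diam_of_mem hTc.isBounded hy hwT
        have h5 := hTc.diam_le hc
        rw [hF, Metric.mem_ball] at hwF
        rw [Metric.mem_ball]
        have h6 := dist_triangle y w x
        have h7 : c₀⁻¹ * (2 : ℝ) ^ (-i₀) ≤ c₀⁻¹ * (2 ^ k * 2 ^ (-j)) := by gcongr
        linarith

end DyadicSystem

lemma tsum_tsum_geometric_le (a : ℕ → ℝ≥0∞) :
    ∑' t : ℕ, ∑' N : ℕ, 2⁻¹ ^ N * a (t + N) ≤ 2 * ∑' s : ℕ, a s := by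
  rw [ENNReal.tsum_comm]
  calc _ ≤ ∑' N : ℕ, (2⁻¹ : ℝ≥0∞) ^ N * ∑' s : ℕ, a s := by
        refine ENNReal.tsum_le_tsum fun N => ?_
        rw [ENNReal.tsum_mul_left]
        exact mul_le_mul' le_rfl (ENNReal.tsum_comp_le_tsum_of_injective (add_left_injective N) a)
    _ = _ := by
        rw [ENNReal.tsum_mul_right, ENNReal.tsum_geometric, ENNReal.one_sub_inv_two, inv_inv]

end Packing

/-! ### Conclusion -/

lemma exists_gLem_iota_of_gLem_beta (d : ℕ) (hd : 1 ≤ d) (C p q c₀ : ℝ) (hC : 1 ≤ C)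
    (hp : 1 ≤ p) (hpq : p ≤ q) (hc : 0 < c₀) (hc2 : c₀ ≤ 1 / 2) :
    ∃ K : ℝ, 0 < K ∧ ∀ (n : ℕ) (E : Set (EuclideanSpace ℝ (Fin n))), Nonempty (Planes d n) →
      IsRegular (d : ℝ) C E → ∀ M : ℝ≥0, GLem c₀ (d : ℝ) E (beta d E (2 * p)) (2 * q) M →
        GLem c₀ (d : ℝ) E (iota d E p) q (K.toNNReal * M) := by
  have hc1 : c₀ ≤ 1 := by linarith
  have hκ0 : 0 < C⁻¹ ^ 2 * c₀ := by positivity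
  obtain ⟨k, hk⟩ := pow_unbounded_of_one_lt (3 * c₀⁻¹ / (C⁻¹ ^ 2 * c₀)) (one_lt_two : (1 : ℝ) < 2)
  rw [div_lt_iff₀ hκ0] at hk
  have hk' : 3 * c₀⁻¹ ≤ C⁻¹ ^ 2 * c₀ * 2 ^ k := by linarith
  have hm : c₀⁻¹ < C⁻¹ ^ 2 * c₀ * 2 ^ k := by
    have : 0 < c₀⁻¹ := inv_pos.2 hc
    linarith
  obtain ⟨K, hK, hmain⟩ := exists_ofReal_iota_rpow_mul_measure_le d hd C c₀ p q hC hc hc1 hp hpq k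
    hk'
  set N₀ : ℝ := C * c₀⁻¹ ^ d * (C * ((4 + 2 ^ k) * c₀⁻¹) ^ d) with hN₀
  have hN₀0 : 0 < N₀ := by positivity
  set κ : ℝ := C * (5 * c₀⁻¹ + 2 ^ k * c₀⁻¹) ^ d with hκ
  have hκ0 : 0 < κ := by positivity
  set κ' : ℝ := C * c₀⁻¹ ^ d with hκ'
  have hκ'0 : 0 < κ' := by positivity
  -- The factor k + 1 replaces the multiplicity k so that the constant is visibly positive.
  refine ⟨K * 2 ^ k * N₀ * 2 * (k + 1) * κ * κ', by positivity, ?_⟩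
  intro n E hPl hE M hβ Δ Q₀ hQ₀
  -- The cubes Q stay in Δ, where the conclusion is to be proved; the cubes T carrying β are taken
  -- in Δ', to which the hypothesis also applies.
  set Δ' := Δ.mergeTop hc hc2 hE.isClosed hE.nonempty with hΔ'
  have htop : Δ'.HasTop := Δ.hasTop_mergeTop hc hc2 hE.isClosed hE.nonempty
  set μ := surfaceMeasure (d : ℝ) E with hμ
  obtain ⟨J, hJG, hJ⟩ := hQ₀
  have hQ₀J : Q₀ ∈ Δ.level J := ⟨hJG, hJ⟩
  have hQ₀c := Δ.isCube hQ₀J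
  obtain ⟨x, hx⟩ := hQ₀c.nonempty hc
  have hxE := hQ₀c.subset hx
  set L : ℝ := 2 ^ (-J) with hL
  have hL0 : 0 < L := by positivity
  -- Radius 5c₀⁻¹L: 4c₀⁻¹L for the double of a subcube and c₀⁻¹L for the diameter of Q₀.
  set F := Metric.ball x (5 * c₀⁻¹ * L) with hF
  let B : Set (EuclideanSpace ℝ (Fin n)) → ℝ≥0∞ := fun T =>
    ENNReal.ofReal (beta d E (2 * p) (dilate E 2 T) ^ (2 * q))
  let g : Set (EuclideanSpace ℝ (Fin n)) → ℝ≥0∞ := fun T => B T * μ T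
  let h : Set (EuclideanSpace ℝ (Fin n)) → ℝ≥0∞ := fun Q =>
    ENNReal.ofReal (iota d E p (dilate E 2 Q) ^ q) * μ Q
  let 𝒬 : ℕ → Set (Set (EuclideanSpace ℝ (Fin n))) := fun t =>
    {Q | Q ∈ Δ.level (J + t) ∧ Q ⊆ Q₀}
  have hsplit : ∑' Q : {Q | Q ∈ Δ.cubes ∧ Q ⊆ Q₀}, h Q ≤ ∑' t : ℕ, ∑' Q : 𝒬 t, h Q := by
    refine le_trans (ENNReal.tsum_mono_subtype h ?_) (ENNReal.tsum_iUnion_le_tsum h 𝒬)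
    rintro Q ⟨⟨j, hjG, hQj⟩, hQQ₀⟩
    have hQl : Q ∈ Δ.level j := ⟨hjG, hQj⟩
    rw [Set.mem_iUnion]
    obtain ⟨y, hy⟩ := (Δ.isCube hQl).nonempty hc
    rcases le_or_gt J j with hJj | hJj
    · refine ⟨(j - J).toNat, ?_, hQQ₀⟩
      rwa [Int.toNat_of_nonneg (by omega), add_sub_cancel]
    -- A subset of Q₀ that is a cube of a coarser generation must equal Q₀, so it is counted in
    -- generation J.
    · refine ⟨0, ?_, hQQ₀⟩
      have : Q = Q₀ := hQQ₀.antisymm (Δ.subset_of_mem hJj.le hQl hQ₀J hy (hQQ₀ hy))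
      rw [this]; simpa using hQ₀J
  have hsingle : ∀ (t : ℕ) (Q : Set (EuclideanSpace ℝ (Fin n))), Q ∈ 𝒬 t →
      h Q ≤ ENNReal.ofReal (K * 2 ^ k) * Δ'.weightedSum μ B Q (J + t - k) := by
    rintro t Q ⟨hQ, -⟩
    obtain ⟨t', ht'k, ht'G, -, ht'⟩ := exists_first_generation hQ.1 k
    refine (hmain n E hPl hE Δ' htop (J + t) _ t' Q hQ.1 (Δ.isCube hQ) ht'k rfl ht'G ht').trans ?_
    rw [ENNReal.ofReal_mul hK.le, mul_assoc]
    gcongr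
    refine (Δ'.weightedSum_shift_le μ B Q _ t').trans ?_
    rw [ENNReal.ofReal_pow zero_le_two, ENNReal.ofReal_ofNat]
    gcongr
    exact one_le_two
  have hdil : ∀ (t : ℕ) (Q : Set (EuclideanSpace ℝ (Fin n))), Q ∈ 𝒬 t → dilate E 2 Q ⊆ F := by
    rintro t Q ⟨hQ, hQQ₀⟩ w hw
    have hQc := Δ.isCube hQ
    obtain ⟨y, hy⟩ := hQc.nonempty hc
    have h1 := hQc.dilate_subset_ball hc (subset_dilate hQc.subset hy) hw
    have h2 := Metric.dist_le_diam_of_mem hQ₀c.isBounded (hQQ₀ hy) hx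
    have h3 := hQ₀c.diam_le hc
    have h4 : (2 : ℝ) ^ (-(J + (t : ℤ))) ≤ L := zpow_le_zpow_right₀ one_le_two (by omega)
    have h5 : 4 * c₀⁻¹ * (2 : ℝ) ^ (-(J + (t : ℤ))) ≤ 4 * c₀⁻¹ * L := by gcongr
    rw [Metric.mem_ball] at h1
    rw [hF, Metric.mem_ball]
    have h6 := dist_triangle w y x
    linarith
  let a : ℕ → ℝ≥0∞ := fun s => ∑' T : Δ'.meeting F (J - k + s), g T
  have hlevelsum : ∀ t : ℕ, ∑' Q : 𝒬 t, h Q ≤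
      ENNReal.ofReal (K * 2 ^ k) * (ENNReal.ofReal N₀ * ∑' N : ℕ, 2⁻¹ ^ N * a (t + N)) := by
    intro t
    calc ∑' Q : 𝒬 t, h Q
        ≤ ∑' Q : 𝒬 t, ENNReal.ofReal (K * 2 ^ k) * Δ'.weightedSum μ B Q (J + t - k) :=
          ENNReal.tsum_le_tsum fun Q => hsingle t Q Q.2
      _ = ENNReal.ofReal (K * 2 ^ k) * ∑' N : ℕ, 2⁻¹ ^ N *
            ∑' Q : 𝒬 t, ∑' T : Δ'.touching Q (J + t - k + N), g T := by
          rw [ENNReal.tsum_mul_left]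
          unfold DyadicSystem.weightedSum
          rw [ENNReal.tsum_comm]
          simp_rw [ENNReal.tsum_mul_left]
          rfl
      _ ≤ ENNReal.ofReal (K * 2 ^ k) * ∑' N : ℕ, 2⁻¹ ^ N * (ENNReal.ofReal N₀ * a (t + N)) := by
          gcongr with N
          have h1 := Δ.tsum_touching_le hE Δ' hc hc1 (k := k) (i := J + t - k + N) (j := J + t)
            (by omega) (𝒬 := 𝒬 t) (fun Q hQ => hQ.1) (hdil t) g
          refine h1.trans (le_of_eq ?_)
          have h2 : J + (t : ℤ) - k + N = J - k + ((t + N : ℕ) : ℤ) := by push_cast; ring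
          rw [h2]
      _ = _ := by
          congr 1
          rw [← ENNReal.tsum_mul_left]
          exact tsum_congr fun N => mul_left_comm _ _ _
  have hsum : ∑' s : ℕ, a s ≤ k * (M * ENNReal.ofReal (κ * L ^ d)) := by
    refine (Δ'.tsum_meeting_le hE hd hc hc1 (k := k) hm hJG hxE (R := 5 * c₀⁻¹) (by positivity)
      (M := M) (g := g) ?_).trans (le_of_eq ?_)
    · intro T₀ hT₀
      exact hβ Δ' T₀ hT₀
    · rw [hκ, mul_pow]
      congr 3; ring
  have hmass := hQ₀c.ofReal_pow_le hE hJG hc hc1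
  change ∑' Q : {Q | Q ∈ Δ.cubes ∧ Q ⊆ Q₀}, h Q ≤ _
  calc ∑' Q : {Q | Q ∈ Δ.cubes ∧ Q ⊆ Q₀}, h Q
      ≤ ∑' t : ℕ, ENNReal.ofReal (K * 2 ^ k) *
          (ENNReal.ofReal N₀ * ∑' N : ℕ, 2⁻¹ ^ N * a (t + N)) :=
        hsplit.trans (ENNReal.tsum_le_tsum hlevelsum)
    _ ≤ ENNReal.ofReal (K * 2 ^ k) * (ENNReal.ofReal N₀ * (ENNReal.ofReal 2 *
          (ENNReal.ofReal (k + 1) *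
            (M * (ENNReal.ofReal κ * (ENNReal.ofReal κ' * μ Q₀)))))) := by
        rw [ENNReal.tsum_mul_left, ENNReal.tsum_mul_left]
        gcongr
        refine (tsum_tsum_geometric_le a).trans ?_
        rw [ENNReal.ofReal_ofNat]
        gcongr
        refine hsum.trans ?_
        rw [ENNReal.ofReal_mul hκ0.le]
        gcongr
        rw [ENNReal.ofReal_add (by positivity) zero_le_one, ENNReal.ofReal_natCast]
        exact le_self_add
    _ = _ := by
        have hmul : ENNReal.ofReal (K * 2 ^ k * N₀ * 2 * (k + 1) * κ * κ') =
            ENNReal.ofReal (K * 2 ^ k) * ENNReal.ofReal N₀ * ENNReal.ofReal 2 *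
              ENNReal.ofReal (k + 1) * ENNReal.ofReal κ * ENNReal.ofReal κ' := by
          rw [← ENNReal.ofReal_mul (by positivity), ← ENNReal.ofReal_mul (by positivity),
            ← ENNReal.ofReal_mul (by positivity), ← ENNReal.ofReal_mul (by positivity),
            ← ENNReal.ofReal_mul (by positivity)]
        rw [ENNReal.coe_mul, ← ENNReal.ofReal, hmul]
        ring

end GeometricLemma
end

theorem mainTheorem3 (d : ℕ) (C p q c₀ : ℝ) (hd : 1 ≤ d) (hC : 1 ≤ C)
    (hp : 1 ≤ p) (hpq : p ≤ q) (hc₀ : 0 < c₀) (hc₀' : c₀ ≤ 1 / 2) :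
    ∃ C' : ℝ≥0, ∀ (n : ℕ), d < n → ∀ E : Set (EuclideanSpace ℝ (Fin n)),
      GeometricLemma.IsRegular (d : ℝ) C E → ∀ M : ℝ≥0,
        GeometricLemma.GLem c₀ (d : ℝ) E (GeometricLemma.beta d E (2 * p)) (2 * q) M →
        GeometricLemma.GLem c₀ (d : ℝ) E (GeometricLemma.iota d E p) q (C' * M) := by
  obtain ⟨K, -, h⟩ := GeometricLemma.exists_gLem_iota_of_gLem_beta d hd C p q c₀ hC hp hpq hc₀ hc₀'
  refine ⟨K.toNNReal, fun n hn E hE M hβ => ?_⟩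
  refine h n E ?_ hE M hβ
  -- Since d < n, the span of d independent vectors shows that the infima run over a nonempty family
  -- of planes.
  obtain ⟨f, hf⟩ := exists_linearIndependent_of_le_finrank
    (R := ℝ) (M := EuclideanSpace ℝ (Fin n)) (n := d) (by simpa using hn.le)
  exact ⟨(Submodule.span ℝ (Set.range f)).toAffineSubspace, ⟨⟨0, by simp⟩⟩, by
    rw [Submodule.toAffineSubspace_direction]
    simpa using finrank_span_eq_card hf⟩
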